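/- Let $\mathbb H=\mathbb R^3$ be the Heisenberg group with product $(p,q,t)(p',q',t')=(p+p',q+q',t+t'+\tfrac12(pq'-qp'))$ and Lebesgue measure as Haar measure, and let $(\lambda(x)f)(y)=f(x^{-1}y)$ be its left regular representation on $L^2(\mathbb H)$. For $h\neq 0$ let $\rho_h$ be the Schrödinger representation on $L^2(\mathbb R)$, $$[\rho_h(p,q,t)f](x)=e^{2\pi i ht}e^{2\pi i qx}e^{\pi i hpq}f(x+hp).$$ Let $\mathcal B_2(L^2(\mathbb R))$ be the Hilbert space of Hilbert–Schmidt operators with $\langle S,T\rangle=\operatorname{tr}(T^*S)$, and let $f\mapsto\widehat f=(\widehat f(h))_{h\ne0}$, $L^2(\mathbb H)\to\int^\oplus_{\mathbb R\setminus\{0\}}\mathcal B_2(L^2(\mathbb R))\,|h|\,dh$, be the Plancherel transform, i.e. the continuous extension of $f\mapsto\big(\int_{\mathbb H}f(x)\rho_h(x)\,dx\big)_{h}$ from $L^1(\mathbb H)\cap L^2(\mathbb H)$. Let $d\ge 1$ be an integer, let $\Gamma_d$ be the lattice of $\mathbb H$ generated by $(1,0,0),(0,d,0),(0,0,1)$,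 and let $\Gamma_d^r=\{(m,dk,\tfrac12dmk):m,k\in\mathbb Z\}$. Let $\mathcal H\subset L^2(\mathbb H)$ be a closed left-invariant subspace with orthogonal projection $P$, and let $(\widehat P_h)_{h\neq0}$ be the associated measurable field of orthogonal projections on $L^2(\mathbb R)$, determined up to a null set by $\widehat{Pf}(h)=\widehat f(h)\circ\widehat P_h$ for all $f\in L^2(\mathbb H)$ and almost every $h$. Put $\Sigma(\mathcal H)=\{h\ne0:\widehat P_h\neq0\}$. A family $(\eta_i)_{i\in I}$ in a Hilbert space $\mathcal K$ is called a normalised tight frame of $\mathcal K$ if $\sum_{i}|\langle\varphi,\eta_i\rangle|^2=\|\varphi\|^2$ for all $\varphi\in\mathcal K$. Let $\Phi\in\mathcal H$, and consider, for $h\ne0$, the condition $$(\ast)_h\qquad \big(|h|^{1/2}\rho_h(\gamma)\widehat\Phi(h)\big)_{\gamma\in\Gamma_d^r}\ \text{is a normalised tight frame of } \mathcal B_2(L^2(\mathbb R))\circ\widehat P_h .$$ 1. If $(\lambda(\gamma)\Phi)_{\gamma\in\Gamma_d}$ is a normalised tight frame of $\mathcal H$, then $(\ast)_h$ holds for almost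 every $h$ (in particular for almost every $h\in\Sigma(\mathcal H)$). 2. Conversely, if $(\ast)_h$ holds for almost every $h\in\Sigma(\mathcal H)$ and $\Sigma(\mathcal H)\cap(m+\Sigma(\mathcal H))$ has Lebesgue measure zero for every $m\in\mathbb Z\setminus\{0\}$, then $(\lambda(\gamma)\Phi)_{\gamma\in\Gamma_d}$ is a normalised tight frame of $\mathcal H$. -/

import Mathlib

open MeasureTheory Filter Topology
open scoped ENNReal

noncomputable section

namespace HeisenbergSampling

/-! ### Normalised tight frames -/

/-- `(η i)` is a normalised tight frame of the subspace `K` of `E`: the vectors lie in `K` and the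
coefficient operator `φ ↦ (⟨φ, η i⟩)ᵢ` is an isometry from `K` into `ℓ²(ι)`. -/
def IsNormalisedTightFrame {E ι : Type*} [NormedAddCommGroup E] [InnerProductSpace ℂ E]
    (K : Submodule ℂ E) (η : ι → E) : Prop :=
  (∀ i, η i ∈ K) ∧ ∀ φ ∈ K, HasSum (fun i => ‖inner ℂ (η i) φ‖ ^ 2) (‖φ‖ ^ 2)

/-! ### Hilbert–Schmidt operators -/

section HilbertSchmidt

variable (E : Type*) [NormedAddCommGroup E] [InnerProductSpace ℂ E] [CompleteSpace E]

/-- Index set of a fixed Hilbert basis of `E`. -/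
def basisIndex : Set E := (exists_hilbertBasis ℂ E).choose

/-- A fixed Hilbert basis of `E`; the Hilbert–Schmidt class and inner product do not depend
on it. -/
def basis : HilbertBasis (basisIndex E) ℂ E := (exists_hilbertBasis ℂ E).choose_spec.choose

variable {E} in
theorem memlp_iff (T : E →L[ℂ] E) :
    Memℓp (fun i => T (basis E i)) 2 ↔ Summable fun i => ‖T (basis E i)‖ ^ 2 := by
  rw [memℓp_gen_iff (by norm_num)]
  simp

/-- The bounded operators `T` with `T* T` of trace class, i.e. with
`tr (T* T) = ∑ ‖T eᵢ‖² < ∞`. -/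
def hsSubmodule : Submodule ℂ (E →L[ℂ] E) where
  carrier := {T | Summable fun i => ‖T (basis E i)‖ ^ 2}
  zero_mem' := by simp
  add_mem' {S T} hS hT := (memlp_iff _).1 (((memlp_iff S).2 hS).add ((memlp_iff T).2 hT))
  smul_mem' c T hT := (memlp_iff _).1 (((memlp_iff T).2 hT).const_smul c)

/-- The space `B₂(E)` of Hilbert–Schmidt operators. It is a type synonym, so that it carries the
Hilbert–Schmidt norm and not the operator norm. -/
def HS : Type _ := hsSubmodule E

instance : AddCommGroup (HS E) := inferInstanceAs (AddCommGroup (hsSubmodule E))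

instance : Module ℂ (HS E) := inferInstanceAs (Module ℂ (hsSubmodule E))

namespace HS

variable {E}

/-- A Hilbert–Schmidt operator as a bounded operator. -/
def toCLM : HS E →ₗ[ℂ] (E →L[ℂ] E) := (hsSubmodule E).subtype

variable (E) in
/-- `T ↦ (T eᵢ)ᵢ`, as a map into the Hilbert sum. -/
def columns : HS E →ₗ[ℂ] lp (fun _ : basisIndex E => E) 2 where
  toFun T := ⟨fun i => toCLM T (basis E i), (memlp_iff _).2 T.2⟩
  map_add' _ _ := rfl
  map_smul' _ _ := rfl

theorem columns_injective : Function.Injective (columns E) := by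
  intro S T h
  have h1 : ∀ i, toCLM S (basis E i) = toCLM T (basis E i) := fun i =>
    congrFun (congrArg Subtype.val h) i
  refine Subtype.ext (ContinuousLinearMap.ext_on
    (s := Set.range (basis E)) ?_ ?_)
  · rw [dense_iff_closure_eq, ← Submodule.topologicalClosure_coe, (basis E).dense_span]
    rfl
  · rintro _ ⟨i, rfl⟩
    exact h1 i

instance : NormedAddCommGroup (HS E) :=
  NormedAddCommGroup.induced (HS E) (lp (fun _ : basisIndex E => E) 2) (columns E)
    columns_injective

instance : InnerProductSpace ℂ (HS E) := InnerProductSpace.induced (columns E)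

/-- The inner product is `⟨S, T⟩ = tr (T* S) = ∑ ⟨S eᵢ, T eᵢ⟩`; note that `inner ℂ` is linear in its
second argument. -/
theorem inner_eq_tsum (S T : HS E) :
    inner ℂ T S = ∑' i, inner ℂ (toCLM T (basis E i)) (toCLM S (basis E i)) := rfl

/-- Composition `A ∘ T` with a bounded operator on the left. -/
def lcomp (A : E →L[ℂ] E) (T : HS E) : HS E :=
  ⟨A ∘L toCLM T, by
    refine Summable.of_nonneg_of_le (fun _ => by positivity) (fun i => ?_)
      ((show Summable fun i => ‖toCLM T (basis E i)‖ ^ 2 from T.2).mul_left (‖A‖ ^ 2))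
    rw [← mul_pow]
    exact pow_le_pow_left₀ (norm_nonneg _) (A.le_opNorm _) 2⟩

/-- The subspace `B₂(E) ∘ P` of `B₂(E)`. -/
def rightMul (P : E →L[ℂ] E) : Submodule ℂ (HS E) where
  carrier := {T | ∃ S : HS E, toCLM T = toCLM S ∘L P}
  zero_mem' := ⟨0, by simp⟩
  add_mem' := by
    rintro _ _ ⟨S, hS⟩ ⟨S', hS'⟩
    exact ⟨S + S', by rw [map_add, map_add, hS, hS', ContinuousLinearMap.add_comp]⟩
  smul_mem' := by
    rintro c _ ⟨S, hS⟩
    exact ⟨c • S, by rw [map_smul, map_smul, hS, ContinuousLinearMap.smul_comp]⟩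

end HS

end HilbertSchmidt

/-! ### The Heisenberg group and its left regular representation -/

/-- The Heisenberg group, in the coordinates `(p, q, t)` with respect to the basis `P, Q, Z` of the
Lie algebra. -/
def Heis : Type := ℝ × ℝ × ℝ

namespace Heis

/-- Lebesgue measure on `ℝ³` is the Haar measure. -/
instance : MeasureSpace Heis := inferInstanceAs (MeasureSpace (ℝ × ℝ × ℝ))

/-- The element with coordinates `(p, q, t)`. -/
def mk (p q t : ℝ) : Heis := (p, q, t)

/-- First coordinate. -/
def p (x : Heis) : ℝ := x.1

/-- Second coordinate. -/
def q (x : Heis) : ℝ := x.2.1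

/-- Central coordinate. -/
def t (x : Heis) : ℝ := x.2.2

theorem ext {x y : Heis} (hp : x.p = y.p) (hq : x.q = y.q) (ht : x.t = y.t) : x = y :=
  Prod.ext hp (Prod.ext hq ht)

instance : Mul Heis :=
  ⟨fun x y => mk (x.p + y.p) (x.q + y.q) (x.t + y.t + (x.p * y.q - x.q * y.p) / 2)⟩

instance : One Heis := ⟨mk 0 0 0⟩

instance : Inv Heis := ⟨fun x => mk (-x.p) (-x.q) (-x.t)⟩

theorem mul_p (x y : Heis) : (x * y).p = x.p + y.p := rfl

theorem mul_q (x y : Heis) : (x * y).q = x.q + y.q := rfl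

theorem mul_t (x y : Heis) : (x * y).t = x.t + y.t + (x.p * y.q - x.q * y.p) / 2 := rfl

instance : Group Heis :=
  Group.ofLeftAxioms
    (fun x y z => by
      apply ext <;> simp only [mul_p, mul_q, mul_t] <;> ring)
    (fun x => by
      have hp : (1 : Heis).p = 0 := rfl
      have hq : (1 : Heis).q = 0 := rfl
      have ht : (1 : Heis).t = 0 := rfl
      apply ext <;> simp only [mul_p, mul_q, mul_t, hp, hq, ht] <;> ring)
    (fun x => by
      have hp : (x⁻¹).p = -x.p := rfl
      have hq : (x⁻¹).q = -x.q := rfl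
      have ht : (x⁻¹).t = -x.t := rfl
      apply ext
      · rw [mul_p, hp]; exact neg_add_cancel _
      · rw [mul_q, hq]; exact neg_add_cancel _
      · rw [mul_t, hp, hq, ht]
        show _ = (0 : ℝ)
        ring)

theorem measurePreserving_mul_left (x : Heis) :
    MeasurePreserving (fun y : Heis => x * y) volume volume := by
  have key : MeasurePreserving
      (fun y : ℝ × ℝ × ℝ => (x.p + y.1, ((fun (a : ℝ) (z : ℝ × ℝ) =>
        (x.q + z.1, (x.t + (x.p * z.1 - x.q * a) / 2) + z.2)) y.1 y.2)))
      ((volume : Measure ℝ).prod ((volume : Measure ℝ).prod (volume : Measure ℝ)))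
      ((volume : Measure ℝ).prod ((volume : Measure ℝ).prod (volume : Measure ℝ))) := by
    refine (measurePreserving_add_left volume x.p).skew_product
      (g := fun (a : ℝ) (z : ℝ × ℝ) => (x.q + z.1, (x.t + (x.p * z.1 - x.q * a) / 2) + z.2))
      (by unfold Function.uncurry; fun_prop)
      (ae_of_all _ fun a => ?_)
    refine ((measurePreserving_add_left volume x.q).skew_product
      (g := fun b c => (x.t + (x.p * b - x.q * a) / 2) + c)
      (by unfold Function.uncurry; fun_prop)
      (ae_of_all _ fun b => ?_)).map_eq
    exact (measurePreserving_add_left volume _).map_eq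
  have heq : (fun y : Heis => x * y) = (fun y : ℝ × ℝ × ℝ => (x.p + y.1,
      ((fun (a : ℝ) (z : ℝ × ℝ) =>
        (x.q + z.1, (x.t + (x.p * z.1 - x.q * a) / 2) + z.2)) y.1 y.2))) := by
    funext y
    refine ext rfl rfl ?_
    rw [mul_t]
    simp only [p, q, t]
    ring
  rw [heq]
  exact key

end Heis

/-- `L²(ℍ)`. -/
abbrev L2H : Type := Lp ℂ 2 (volume : Measure Heis)

/-- `L²(ℝ)`. -/
abbrev L2R : Type := Lp ℂ 2 (volume : Measure ℝ)

/-- The left regular representation, `(λ(x) f)(y) = f (x⁻¹ y)`. -/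
def leftReg (x : Heis) : L2H →ₗᵢ[ℂ] L2H :=
  Lp.compMeasurePreservingₗᵢ ℂ (fun y => x⁻¹ * y) (Heis.measurePreserving_mul_left x⁻¹)

/-- The lattice `Γ_d`, generated by `P`, `dQ` and `Z`. -/
def lattice (d : ℕ) : Subgroup Heis :=
  Subgroup.closure {Heis.mk 1 0 0, Heis.mk 0 d 0, Heis.mk 0 0 1}

/-- The reduced lattice `Γ_d^r = {(m, dk, dmk/2) : m, k ∈ ℤ}`. -/
def reducedLattice (d : ℕ) : Set Heis :=
  Set.range fun n : ℤ × ℤ => Heis.mk n.1 (d * n.2) (d * n.1 * n.2 / 2)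

/-! ### Schrödinger representations -/

/-- The phase factor `e^{2πi h t} e^{2πi q x} e^{πi h p q}`. -/
def phase (h : ℝ) (g : Heis) (x : ℝ) : ℂ :=
  Complex.exp (2 * Real.pi * Complex.I * h * g.t) * Complex.exp (2 * Real.pi * Complex.I * g.q * x) *
    Complex.exp (Real.pi * Complex.I * h * g.p * g.q)

theorem norm_phase (h : ℝ) (g : Heis) (x : ℝ) : ‖phase h g x‖ = 1 := by
  simp [phase, Complex.norm_exp]

theorem measurable_phase (h : ℝ) (g : Heis) : Measurable (phase h g) := by
  unfold phase
  fun_prop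

theorem memLp_phase_mul (h : ℝ) (g : Heis) (f : L2R) :
    MemLp (fun x => phase h g x * f x) 2 volume :=
  (Lp.memLp f).of_le ((measurable_phase h g).aestronglyMeasurable.mul (Lp.aestronglyMeasurable f))
    (ae_of_all _ fun x => by simp [norm_phase])

/-- Multiplication by the phase factor. -/
def phaseMul (h : ℝ) (g : Heis) : L2R →ₗᵢ[ℂ] L2R where
  toFun f := (memLp_phase_mul h g f).toLp
  map_add' f₁ f₂ := by
    rw [← MemLp.toLp_add]
    refine MemLp.toLp_congr _ _ ?_
    filter_upwards [Lp.coeFn_add f₁ f₂] with x hx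
    rw [hx]
    exact mul_add _ _ _
  map_smul' c f := by
    rw [RingHom.id_apply, ← MemLp.toLp_const_smul]
    refine MemLp.toLp_congr _ _ ?_
    filter_upwards [Lp.coeFn_smul c f] with x hx
    simp [hx, mul_left_comm]
  norm_map' f := by
    show ‖(memLp_phase_mul h g f).toLp‖ = ‖f‖
    rw [Lp.norm_toLp, Lp.norm_def]
    congr 1
    exact eLpNorm_congr_norm_ae (ae_of_all _ fun x => by simp [norm_phase])

/-- The Schrödinger representation
`(ρ_h(p,q,t) f)(x) = e^{2πi h t} e^{2πi q x} e^{πi h p q} f (x + h p)`. -/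
def schrodinger (h : ℝ) (g : Heis) : L2R →L[ℂ] L2R :=
  ((phaseMul h g).comp (Lp.compMeasurePreservingₗᵢ ℂ (fun x => x + h * g.p)
    (measurePreserving_add_right volume (h * g.p)))).toContinuousLinearMap

theorem schrodinger_apply (h : ℝ) (g : Heis) (f : L2R) :
    schrodinger h g f =ᵐ[volume] fun x => Complex.exp (2 * Real.pi * Complex.I * h * g.t) *
      Complex.exp (2 * Real.pi * Complex.I * g.q * x) *
      Complex.exp (Real.pi * Complex.I * h * g.p * g.q) * f (x + h * g.p) := by
  have h1 := MemLp.coeFn_toLp (memLp_phase_mul h g (Lp.compMeasurePreservingₗᵢ ℂ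
    (fun x => x + h * g.p) (measurePreserving_add_right volume (h * g.p)) f))
  have h2 := Lp.coeFn_compMeasurePreserving f (measurePreserving_add_right volume (h * g.p))
  refine h1.trans ?_
  filter_upwards [h2] with x hx
  exact congrArg _ hx

/-! ### The Plancherel transform -/

open Classical in
/-- The Fourier transform of `f` at `h`: the Hilbert–Schmidt operator
`ρ_h(f) = ∫ f(x) ρ_h(x) dx`, the integral being taken in the weak operator sense. -/
def fourier (f : L2H) (h : ℝ) : HS L2R :=
  if ex : ∃ T : HS L2R, ∀ φ ψ : L2R,
      inner ℂ ψ (T.toCLM φ) = ∫ x : Heis, f x * inner ℂ ψ (schrodinger h x φ) then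
    ex.choose
  else 0

/-- The Plancherel measure `|h| dh`; the point `0` is a null set. -/
def plancherelMeasure : Measure ℝ := volume.withDensity fun h => ENNReal.ofReal |h|

/-- The direct integral of the constant field `B₂(L²(ℝ))` with respect to `|h| dh`. -/
abbrev DirectIntegral : Type := Lp (HS L2R) 2 plancherelMeasure

open Classical in
/-- The operator field `h ↦ ρ_h(f)` as an element of the direct integral. -/
def fourierField (f : L2H) : DirectIntegral :=
  if hf : MemLp (fourier f) 2 plancherelMeasure then hf.toLp else 0

/-- The Plancherel transform: the extension by continuity to `L²(ℍ)` of the Fourier transform on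
`L¹(ℍ) ∩ L²(ℍ)`. -/
def plancherel : L2H → DirectIntegral :=
  extendFrom {f : L2H | Integrable f volume} fourierField

/-! ### The projection field of a left-invariant subspace -/

/-- `(P_h)` is a measurable field of orthogonal projections on `L²(ℝ)` that decomposes the orthogonal
projection of `L²(ℍ)` onto `H`: whenever `g` is the orthogonal projection of `f` onto `H`,
`ĝ(h) = f̂(h) ∘ P_h` for almost every `h`. -/
structure IsProjectionField (H : Submodule ℂ L2H) (P : ℝ → L2R →L[ℂ] L2R) : Prop where
  isStarProjection : ∀ h, IsStarProjection (P h)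
  measurable : ∀ v : L2R, AEStronglyMeasurable (fun h => P h v) volume
  decomposes : ∀ f g : L2H, g ∈ H → f - g ∈ Hᗮ →
    ∀ᵐ h : ℝ, (plancherel g h).toCLM = (plancherel f h).toCLM ∘L P h

open Classical in
/-- The field of projections associated with `H`, which is unique up to a null set. -/
def projectionField (H : Submodule ℂ L2H) : ℝ → L2R →L[ℂ] L2R :=
  if ex : ∃ P, IsProjectionField H P then ex.choose else 0

/-- The spectral support `Σ(H) = {h ≠ 0 : P_h ≠ 0}`. -/
def spectralSupport (H : Submodule ℂ L2H) : Set ℝ := {h | h ≠ 0 ∧ projectionField H h ≠ 0}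

/-- The condition at `h`: the system `|h|^{1/2} ρ_h(γ) Φ̂(h)`, `γ ∈ Γ_d^r`, is a normalised tight
frame of `B₂(L²(ℝ)) ∘ P_h`. -/
def FibreCondition (d : ℕ) (H : Submodule ℂ L2H) (Φ : L2H) (h : ℝ) : Prop :=
  IsNormalisedTightFrame (HS.rightMul (projectionField H h)) fun γ : reducedLattice d =>
    ((Real.sqrt |h| : ℝ) : ℂ) • HS.lcomp (schrodinger h γ) (plancherel Φ h)

/-- The support condition: `Σ(H) ∩ (m + Σ(H))` is a null set for all integers `m ≠ 0`. -/
def SupportCondition (H : Submodule ℂ L2H) : Prop :=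
  ∀ m : ℤ, m ≠ 0 →
    volume (spectralSupport H ∩ (fun h : ℝ => (m : ℝ) + h) '' spectralSupport H) = 0

end HeisenbergSampling

end

/-! The Plancherel transform is unitary and turns `leftReg x` into left composition with
`schrodinger h x` in almost every fibre. A lattice point `(m, dk, dmk/2 + l)` is a reduced lattice
point times the central element `(0, 0, l)`, and the centre acts in the fibre over `h` by the scalar
`e^{2πihl}`. Hence, with `n = (m, k)` fixed, the frame coefficients of `f` are the integrals `∫
e^{-2πihl} cₙ(h) dh`, where `cₙ(h) = |h| ⟨ρ_h(γₙ) Φ̂(h), f̂(h)⟩`. These are the Fourier coefficients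
of the 1-periodisation of `cₙ`.

If the integer translates of `cₙ` have disjoint supports, the periodisation has no cross terms, and
Parseval gives `∑ₗ |⟨λ(γ)Φ, f⟩|² = ∫ |cₙ|²`. Summing over `n` gives `∫ |h| ∑ₙ |⟨|h|^{1/2} ρ_h(γₙ)
Φ̂(h), f̂(h)⟩|² dh`, to be compared with `‖f‖² = ∫ |h| ‖f̂(h)‖² dh` (`tsum_enorm_inner_leftReg`).

For the converse direction, the support condition gives the disjointness, because `f̂` vanishes off
the spectral support, and the fibre condition makes the two integrands equal. For the direct one,
disjointness is forced by the choice of `f`: its transform is `T ∘ P_h` cut off to a subset of an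
interval of length one. Varying the cut-off set turns equality of integrals into equality almost
everywhere. Countably many `T` and countably many pieces of the line leave a single null set, and
density extends the identity to every `T` (`hasSum_fibreFrame_of_frame`,
`hasSum_inner_sq_of_dense`).

Two facts behind this are proved from scratch. The Plancherel theorem (`plancherel_eq`) is obtained
by building the inverse transform as a unitary operator: matrix coefficients of the Schrödinger
representation form a Hilbert basis of `L²(ℝ²)` for each `h` (`isBasisField_coeff`), and a Fourier
transform in `h` restores the central variable. The field of projections exists
(`exists_isProjectionField`) because a projection commuting with left translations can only act on
the right of each fibre. This is read off from its action on rank one fields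
(`rankOne_ae_of_inner_leftReg`). -/

noncomputable section

namespace HeisenbergSampling

open scoped ComplexConjugate FourierTransform SchwartzMap

set_option linter.unusedSectionVars false

/-! ### Hilbert sums and Hilbert bases -/

section HilbertSum

variable {κ ι : Type*} {G : ι → Type*} [∀ i, NormedAddCommGroup (G i)]
  [∀ i, InnerProductSpace ℂ (G i)] {E F : Type*} [NormedAddCommGroup E] [InnerProductSpace ℂ E]
  [NormedAddCommGroup F] [InnerProductSpace ℂ F]
  {V : ∀ i, G i →ₗᵢ[ℂ] E} {W : ∀ i, G i →ₗᵢ[ℂ] F}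

/-- The image of a Hilbert basis under a unitary operator. -/
def mapBasis (b : HilbertBasis κ ℂ E) (e : E ≃ₗᵢ[ℂ] F) : HilbertBasis κ ℂ F :=
  HilbertBasis.ofRepr (e.symm.trans b.repr)

theorem mapBasis_apply (b : HilbertBasis κ ℂ E) (e : E ≃ₗᵢ[ℂ] F) (k : κ) :
    mapBasis b e k = e (b k) := by
  classical
  rw [← (mapBasis b e).repr_symm_single, ← b.repr_symm_single]
  rfl

theorem eq_zero_of_basis_inner (b : HilbertBasis κ ℂ E) {x : E}
    (h : ∀ k, inner ℂ (b k) x = 0) : x = 0 := by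
  apply b.repr.injective
  ext k
  simp [b.repr_apply_apply, h k]

/-- Orthonormal vectors are at mutual distance `√2`, so balls of radius `1/2` around them are
disjoint, and a separable space holds only countably many. Countability is what later allows a
single null set for all basis indices. -/
theorem countable_of_orthonormal [TopologicalSpace.SeparableSpace E] {v : κ → E}
    (hv : Orthonormal ℂ v) : Countable κ := by
  have hd : ∀ i j, i ≠ j → dist (v i) (v j) ^ 2 = 2 := by
    intro i j hij
    rw [dist_eq_norm, norm_sub_sq (𝕜 := ℂ), hv.1 i, hv.1 j, hv.2 hij]
    norm_num
  have hpd : Set.PairwiseDisjoint (Set.univ : Set κ) fun i => Metric.ball (v i) (1 / 2) := by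
    intro i _ j _ hij
    apply Metric.ball_disjoint_ball
    have := hd i j hij
    have h0 : 0 ≤ dist (v i) (v j) := dist_nonneg
    nlinarith
  exact Set.countable_univ_iff.1 (hpd.countable_of_isOpen (fun i _ => Metric.isOpen_ball)
    (fun i _ => ⟨v i, by simp⟩))

variable [CompleteSpace E] [CompleteSpace F]

/-- Two Hilbert sums of the same family are unitarily equivalent. -/
def hilbertSumEquiv (hV : IsHilbertSum ℂ G V) (hW : IsHilbertSum ℂ G W) : E ≃ₗᵢ[ℂ] F :=
  hV.linearIsometryEquiv.trans hW.linearIsometryEquiv.symm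

theorem hilbertSumEquiv_apply (hV : IsHilbertSum ℂ G V) (hW : IsHilbertSum ℂ G W) (i : ι)
    (g : G i) : hilbertSumEquiv hV hW (V i g) = W i g := by
  classical
  have h := congrArg hV.linearIsometryEquiv (hV.linearIsometryEquiv_symm_apply_single g)
  rw [LinearIsometryEquiv.apply_symm_apply] at h
  rw [← hW.linearIsometryEquiv_symm_apply_single, h]
  rfl

theorem isHilbertSum_of_orthogonal [∀ i, CompleteSpace (G i)]
    (h1 : ∀ i j, i ≠ j → ∀ a b, inner ℂ (V i a) (V j b) = 0)
    (h2 : ∀ x, (∀ i a, inner ℂ (V i a) x = 0) → x = 0) : IsHilbertSum ℂ G V := by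
  refine IsHilbertSum.mk (fun i j hij a b => h1 i j hij a b) ?_
  rw [top_le_iff, Submodule.topologicalClosure_eq_top_iff, Submodule.eq_bot_iff]
  intro x hx
  refine h2 x fun i a => ?_
  exact (Submodule.mem_orthogonal _ _).1 hx _
    (Submodule.mem_iSup_of_mem i (LinearMap.mem_range_self _ a))

theorem exists_basis {v : κ → E} (hv : Orthonormal ℂ v)
    (ht : ∀ x, (∀ k, inner ℂ (v k) x = 0) → x = 0) :
    ∃ b : HilbertBasis κ ℂ E, ∀ k, b k = v k := by
  refine ⟨HilbertBasis.mkOfOrthogonalEqBot hv ?_, fun k => by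
    rw [HilbertBasis.coe_mkOfOrthogonalEqBot]⟩
  rw [Submodule.eq_bot_iff]
  intro x hx
  exact ht x fun k => (Submodule.mem_orthogonal _ _).1 hx _ (Submodule.subset_span ⟨k, rfl⟩)

end HilbertSum

/-! ### Weighted composition operators -/

section Weighted

variable {Y Y' : Type*} [MeasurableSpace Y] [MeasurableSpace Y']

theorem eLpNorm_two_eq {E : Type*} [NormedAddCommGroup E] (f : Y → E) (ν : Measure Y) :
    eLpNorm f 2 ν = (∫⁻ y, ‖f y‖ₑ ^ 2 ∂ν) ^ (1 / 2 : ℝ) := by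
  rw [eLpNorm_eq_lintegral_rpow_enorm_toReal (by norm_num) (by norm_num)]
  simp

theorem memLp_two_iff {E : Type*} [NormedAddCommGroup E] {f : Y → E} {ν : Measure Y}
    (hf : AEStronglyMeasurable f ν) : MemLp f 2 ν ↔ ∫⁻ y, ‖f y‖ₑ ^ 2 ∂ν < ∞ := by
  rw [MemLp, eLpNorm_two_eq]
  simp [hf, ENNReal.rpow_lt_top_iff_of_pos]

theorem norm_sq_eq_lintegral {E : Type*} [NormedAddCommGroup E] {ν : Measure Y} (f : Lp E 2 ν) :
    ENNReal.ofReal (‖f‖ ^ 2) = ∫⁻ y, ‖f y‖ₑ ^ 2 ∂ν := by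
  rw [Lp.norm_def, ← ENNReal.toReal_pow, ENNReal.ofReal_toReal, eLpNorm_two_eq, ← ENNReal.rpow_natCast,
    ← ENNReal.rpow_mul]
  · simp
  · exact ENNReal.pow_ne_top (Lp.eLpNorm_ne_top f)

variable {ν : Measure Y} {ν' : Measure Y'} (T : Y ≃ᵐ Y') (s : Y → ℂ)

theorem lintegral_weighted {T : Y ≃ᵐ Y'} {s : Y → ℂ} (hs : Measurable s)
    (hmap : (ν.withDensity fun y => ‖s y‖ₑ ^ 2).map T = ν') (g : Y' → ℂ) :
    ∫⁻ y, ‖s y * g (T y)‖ₑ ^ 2 ∂ν = ∫⁻ y, ‖g y‖ₑ ^ 2 ∂ν' := by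
  rw [← hmap, lintegral_map_equiv, lintegral_withDensity_eq_lintegral_mul_non_measurable]
  · simp [mul_pow]
  · fun_prop
  · exact ae_of_all _ fun y => by finiteness

/-- As `s` vanishes nowhere, `ν` and `|s|² ν` have the same null sets, so `ν'`-null sets pull back
to `ν`-null sets. This makes `g ↦ s · (g ∘ T)` well defined on classes. -/
theorem ae_weighted {T : Y ≃ᵐ Y'} {s : Y → ℂ} (hs : Measurable s) (hs0 : ∀ y, s y ≠ 0)
    (hmap : (ν.withDensity fun y => ‖s y‖ₑ ^ 2).map T = ν') {p : Y' → Prop}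
    (hp : ∀ᵐ y ∂ν', p y) : ∀ᵐ y ∂ν, p (T y) := by
  have hac : ν ≪ ν.withDensity fun y => ‖s y‖ₑ ^ 2 :=
    withDensity_absolutelyContinuous' (by fun_prop) (ae_of_all _ fun y => by simp [hs0])
  have h1 : ∀ᵐ y ∂(ν.withDensity fun y => ‖s y‖ₑ ^ 2), p (T y) := by
    rw [← hmap] at hp
    exact ae_of_ae_map T.measurable.aemeasurable hp
  exact hac h1

theorem aestronglyMeasurable_weighted {T : Y ≃ᵐ Y'} {s : Y → ℂ} (hs : Measurable s)
    (hs0 : ∀ y, s y ≠ 0) (hmap : (ν.withDensity fun y => ‖s y‖ₑ ^ 2).map T = ν') {g : Y' → ℂ}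
    (hg : AEStronglyMeasurable g ν') : AEStronglyMeasurable (fun y => s y * g (T y)) ν := by
  refine hs.aestronglyMeasurable.mul ?_
  refine ⟨fun y => hg.mk g (T y), hg.stronglyMeasurable_mk.comp_measurable T.measurable, ?_⟩
  exact ae_weighted hs hs0 hmap hg.ae_eq_mk

theorem memLp_weighted {T : Y ≃ᵐ Y'} {s : Y → ℂ} (hs : Measurable s)
    (hs0 : ∀ y, s y ≠ 0) (hmap : (ν.withDensity fun y => ‖s y‖ₑ ^ 2).map T = ν') {g : Y' → ℂ}
    (hg : MemLp g 2 ν') : MemLp (fun y => s y * g (T y)) 2 ν := by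
  rw [memLp_two_iff (aestronglyMeasurable_weighted hs hs0 hmap hg.1), lintegral_weighted hs hmap]
  exact (memLp_two_iff hg.1).1 hg

/-- The unitary operator `g ↦ s · (g ∘ T)`, where `T` carries `|s|² ν` to `ν'`. -/
def weightedComp (hs : Measurable s) (hs0 : ∀ y, s y ≠ 0)
    (hmap : (ν.withDensity fun y => ‖s y‖ₑ ^ 2).map T = ν') : Lp ℂ 2 ν' ≃ₗᵢ[ℂ] Lp ℂ 2 ν :=
  LinearIsometryEquiv.ofSurjective
    { toFun := fun g => (memLp_weighted hs hs0 hmap (Lp.memLp g)).toLp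
      map_add' := fun f g => by
        rw [← MemLp.toLp_add]
        refine MemLp.toLp_congr _ _ ?_
        filter_upwards [ae_weighted hs hs0 hmap (Lp.coeFn_add f g)] with y hy
        rw [hy]
        exact mul_add _ _ _
      map_smul' := fun c f => by
        rw [RingHom.id_apply, ← MemLp.toLp_const_smul]
        refine MemLp.toLp_congr _ _ ?_
        filter_upwards [ae_weighted hs hs0 hmap (Lp.coeFn_smul c f)] with y hy
        simp [hy, mul_left_comm]
      norm_map' := fun g => by
        show ‖(memLp_weighted hs hs0 hmap (Lp.memLp g)).toLp‖ = ‖g‖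
        rw [Lp.norm_toLp, Lp.norm_def, eLpNorm_two_eq, eLpNorm_two_eq, lintegral_weighted hs hmap] }
    (by
      intro f
      have hq : Measure.QuasiMeasurePreserving T.symm ν' ν := by
        refine ⟨T.symm.measurable, ?_⟩
        rw [← hmap, Measure.map_map T.symm.measurable T.measurable, T.symm_comp_self,
          Measure.map_id]
        exact withDensity_absolutelyContinuous _ _
      have hm : AEStronglyMeasurable (fun y' => (s (T.symm y'))⁻¹ * f (T.symm y')) ν' :=
        (hs.inv.aestronglyMeasurable.mul
          (Lp.aestronglyMeasurable f)).comp_quasiMeasurePreserving hq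
      have he : ∀ y, s y * ((s (T.symm (T y)))⁻¹ * f (T.symm (T y))) = f y := fun y => by
        rw [T.symm_apply_apply, mul_inv_cancel_left₀ (hs0 y)]
      have hL : MemLp (fun y' => (s (T.symm y'))⁻¹ * f (T.symm y')) 2 ν' := by
        rw [memLp_two_iff hm, ← lintegral_weighted hs hmap]
        simp_rw [he]
        exact (memLp_two_iff (Lp.aestronglyMeasurable f)).1 (Lp.memLp f)
      refine ⟨hL.toLp, ?_⟩
      refine Lp.ext ((memLp_weighted hs hs0 hmap (Lp.memLp hL.toLp)).coeFn_toLp.trans ?_)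
      filter_upwards [ae_weighted hs hs0 hmap hL.coeFn_toLp] with y hy
      rw [hy, he])

theorem coeFn_weightedComp (hs : Measurable s) (hs0 : ∀ y, s y ≠ 0)
    (hmap : (ν.withDensity fun y => ‖s y‖ₑ ^ 2).map T = ν') (g : Lp ℂ 2 ν') :
    weightedComp T s hs hs0 hmap g =ᵐ[ν] fun y => s y * g (T y) :=
  (memLp_weighted hs hs0 hmap (Lp.memLp g)).coeFn_toLp

end Weighted

/-! ### Hilbert space valued fields and `L²` of a product -/

section Field

variable {X Y ι : Type*} [MeasurableSpace X] [MeasurableSpace Y] {μ : Measure X} {ν : Measure Y}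
  [SigmaFinite μ] [SigmaFinite ν]

theorem ae_fst {p : X → Prop} (h : ∀ᵐ x ∂μ, p x) : ∀ᵐ z ∂μ.prod ν, p z.1 :=
  Measure.quasiMeasurePreserving_fst.ae h

theorem ae_snd {p : Y → Prop} (h : ∀ᵐ y ∂ν, p y) : ∀ᵐ z ∂μ.prod ν, p z.2 :=
  Measure.quasiMeasurePreserving_snd.ae h

theorem lintegral_field {κ : X × Y → ℂ} (hκ : Measurable κ)
    (h1 : ∀ᵐ x ∂μ, ∫⁻ y, ‖κ (x, y)‖ₑ ^ 2 ∂ν = 1) {f : X → ℂ} (hf : AEStronglyMeasurable f μ) :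
    ∫⁻ z, ‖f z.1 * κ z‖ₑ ^ 2 ∂μ.prod ν = ∫⁻ x, ‖f x‖ₑ ^ 2 ∂μ := by
  rw [lintegral_prod _ (by
    have : AEStronglyMeasurable (fun z : X × Y => f z.1) (μ.prod ν) := hf.comp_fst
    exact ((this.mul hκ.aestronglyMeasurable).enorm.pow_const 2))]
  apply lintegral_congr_ae
  filter_upwards [h1] with x hx
  simp only [enorm_mul, mul_pow]
  rw [lintegral_const_mul _ (by fun_prop), hx, mul_one]

theorem memLp_field {κ : X × Y → ℂ} (hκ : Measurable κ)
    (h1 : ∀ᵐ x ∂μ, ∫⁻ y, ‖κ (x, y)‖ₑ ^ 2 ∂ν = 1) {f : X → ℂ} (hf : MemLp f 2 μ) :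
    MemLp (fun z : X × Y => f z.1 * κ z) 2 (μ.prod ν) := by
  have : AEStronglyMeasurable (fun z : X × Y => f z.1) (μ.prod ν) := hf.1.comp_fst
  refine (memLp_two_iff (this.mul hκ.aestronglyMeasurable)).2 ?_
  exact (lintegral_field hκ h1 hf.1).trans_lt ((memLp_two_iff hf.1).1 hf)

/-- The isometry `f ↦ f(x) κ(x, y)` given by a field `x ↦ κ(x, ·)` of unit vectors. -/
def fieldMul (κ : X × Y → ℂ) (hκ : Measurable κ) (h1 : ∀ᵐ x ∂μ, ∫⁻ y, ‖κ (x, y)‖ₑ ^ 2 ∂ν = 1) :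
    Lp ℂ 2 μ →ₗᵢ[ℂ] Lp ℂ 2 (μ.prod ν) where
  toFun f := (memLp_field hκ h1 (Lp.memLp f)).toLp
  map_add' f g := by
    rw [← MemLp.toLp_add]
    refine MemLp.toLp_congr _ _ ?_
    filter_upwards [ae_fst (Lp.coeFn_add f g)] with y hy
    rw [hy]
    exact add_mul _ _ _
  map_smul' c f := by
    rw [RingHom.id_apply, ← MemLp.toLp_const_smul]
    refine MemLp.toLp_congr _ _ ?_
    filter_upwards [ae_fst (Lp.coeFn_smul c f)] with y hy
    simp [hy, mul_assoc]
  norm_map' g := by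
    show ‖(memLp_field hκ h1 (Lp.memLp g)).toLp‖ = ‖g‖
    rw [Lp.norm_toLp, Lp.norm_def, eLpNorm_two_eq, eLpNorm_two_eq,
      lintegral_field hκ h1 (Lp.aestronglyMeasurable g)]

theorem coeFn_fieldMul (κ : X × Y → ℂ) (hκ : Measurable κ)
    (h1 : ∀ᵐ x ∂μ, ∫⁻ y, ‖κ (x, y)‖ₑ ^ 2 ∂ν = 1) (f : Lp ℂ 2 μ) :
    fieldMul κ hκ h1 f =ᵐ[μ.prod ν] fun z => f z.1 * κ z :=
  (memLp_field hκ h1 (Lp.memLp f)).coeFn_toLp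

/-- A measurable field of Hilbert bases of `L²(ν)`. -/
structure IsBasisField (μ : Measure X) (ν : Measure Y) (κ : ι → X × Y → ℂ) : Prop where
  measurable : ∀ i, Measurable (κ i)
  basis : ∀ᵐ x ∂μ, ∃ b : HilbertBasis ι ℂ (Lp ℂ 2 ν), ∀ i, b i =ᵐ[ν] fun y => κ i (x, y)

namespace IsBasisField

variable {κ : ι → X × Y → ℂ}

theorem lintegral_eq_one (h : IsBasisField μ ν κ) (i : ι) : ∀ᵐ x ∂μ, ∫⁻ y, ‖κ i (x, y)‖ₑ ^ 2 ∂ν = 1 := by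
  filter_upwards [h.basis] with x ⟨b, hb⟩
  have h1 := norm_sq_eq_lintegral (b i)
  rw [b.orthonormal.1 i] at h1
  rw [one_pow, ENNReal.ofReal_one] at h1
  rw [h1]
  apply lintegral_congr_ae
  filter_upwards [hb i] with y hy
  rw [hy]

/-- The isometry `f ↦ f(x) κᵢ(x, y)`. -/
def isom (h : IsBasisField μ ν κ) (i : ι) : Lp ℂ 2 μ →ₗᵢ[ℂ] Lp ℂ 2 (μ.prod ν) :=
  fieldMul (κ i) (h.measurable i) (h.lintegral_eq_one i)

theorem coeFn_isom (h : IsBasisField μ ν κ) (i : ι) (f : Lp ℂ 2 μ) :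
    h.isom i f =ᵐ[μ.prod ν] fun z => f z.1 * κ i z :=
  coeFn_fieldMul _ _ _ f

theorem inner_isom (h : IsBasisField μ ν κ) (i : ι) (a : Lp ℂ 2 μ) (f : Lp ℂ 2 (μ.prod ν)) :
    inner ℂ (h.isom i a) f = ∫ x, conj (a x) * ∫ y, conj (κ i (x, y)) * f (x, y) ∂ν ∂μ := by
  rw [L2.inner_def, integral_prod _ (L2.integrable_inner _ _)]
  apply integral_congr_ae
  filter_upwards [Measure.ae_ae_of_ae_prod (h.coeFn_isom i a)] with x hx
  rw [← integral_const_mul]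
  apply integral_congr_ae
  filter_upwards [hx] with y hy
  rw [hy]
  simp only [RCLike.inner_apply, map_mul]
  ring

theorem orthogonal (h : IsBasisField μ ν κ) {i j : ι} (hij : i ≠ j) (a b : Lp ℂ 2 μ) :
    inner ℂ (h.isom i a) (h.isom j b) = 0 := by
  rw [h.inner_isom]
  rw [integral_eq_zero_of_ae]
  filter_upwards [h.basis, Measure.ae_ae_of_ae_prod (h.coeFn_isom j b)] with x ⟨e, he⟩ hx
  have h1 : inner ℂ (e i) (e j) = 0 := e.orthonormal.2 hij
  rw [L2.inner_def] at h1
  have h2 : ∫ y, conj (κ i (x, y)) * h.isom j b (x, y) ∂ν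
      = b x * ∫ y, inner ℂ (e i y) (e j y) ∂ν := by
    rw [← integral_const_mul]
    apply integral_congr_ae
    filter_upwards [he i, he j, hx] with y h3 h4 h5
    rw [h3, h4, h5]
    simp only [RCLike.inner_apply]
    ring
  rw [h2, h1]
  simp

/-- Taking for `a` the indicators of sets of finite measure shows that the `i`-th fibre coefficient
of `f` vanishes for almost every `x`. Since `ι` is countable, almost every fibre `f(x, ·)` is then
orthogonal to a whole Hilbert basis. -/
theorem total [Countable ι] (h : IsBasisField μ ν κ) (f : Lp ℂ 2 (μ.prod ν)) (hf : ∀ i a, inner ℂ (h.isom i a) f = 0) :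
    f = 0 := by
  have key : ∀ i, ∀ᵐ x ∂μ, ∫ y, conj (κ i (x, y)) * f (x, y) ∂ν = 0 := by
    intro i
    have hind : ∀ (s : Set X) (hs : MeasurableSet s) (hμ : μ s ≠ ∞),
        (fun x => conj ((indicatorConstLp 2 hs hμ (1 : ℂ)) x) *
          ∫ y, conj (κ i (x, y)) * f (x, y) ∂ν) =ᵐ[μ]
          s.indicator (fun x => ∫ y, conj (κ i (x, y)) * f (x, y) ∂ν) := by
      intro s hs hμ
      filter_upwards [indicatorConstLp_coeFn (p := 2) (hs := hs) (hμs := hμ) (c := (1 : ℂ))]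
        with x hx
      rw [hx]
      by_cases hxs : x ∈ s <;> simp [hxs]
    refine ae_eq_zero_of_forall_setIntegral_eq_of_sigmaFinite (fun s hs hμ => ?_)
      (fun s hs hμ => ?_)
    · have h1 := (L2.integrable_inner (𝕜 := ℂ)
        (h.isom i (indicatorConstLp 2 hs hμ.ne (1 : ℂ))) f).integral_prod_left
      rw [← integrable_indicator_iff hs]
      refine h1.congr ?_
      filter_upwards [hind s hs hμ.ne, Measure.ae_ae_of_ae_prod
        (h.coeFn_isom i (indicatorConstLp 2 hs hμ.ne (1 : ℂ)))] with x hx hx2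
      rw [← hx, ← integral_const_mul]
      apply integral_congr_ae
      filter_upwards [hx2] with y hy
      rw [hy]
      simp only [RCLike.inner_apply, map_mul]
      ring
    · have h1 := hf i (indicatorConstLp 2 hs hμ.ne (1 : ℂ))
      rw [h.inner_isom, integral_congr_ae (hind s hs hμ.ne), integral_indicator hs] at h1
      exact h1
  have hfin : ∀ᵐ x ∂μ, ∫⁻ y, ‖f (x, y)‖ₑ ^ 2 ∂ν < ∞ := by
    have h1 := (memLp_two_iff (Lp.aestronglyMeasurable f)).1 (Lp.memLp f)
    rw [lintegral_prod _ ((Lp.aestronglyMeasurable f).enorm.pow_const 2)] at h1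
    refine ae_lt_top' ?_ h1.ne
    exact ((Lp.stronglyMeasurable f).measurable.enorm.pow_const 2).lintegral_prod_right'.aemeasurable
  have hz : ∀ᵐ x ∂μ, ∀ᵐ y ∂ν, f (x, y) = 0 := by
    filter_upwards [hfin, h.basis, ae_all_iff.2 key] with x hx ⟨b, hb⟩ hk
    have hm : MemLp (fun y => f (x, y)) 2 ν :=
      (memLp_two_iff ((Lp.stronglyMeasurable f).comp_measurable
        measurable_prodMk_left).aestronglyMeasurable).2 hx
    have h0 : hm.toLp = 0 := by
      refine eq_zero_of_basis_inner b fun i => ?_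
      rw [L2.inner_def, ← hk i]
      apply integral_congr_ae
      filter_upwards [hb i, hm.coeFn_toLp] with y h3 h4
      rw [h3, h4, RCLike.inner_apply, mul_comm]
    filter_upwards [hm.coeFn_toLp, Lp.coeFn_zero ℂ 2 ν] with y h3 h4
    rw [← h3, h0, h4]
    rfl
  refine Lp.ext ?_
  refine EventuallyEq.trans ?_ (Lp.coeFn_zero ℂ 2 _).symm
  exact (Measure.ae_prod_iff_ae_ae (measurableSet_eq_fun (Lp.stronglyMeasurable f).measurable
    measurable_const)).2 hz

theorem isHilbertSum [Countable ι] (h : IsBasisField μ ν κ) :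
    IsHilbertSum ℂ (fun _ : ι => Lp ℂ 2 μ) fun i => h.isom i :=
  isHilbertSum_of_orthogonal (fun _ _ hij a b => h.orthogonal hij a b) fun f hf => h.total f hf

/-- A Hilbert basis of `L²(μ × ν)` made of a Hilbert basis of `L²(μ)` and a field of bases. -/
theorem exists_prod_basis [Countable ι] (h : IsBasisField μ ν κ) {ι' : Type*} (e : HilbertBasis ι' ℂ (Lp ℂ 2 μ)) :
    ∃ b : HilbertBasis (ι' × ι) ℂ (Lp ℂ 2 (μ.prod ν)), ∀ m, b m = h.isom m.2 (e m.1) := by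
  apply exists_basis
  · constructor
    · intro m
      rw [LinearIsometry.norm_map, e.orthonormal.1]
    · rintro ⟨k, j⟩ ⟨k', j'⟩ hm
      by_cases hj : j = j'
      · subst hj
        show inner ℂ (h.isom j (e k)) (h.isom j (e k')) = 0
        rw [LinearIsometry.inner_map_map]
        exact e.orthonormal.2 fun hk => hm (by rw [hk])
      · exact h.orthogonal hj _ _
  · intro f hf
    refine h.total f fun i a => ?_
    -- Orthogonality is known only against the images of the `e k`; passing to the adjoint yields it
    -- against the image of every `a`, which is what `total` asks for.
    have h1 : (ContinuousLinearMap.adjoint (h.isom i).toContinuousLinearMap) f = 0 := by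
      refine eq_zero_of_basis_inner e fun k => ?_
      rw [ContinuousLinearMap.adjoint_inner_right]
      exact hf (k, i)
    have h2 := ContinuousLinearMap.adjoint_inner_right (h.isom i).toContinuousLinearMap a f
    rw [h1, inner_zero_right] at h2
    exact h2.symm

end IsBasisField

end Field

/-! ### The Fourier transform in the first variable -/

section Tensor

variable {X Y : Type*} [MeasurableSpace X] [MeasurableSpace Y] {μ : Measure X} {ν : Measure Y}
  [SigmaFinite μ] [SigmaFinite ν]

theorem lintegral_tensor {f : X → ℂ} {g : Y → ℂ} (hf : AEStronglyMeasurable f μ)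
    (hg : AEStronglyMeasurable g ν) :
    ∫⁻ z, ‖f z.1 * g z.2‖ₑ ^ 2 ∂μ.prod ν = (∫⁻ x, ‖f x‖ₑ ^ 2 ∂μ) * ∫⁻ y, ‖g y‖ₑ ^ 2 ∂ν := by
  simp only [enorm_mul, mul_pow]
  exact lintegral_prod_mul (hf.enorm.pow_const 2) (hg.enorm.pow_const 2)

theorem memLp_tensor {f : X → ℂ} {g : Y → ℂ} (hf : MemLp f 2 μ) (hg : MemLp g 2 ν) :
    MemLp (fun z : X × Y => f z.1 * g z.2) 2 (μ.prod ν) := by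
  refine (memLp_two_iff (hf.1.comp_fst.mul hg.1.comp_snd)).2 ?_
  refine (lintegral_tensor hf.1 hg.1).trans_lt ?_
  exact ENNReal.mul_lt_top ((memLp_two_iff hf.1).1 hf) ((memLp_two_iff hg.1).1 hg)

/-- The map `g ↦ f ⊗ g`. -/
def tensor (f : Lp ℂ 2 μ) : Lp ℂ 2 ν →L[ℂ] Lp ℂ 2 (μ.prod ν) :=
  LinearMap.mkContinuous
    { toFun := fun g => (memLp_tensor (Lp.memLp f) (Lp.memLp g)).toLp
      map_add' := fun g g' => by
        rw [← MemLp.toLp_add]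
        refine MemLp.toLp_congr _ _ ?_
        filter_upwards [ae_snd (Lp.coeFn_add g g')] with y hy
        rw [hy]
        exact mul_add _ _ _
      map_smul' := fun c g => by
        rw [RingHom.id_apply, ← MemLp.toLp_const_smul]
        refine MemLp.toLp_congr _ _ ?_
        filter_upwards [ae_snd (Lp.coeFn_smul c g)] with y hy
        simp [hy, mul_left_comm] }
    ‖f‖ fun g => by
      show ‖(memLp_tensor (Lp.memLp f) (Lp.memLp g)).toLp‖ ≤ ‖f‖ * ‖g‖
      rw [Lp.norm_toLp, Lp.norm_def, Lp.norm_def, ← ENNReal.toReal_mul, eLpNorm_two_eq,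
        eLpNorm_two_eq, eLpNorm_two_eq, lintegral_tensor (Lp.aestronglyMeasurable f)
        (Lp.aestronglyMeasurable g), ENNReal.mul_rpow_of_nonneg _ _ (by norm_num)]

theorem coeFn_tensor (f : Lp ℂ 2 μ) (g : Lp ℂ 2 ν) :
    tensor f g =ᵐ[μ.prod ν] fun z => f z.1 * g z.2 :=
  (memLp_tensor (Lp.memLp f) (Lp.memLp g)).coeFn_toLp

end Tensor

/-! ### The partial Fourier transform and its integral formula -/

section PartialFourier

/-- The Fourier transform on `L²(ℝ)`. -/
def fourierL2 : L2R ≃ₗᵢ[ℂ] L2R := Lp.fourierTransformₗᵢ ℝ ℂ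

theorem fourierInv_schwartz_apply (c : 𝓢(ℝ, ℂ)) (x : ℝ) :
    (𝓕⁻ c) x = ∫ ξ : ℝ, Complex.exp (2 * Real.pi * Complex.I * ξ * x) * c ξ := by
  rw [SchwartzMap.fourierInv_coe, Real.fourierInv_eq']
  refine integral_congr_ae (ae_of_all _ fun ξ => ?_)
  simp
  left
  congr 1
  ring

theorem fourierL2_symm_toLp (c : 𝓢(ℝ, ℂ)) :
    fourierL2 ((𝓕⁻ c).toLp 2 volume) = c.toLp 2 volume := by
  rw [← LinearIsometryEquiv.eq_symm_apply]
  exact (SchwartzMap.toLp_fourierInv_eq c).symm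

variable {Y : Type*} [MeasurableSpace Y] [MeasurableSpace.CountablyGenerated Y] (ν : Measure Y)
  [SigmaFinite ν]

instance : Fact ((2 : ℝ≥0∞) ≠ ∞) := ⟨by norm_num⟩

instance countable_basisIndex : Countable (basisIndex (Lp ℂ 2 ν)) :=
  countable_of_orthonormal (basis (Lp ℂ 2 ν)).orthonormal

/-- The constant field of Hilbert bases. -/
theorem isBasisField_const : IsBasisField (volume : Measure ℝ) ν
    fun (i : basisIndex (Lp ℂ 2 ν)) (z : ℝ × Y) => basis (Lp ℂ 2 ν) i z.2 where
  measurable i := (Lp.stronglyMeasurable (basis (Lp ℂ 2 ν) i)).measurable.comp measurable_snd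
  basis := ae_of_all _ fun _ => ⟨basis _, fun _ => ae_of_all _ fun _ => rfl⟩

/-- The Fourier transform is onto, so `f ↦ (𝓕 f) ⊗ eᵢ` decomposes the space just as `f ↦ f ⊗ eᵢ`
does. Matching the two decompositions defines the partial transform on all of `L²`, with no
integrability assumption. -/
theorem isHilbertSum_const_fourier : IsHilbertSum ℂ (fun _ : basisIndex (Lp ℂ 2 ν) => L2R)
    fun i => ((isBasisField_const ν).isom i).comp
      fourierL2.toLinearIsometry := by
  refine isHilbertSum_of_orthogonal (fun _ _ hij a b => (isBasisField_const ν).orthogonal hij _ _)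
    fun f hf => (isBasisField_const ν).total f fun i a => ?_
  have h := hf i (fourierL2.symm a)
  simpa using h

/-- The Fourier transform in the first variable. -/
def partialFourier : Lp ℂ 2 ((volume : Measure ℝ).prod ν) ≃ₗᵢ[ℂ] Lp ℂ 2 ((volume : Measure ℝ).prod ν) :=
  hilbertSumEquiv (isBasisField_const ν).isHilbertSum (isHilbertSum_const_fourier ν)

theorem partialFourier_isom (i : basisIndex (Lp ℂ 2 ν)) (f : L2R) :
    partialFourier ν ((isBasisField_const ν).isom i f)
      = (isBasisField_const ν).isom i (fourierL2 f) :=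
  hilbertSumEquiv_apply (isBasisField_const ν).isHilbertSum (isHilbertSum_const_fourier ν) i f

/-- For `g` in the fixed basis this is how the transform was built; both sides are linear and
continuous in `g`. -/
theorem partialFourier_tensor (f : L2R) (g : Lp ℂ 2 ν) :
    partialFourier ν (tensor f g) = tensor (fourierL2 f) g := by
  have hb : ∀ f : L2R, ∀ i, tensor f (basis (Lp ℂ 2 ν) i) = (isBasisField_const ν).isom i f :=
    fun f i => Lp.ext ((coeFn_tensor _ _).trans ((isBasisField_const ν).coeFn_isom i f).symm)
  have h : (partialFourier ν).toContinuousLinearEquiv.toContinuousLinearMap ∘L tensor f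
      = tensor (ν := ν) (fourierL2 f) := by
    refine ContinuousLinearMap.ext_on (s := Set.range (basis (Lp ℂ 2 ν))) ?_ ?_
    · rw [dense_iff_closure_eq, ← Submodule.topologicalClosure_coe, (basis _).dense_span]
      rfl
    · rintro _ ⟨i, rfl⟩
      show partialFourier ν (tensor f (basis (Lp ℂ 2 ν) i)) = _
      rw [hb, hb, partialFourier_isom]
  exact congrArg (fun T => T g) h

variable {ν}

/-- On functions that are integrable in the first variable, uniformly in the second one, the
partial Fourier transform is given by the integral. -/
theorem partialFourier_ae {k : ℝ × Y → ℂ} (hkm : Measurable k)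
    (hk : MemLp k 2 ((volume : Measure ℝ).prod ν)) {C : ℝ} (hi : ∀ y, Integrable fun x => k (x, y))
    (hC : ∀ y, ∫ x, ‖k (x, y)‖ ≤ C) :
    partialFourier ν hk.toLp =ᵐ[(volume : Measure ℝ).prod ν]
      fun z => ∫ x : ℝ, Complex.exp (-(2 * Real.pi * Complex.I * z.1 * x)) * k (x, z.2) := by
  set F := partialFourier ν hk.toLp with hF
  set v : ℝ × Y → ℂ :=
    fun z => ∫ x : ℝ, Complex.exp (-(2 * Real.pi * Complex.I * z.1 * x)) * k (x, z.2) with hv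
  have hvm : StronglyMeasurable v := by
    refine StronglyMeasurable.integral_prod_left' (f := fun w : ℝ × (ℝ × Y) =>
      Complex.exp (-(2 * Real.pi * Complex.I * w.2.1 * w.1)) * k (w.1, w.2.2)) ?_
    refine Measurable.stronglyMeasurable ?_
    fun_prop
  have hFm : StronglyMeasurable (F : ℝ × Y → ℂ) := Lp.stronglyMeasurable F
  have hvb : ∀ z, ‖v z‖ ≤ C := by
    intro z
    refine (norm_integral_le_integral_norm _).trans (le_trans (le_of_eq ?_) (hC z.2))
    refine integral_congr_ae (ae_of_all _ fun x => ?_)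
    dsimp only
    have : ‖Complex.exp (-(2 * Real.pi * Complex.I * z.1 * x))‖ = 1 := by
      simp [Complex.norm_exp]
    rw [norm_mul, this, one_mul]
  -- the pairing with `χ ⊗ G`
  have hint : ∀ (χ : ℝ → ℂ) (G : Y → ℂ), Integrable χ → MemLp χ 2 volume → MemLp G 2 ν →
      Integrable G ν → Integrable (fun z : ℝ × Y => conj (χ z.1) * conj (G z.2) * (F z - v z))
        ((volume : Measure ℝ).prod ν) := by
    intro χ G h1 h2 h3 h4
    have hA : Integrable (fun z : ℝ × Y => conj (χ z.1) * conj (G z.2) * F z)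
        ((volume : Measure ℝ).prod ν) := by
      have := L2.integrable_inner (𝕜 := ℂ) (tensor h2.toLp h3.toLp) F
      refine this.congr ?_
      filter_upwards [coeFn_tensor h2.toLp h3.toLp, ae_fst h2.coeFn_toLp, ae_snd h3.coeFn_toLp]
        with z h5 h6 h7
      rw [h5, h6, h7, RCLike.inner_apply, map_mul]
      ring
    have hB : Integrable (fun z : ℝ × Y => conj (χ z.1) * conj (G z.2) * v z)
        ((volume : Measure ℝ).prod ν) := by
      have hp : Integrable (fun z : ℝ × Y => conj (χ z.1) * conj (G z.2))
          ((volume : Measure ℝ).prod ν) := by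
        have := (h1.mul_prod h4)
        refine (this.norm.mono' ?_ ?_)
        · exact (Complex.continuous_conj.comp_aestronglyMeasurable h1.1.comp_fst).mul
            (Complex.continuous_conj.comp_aestronglyMeasurable h4.1.comp_snd)
        · exact ae_of_all _ fun z => by simp
      refine hp.mul_bdd (c := C) hvm.aestronglyMeasurable (ae_of_all _ hvb)
    refine (hA.sub hB).congr (ae_of_all _ fun z => ?_)
    simp only [Pi.sub_apply]
    ring
  -- Unitarity moves the transform from `k` to the Schwartz function `c`, replacing it by `𝓕⁻ c`.
  -- What remains is Fubini in the first variable for each fixed `y`, and there `k(·, y)` is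
  -- integrable.
  have hpair : ∀ (c : 𝓢(ℝ, ℂ)) (G : Y → ℂ), MemLp G 2 ν → Integrable G ν →
      ∫ z, conj (c z.1) * conj (G z.2) * (F z - v z) ∂((volume : Measure ℝ).prod ν) = 0 := by
    intro c G h3 h4
    have hcL : MemLp (fun x => c x) 2 (volume : Measure ℝ) := c.memLp 2
    have hcI : Integrable (fun x => c x) (volume : Measure ℝ) := c.integrable
    set c' := 𝓕⁻ c with hc'
    have hcL' : MemLp (fun x => c' x) 2 (volume : Measure ℝ) := c'.memLp 2
    have hten : inner ℂ (tensor hcL.toLp h3.toLp) F = inner ℂ (tensor hcL'.toLp h3.toLp) hk.toLp := by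
      have h5 : fourierL2 hcL'.toLp = hcL.toLp := fourierL2_symm_toLp c
      rw [← h5, ← partialFourier_tensor, hF, LinearIsometryEquiv.inner_map_map]
    have hG : ∀ᵐ z ∂(volume : Measure ℝ).prod ν, (h3.toLp G : Y → ℂ) z.2 = G z.2 := ae_snd h3.coeFn_toLp
    have hL : inner ℂ (tensor hcL.toLp h3.toLp) F
        = ∫ z, conj (c z.1) * conj (G z.2) * F z ∂(volume : Measure ℝ).prod ν := by
      rw [L2.inner_def]
      apply integral_congr_ae
      filter_upwards [coeFn_tensor hcL.toLp h3.toLp, ae_fst hcL.coeFn_toLp, hG] with z h5 h6 h7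
      rw [h5, h6, h7, RCLike.inner_apply, map_mul]
      ring
    have hR0 : (fun z => inner ℂ ((tensor hcL'.toLp h3.toLp : Lp ℂ 2 _) z) ((hk.toLp k : ℝ × Y → ℂ) z))
        =ᵐ[(volume : Measure ℝ).prod ν] fun z => conj (c' z.1) * conj (G z.2) * k z := by
      filter_upwards [coeFn_tensor hcL'.toLp h3.toLp, ae_fst hcL'.coeFn_toLp, hG, hk.coeFn_toLp]
        with z h5 h6 h7 h8
      rw [h5, h6, h7, h8, RCLike.inner_apply, map_mul]
      ring
    have hRi := (L2.integrable_inner (𝕜 := ℂ) (tensor hcL'.toLp h3.toLp) hk.toLp).congr hR0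
    have hint1 := hint (fun x => c x) G hcI hcL h3 h4
    have hvi : Integrable (fun z : ℝ × Y => conj (c z.1) * conj (G z.2) * v z)
        ((volume : Measure ℝ).prod ν) := by
      have h5 : Integrable (fun z : ℝ × Y => conj (c z.1) * conj (G z.2) * F z)
          ((volume : Measure ℝ).prod ν) := by
        refine (L2.integrable_inner (𝕜 := ℂ) (tensor hcL.toLp h3.toLp) F).congr ?_
        filter_upwards [coeFn_tensor hcL.toLp h3.toLp, ae_fst hcL.coeFn_toLp, hG] with z h5 h6 h7
        rw [h5, h6, h7, RCLike.inner_apply, map_mul]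
        ring
      refine (h5.sub hint1).congr (ae_of_all _ fun z => ?_)
      simp only [Pi.sub_apply]
      ring
    have hRv : ∫ z, conj (c' z.1) * conj (G z.2) * k z ∂(volume : Measure ℝ).prod ν
        = ∫ z, conj (c z.1) * conj (G z.2) * v z ∂(volume : Measure ℝ).prod ν := by
      rw [integral_prod_symm _ hRi, integral_prod_symm _ hvi]
      congr 1 with y
      have h5 : ∀ x : ℝ, conj (c' x) * conj (G y) * k (x, y)
          = conj (G y) * ∫ ξ : ℝ, conj (c ξ) *
            (Complex.exp (-(2 * Real.pi * Complex.I * ξ * x)) * k (x, y)) := by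
        intro x
        have h6 : conj (c' x) = ∫ ξ : ℝ, conj (c ξ) *
            Complex.exp (-(2 * Real.pi * Complex.I * ξ * x)) := by
          rw [hc', fourierInv_schwartz_apply, ← integral_conj]
          congr 1 with ξ
          rw [map_mul, ← Complex.exp_conj, mul_comm]
          simp [map_ofNat]
        simp_rw [← mul_assoc]
        rw [integral_mul_const, ← h6]
        ring
      simp_rw [h5]
      rw [integral_const_mul, integral_integral_swap]
      · rw [← integral_const_mul]
        congr 1 with ξ
        rw [hv, integral_const_mul]
        ring
      · have h7 : Integrable (fun w : ℝ × ℝ => k (w.1, y) * conj (c w.2))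
            ((volume : Measure ℝ).prod volume) :=
          (hi y).mul_prod ((Complex.conjLIE.toContinuousLinearEquiv.integrable_comp_iff
            (φ := fun x => c x)).2 hcI)
        refine h7.norm.mono' ?_ (ae_of_all _ fun w => ?_)
        · refine Measurable.aestronglyMeasurable ?_
          unfold Function.uncurry
          have := c.continuous.measurable
          fun_prop
        · have : ‖Complex.exp (-(2 * Real.pi * Complex.I * w.2 * w.1))‖ = 1 := by
            simp [Complex.norm_exp]
          simp only [Function.uncurry, norm_mul, this, one_mul]
          rw [mul_comm]
    have h8 := integral_congr_ae hR0
    rw [← L2.inner_def, ← hten, hL, hRv] at h8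
    have h5 : Integrable (fun z : ℝ × Y => conj (c z.1) * conj (G z.2) * F z)
        ((volume : Measure ℝ).prod ν) := by
      refine (hint1.add hvi).congr (ae_of_all _ fun z => ?_)
      simp only [Pi.add_apply]
      ring
    simp_rw [mul_sub]
    rw [integral_sub h5 hvi, h8, sub_self]
  -- Smooth compactly supported functions are Schwartz functions, so `hpair` suffices to kill the
  -- inner integral for almost every `ξ`.
  have hpt : ∀ G : Y → ℂ, MemLp G 2 ν → Integrable G ν →
      ∀ᵐ ξ : ℝ, ∫ y, conj (G y) * (F (ξ, y) - v (ξ, y)) ∂ν = 0 := by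
    intro G h3 h4
    apply ae_eq_zero_of_integral_contDiff_smul_eq_zero
    · refine (locallyIntegrable_iff).2 fun K hK => ?_
      have hf : volume K ≠ ∞ := hK.measure_lt_top.ne
      have h5 := hint (K.indicator fun _ => 1) G
        ((integrable_indicator_iff hK.measurableSet).2 (integrableOn_const hf))
        (memLp_indicator_const 2 hK.measurableSet 1 (Or.inr hf)) h3 h4
      rw [← integrable_indicator_iff hK.measurableSet]
      refine h5.integral_prod_left.congr (ae_of_all _ fun ξ => ?_)
      by_cases hξ : ξ ∈ K <;> simp [hξ]
    · intro g hg hgc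
      have hg' : HasCompactSupport fun x => (g x : ℂ) := hgc.comp_left (g := fun r : ℝ => (r : ℂ)) rfl
      have hgd : ContDiff ℝ (⊤ : ℕ∞) fun x => (g x : ℂ) := Complex.ofRealCLM.contDiff.comp hg
      let c : 𝓢(ℝ, ℂ) := hg'.toSchwartzMap hgd
      have hc : ∀ x, c x = g x := fun x => rfl
      have h6 := hpair c G h3 h4
      rw [integral_prod _ (hint (fun x => c x) G c.integrable (c.memLp 2) h3 h4)] at h6
      rw [← h6]
      congr 1 with ξ
      rw [Complex.real_smul, ← integral_const_mul]
      congr 1 with y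
      rw [hc, Complex.conj_ofReal]
      ring
  have hfin : ∀ᵐ ξ : ℝ, ∫⁻ y, ‖F (ξ, y)‖ₑ ^ 2 ∂ν < ∞ := by
    have h1 := (memLp_two_iff (Lp.aestronglyMeasurable F)).1 (Lp.memLp F)
    rw [lintegral_prod _ ((Lp.aestronglyMeasurable F).enorm.pow_const 2)] at h1
    refine ae_lt_top' ?_ h1.ne
    exact (hFm.measurable.enorm.pow_const 2).lintegral_prod_right'.aemeasurable
  -- The bounded function `v(ξ, ·)` is known to be square integrable only on sets of finite measure.
  -- On each spanning set a countable basis of `L²` detects `F - v`, and the spanning sets exhaust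
  -- `Y`.
  have hB : ∀ n : ℕ, ∀ᵐ ξ : ℝ, ∀ᵐ y ∂ν.restrict (spanningSets ν n), F (ξ, y) = v (ξ, y) := by
    intro n
    have hBm : MeasurableSet (spanningSets ν n) := measurableSet_spanningSets ν n
    have : IsFiniteMeasure (ν.restrict (spanningSets ν n)) :=
      ⟨by simpa using measure_spanningSets_lt_top ν n⟩
    let e := basis (Lp ℂ 2 (ν.restrict (spanningSets ν n)))
    have h9 : ∀ i, ∀ᵐ ξ : ℝ, ∫ y in spanningSets ν n, conj (e i y) * (F (ξ, y) - v (ξ, y)) ∂ν = 0 := by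
      intro i
      have h10 : MemLp ((spanningSets ν n).indicator (e i)) 2 ν :=
        (memLp_indicator_iff_restrict hBm).2 (Lp.memLp (e i))
      have h11 : Integrable ((spanningSets ν n).indicator (e i)) ν :=
        (integrable_indicator_iff hBm).2 ((Lp.memLp (e i)).integrable (by norm_num))
      filter_upwards [hpt _ h10 h11] with ξ hξ
      rw [← hξ, ← integral_indicator hBm]
      congr 1 with y
      by_cases hy : y ∈ spanningSets ν n <;> simp [hy]
    filter_upwards [hfin, ae_all_iff.2 h9] with ξ h12 h13
    have hFl : MemLp (fun y => F (ξ, y)) 2 (ν.restrict (spanningSets ν n)) :=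
      ((memLp_two_iff (hFm.comp_measurable measurable_prodMk_left).aestronglyMeasurable).2
        h12).restrict _
    have hvl : MemLp (fun y => v (ξ, y)) 2 (ν.restrict (spanningSets ν n)) :=
      MemLp.of_bound (hvm.comp_measurable measurable_prodMk_left).aestronglyMeasurable C
        (ae_of_all _ fun y => hvb _)
    have h14 : (hFl.sub hvl).toLp = 0 := by
      refine eq_zero_of_basis_inner e fun i => ?_
      rw [L2.inner_def, ← h13 i]
      apply integral_congr_ae
      filter_upwards [(hFl.sub hvl).coeFn_toLp] with y hy
      rw [hy, RCLike.inner_apply, mul_comm]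
      rfl
    filter_upwards [(hFl.sub hvl).coeFn_toLp, Lp.coeFn_zero ℂ 2 (ν.restrict (spanningSets ν n))]
      with y h15 h16
    rw [h14, h16] at h15
    exact (sub_eq_zero.1 h15.symm)
  refine (Measure.ae_prod_iff_ae_ae (measurableSet_eq_fun hFm.measurable hvm.measurable)).2 ?_
  filter_upwards [ae_all_iff.2 hB] with ξ hξ
  have := (ae_restrict_iUnion_iff (μ := ν) (spanningSets ν) _).2 hξ
  rwa [iUnion_spanningSets, Measure.restrict_univ] at this

end PartialFourier

/-! ### Hilbert–Schmidt operators -/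

namespace HS

variable {E : Type*} [NormedAddCommGroup E] [InnerProductSpace ℂ E] [CompleteSpace E]

theorem toCLM_injective : Function.Injective (toCLM : HS E → E →L[ℂ] E) :=
  Subtype.val_injective

theorem hasSum_inner (S T : HS E) :
    HasSum (fun i => inner ℂ (toCLM S (basis E i)) (toCLM T (basis E i))) (inner ℂ S T) :=
  lp.hasSum_inner (columns E S) (columns E T)

/-- The rank one operator `v ↦ ⟨v, ψ⟩ φ`. -/
def rankOne (φ ψ : E) : HS E :=
  ⟨InnerProductSpace.rankOne ℂ φ ψ, by
    show Summable fun i => ‖InnerProductSpace.rankOne ℂ φ ψ (basis E i)‖ ^ 2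
    have h : Summable fun i => ‖inner ℂ (basis E i) ψ‖ ^ 2 := by
      have := (lp.memℓp ((basis E).repr ψ)).summable (by norm_num)
      simpa [(basis E).repr_apply_apply] using this
    refine (h.mul_right (‖φ‖ ^ 2)).congr fun i => ?_
    rw [InnerProductSpace.rankOne_apply, norm_smul, mul_pow, norm_inner_symm]⟩

theorem rankOne_apply (φ ψ v : E) : toCLM (rankOne φ ψ) v = inner ℂ ψ v • φ := rfl

/-- Expand `ψ` in the fixed basis. The point is that matrix coefficients of an operator are its
Hilbert–Schmidt coordinates, so fibrewise identities can be tested on rank one operators. -/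
theorem inner_rankOne (φ ψ : E) (T : HS E) : inner ℂ (rankOne φ ψ) T = inner ℂ φ (toCLM T ψ) := by
  refine (hasSum_inner (rankOne φ ψ) T).unique ?_
  have h1 : HasSum (fun i => inner ℂ φ (toCLM T ((basis E).repr ψ i • basis E i)))
      (inner ℂ φ (toCLM T ψ)) :=
    (((basis E).hasSum_repr ψ).mapL (toCLM T)).mapL (innerSL ℂ φ)
  have h2 : (fun i => inner ℂ φ (toCLM T ((basis E).repr ψ i • basis E i)))
      = fun i => inner ℂ (toCLM (rankOne φ ψ) (basis E i)) (toCLM T (basis E i)) := by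
    funext i
    rw [(basis E).repr_apply_apply, map_smul, inner_smul_right, rankOne_apply, inner_smul_left,
      inner_conj_symm]
  rwa [h2] at h1

theorem norm_rankOne (φ ψ : E) : ‖rankOne φ ψ‖ = ‖φ‖ * ‖ψ‖ := by
  have h2 := inner_rankOne φ ψ (rankOne φ ψ)
  rw [rankOne_apply, inner_smul_right, inner_self_eq_norm_sq_to_K, inner_self_eq_norm_sq_to_K,
    inner_self_eq_norm_sq_to_K] at h2
  have h3 : ‖rankOne φ ψ‖ ^ 2 = (‖φ‖ * ‖ψ‖) ^ 2 := by
    rw [mul_pow, mul_comm]; exact_mod_cast h2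
  exact (pow_left_inj₀ (norm_nonneg _) (by positivity) two_ne_zero).1 h3

/-- Cauchy–Schwarz for `T` against the rank one operator built from `T v` and `v`. -/
theorem opNorm_le (T : HS E) (v : E) : ‖toCLM T v‖ ≤ ‖T‖ * ‖v‖ := by
  by_cases h : toCLM T v = 0
  · rw [h, norm_zero]; positivity
  have h2 := norm_inner_le_norm (𝕜 := ℂ) (rankOne (toCLM T v) v) T
  rw [inner_rankOne, inner_self_eq_norm_sq_to_K, norm_rankOne] at h2
  have h3 : ‖toCLM T v‖ ^ 2 ≤ ‖toCLM T v‖ * ‖v‖ * ‖T‖ := by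
    simpa using h2
  have h4 : 0 < ‖toCLM T v‖ := norm_pos_iff.2 h
  nlinarith

theorem norm_toCLM_le (T : HS E) : ‖toCLM T‖ ≤ ‖T‖ :=
  ContinuousLinearMap.opNorm_le_bound _ (norm_nonneg _) (opNorm_le T)

/-- The inclusion of the Hilbert–Schmidt operators in the bounded ones is continuous. -/
def toCLML : HS E →L[ℂ] (E →L[ℂ] E) :=
  LinearMap.mkContinuous toCLM 1 fun T => by simpa using norm_toCLM_le T

theorem continuous_toCLM : Continuous (toCLM : HS E → E →L[ℂ] E) := toCLML.continuous

theorem ext_basis {S T : HS E} (h : ∀ k j, inner ℂ (basis E k) (toCLM S (basis E j))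
    = inner ℂ (basis E k) (toCLM T (basis E j))) : S = T := by
  apply columns_injective
  ext j
  rw [← sub_eq_zero]
  refine eq_zero_of_basis_inner (basis E) fun k => ?_
  rw [inner_sub_right, sub_eq_zero]
  exact h k j

/-- For square summable columns `c`, the map `w ↦ (⟨cᵢ, w⟩)ᵢ` into `ℓ²` is bounded by `‖c‖`; read in
the fixed basis, its adjoint sends `eᵢ` to `cᵢ`. Completeness of `HS E` follows from that of the
Hilbert sum. -/
theorem columns_surjective : Function.Surjective (columns E) := by
  intro c
  have hb : ∀ w : E, Memℓp (fun i => inner ℂ (c i) w) 2 := by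
    intro w
    rw [memℓp_gen_iff (by norm_num)]
    have := ((lp.memℓp c).summable (by norm_num)).mul_right (‖w‖ ^ 2)
    refine Summable.of_nonneg_of_le (fun i => by positivity) (fun i => ?_) this
    simp only [ENNReal.toReal_ofNat, Real.rpow_ofNat]
    rw [← mul_pow]
    exact pow_le_pow_left₀ (norm_nonneg _) (norm_inner_le_norm _ _) 2
  let A : E →L[ℂ] lp (fun _ : basisIndex E => ℂ) 2 :=
    LinearMap.mkContinuous
      { toFun := fun w => ⟨fun i => inner ℂ (c i) w, hb w⟩
        map_add' := fun v w => by ext i; exact inner_add_right _ _ _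
        map_smul' := fun a w => by ext i; exact inner_smul_right _ _ _ } ‖c‖ fun w => by
      refine (pow_le_pow_iff_left₀ (norm_nonneg _) (by positivity) two_ne_zero).1 ?_
      have h1 := lp.norm_rpow_eq_tsum (p := 2) (by norm_num)
        (⟨fun i => inner ℂ (c i) w, hb w⟩ : lp (fun _ : basisIndex E => ℂ) 2)
      have h2 := lp.norm_rpow_eq_tsum (p := 2) (by norm_num) c
      have h3 := (lp.memℓp c).summable (by norm_num)
      have h4 := (hb w).summable (by norm_num)
      simp only [ENNReal.toReal_ofNat, Real.rpow_ofNat] at h1 h2 h3 h4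
      rw [mul_pow, h2, ← tsum_mul_right]
      refine h1.trans_le (Summable.tsum_le_tsum (fun i => ?_) h4 (h3.mul_right _))
      rw [← mul_pow]
      exact pow_le_pow_left₀ (norm_nonneg _) (norm_inner_le_norm _ _) 2
  let T : E →L[ℂ] E := ContinuousLinearMap.adjoint
    ((basis E).repr.symm.toContinuousLinearEquiv.toContinuousLinearMap ∘L A)
  have hT : ∀ i, T (basis E i) = c i := by
    intro i
    refine ext_inner_right ℂ fun w => ?_
    rw [ContinuousLinearMap.adjoint_inner_left]
    show inner ℂ (basis E i) ((basis E).repr.symm (A w)) = _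
    rw [← (basis E).repr_apply_apply, LinearIsometryEquiv.apply_symm_apply]
    rfl
  refine ⟨⟨T, ?_⟩, ?_⟩
  · show Summable fun i => ‖T (basis E i)‖ ^ 2
    simp_rw [hT]
    simpa using (lp.memℓp c).summable (by norm_num)
  · ext i
    exact hT i

/-- `columns` as a unitary operator. -/
def columnsEquiv : HS E ≃ₗᵢ[ℂ] lp (fun _ : basisIndex E => E) 2 :=
  LinearIsometryEquiv.ofSurjective ⟨columns E, fun _ => rfl⟩ columns_surjective

instance : CompleteSpace (HS E) :=
  (completeSpace_congr (e := (columnsEquiv (E := E)).toEquiv)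
    (columnsEquiv (E := E)).isometry.isUniformEmbedding).2 inferInstance

variable (E) in
theorem exists_rankOne_basis : ∃ b : HilbertBasis (basisIndex E × basisIndex E) ℂ (HS E),
    ∀ m, b m = rankOne (basis E m.1) (basis E m.2) := by
  apply exists_basis
  · constructor
    · intro m
      rw [norm_rankOne, (basis E).orthonormal.1, (basis E).orthonormal.1, one_mul]
    · rintro ⟨k, j⟩ ⟨k', j'⟩ hm
      show inner ℂ (rankOne (basis E k) (basis E j)) (rankOne (basis E k') (basis E j')) = 0
      rw [inner_rankOne, rankOne_apply, inner_smul_right]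
      by_cases hj : j' = j
      · have hk : k ≠ k' := fun hk => hm (by rw [hk, hj])
        have : inner ℂ (basis E k) (basis E k') = 0 := (basis E).orthonormal.2 hk
        rw [this, mul_zero]
      · have : inner ℂ (basis E j') (basis E j) = 0 := (basis E).orthonormal.2 hj
        rw [this, zero_mul]
  · intro T hT
    refine ext_basis fun k j => ?_
    rw [← inner_rankOne, hT (k, j)]
    simp

theorem separableSpace (h : Countable (basisIndex E)) : TopologicalSpace.SeparableSpace (HS E) := by
  obtain ⟨b, -⟩ := exists_rankOne_basis E
  have h1 : TopologicalSpace.IsSeparable (Set.range b) := (Set.countable_range b).isSeparable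
  have h2 := (h1.span (R := ℂ)).closure
  rw [← Submodule.topologicalClosure_coe, b.dense_span] at h2
  exact TopologicalSpace.isSeparable_univ_iff.1 h2

theorem toCLM_lcomp (A : E →L[ℂ] E) (T : HS E) : toCLM (lcomp A T) = A ∘L toCLM T := rfl

theorem inner_lcomp_of_isometry {A : E →L[ℂ] E} (hA : ∀ v w, inner ℂ (A v) (A w) = inner ℂ v w)
    (S T : HS E) : inner ℂ (lcomp A S) (lcomp A T) = inner ℂ S T := by
  refine (hasSum_inner _ _).unique ?_
  simp only [toCLM_lcomp, ContinuousLinearMap.comp_apply, hA]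
  exact hasSum_inner S T

theorem norm_lcomp_of_isometry {A : E →L[ℂ] E} (hA : ∀ v w, inner ℂ (A v) (A w) = inner ℂ v w)
    (T : HS E) : ‖lcomp A T‖ = ‖T‖ := by
  have h := inner_lcomp_of_isometry hA T T
  rw [inner_self_eq_norm_sq_to_K, inner_self_eq_norm_sq_to_K] at h
  have h3 : ‖lcomp A T‖ ^ 2 = ‖T‖ ^ 2 := by exact_mod_cast h
  exact (pow_left_inj₀ (norm_nonneg _) (norm_nonneg _) two_ne_zero).1 h3

end HS

/-! ### Matrix coefficients of the Schrödinger representations -/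

theorem schrodinger_inner (h : ℝ) (g : Heis) (v w : L2R) :
    inner ℂ (schrodinger h g v) (schrodinger h g w) = inner ℂ v w :=
  LinearIsometry.inner_map_map _ v w

theorem norm_schrodinger (h : ℝ) (g : Heis) (v : L2R) : ‖schrodinger h g v‖ = ‖v‖ :=
  LinearIsometry.norm_map _ v

theorem ae_shift {p : ℝ → Prop} (h : ∀ᵐ x, p x) (a : ℝ) : ∀ᵐ x : ℝ, p (x + a) :=
  (measurePreserving_add_right volume a).quasiMeasurePreserving.ae h

theorem schrodinger_mul (h : ℝ) (g g' : Heis) :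
    schrodinger h (g * g') = schrodinger h g ∘L schrodinger h g' := by
  ext1 f
  refine Lp.ext ((schrodinger_apply h (g * g') f).trans ?_)
  rw [ContinuousLinearMap.comp_apply]
  filter_upwards [schrodinger_apply h g (schrodinger h g' f),
    ae_shift (schrodinger_apply h g' f) (h * g.p)] with x h1 h2
  rw [h1, h2]
  have e : x + h * (g * g').p = x + h * g.p + h * g'.p := by rw [Heis.mul_p]; ring
  rw [e, ← mul_assoc]
  congr 1
  simp only [← Complex.exp_add]
  congr 1
  rw [Heis.mul_p, Heis.mul_q, Heis.mul_t]
  push_cast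
  ring

theorem schrodinger_eq_smul (h p q t : ℝ) (f : L2R) :
    schrodinger h (Heis.mk p q t) f = Complex.exp (2 * Real.pi * Complex.I * h * t) •
      schrodinger 1 (Heis.mk (h * p) q 0) f := by
  refine Lp.ext ((schrodinger_apply h _ f).trans ?_)
  filter_upwards [schrodinger_apply 1 (Heis.mk (h * p) q 0) f, Lp.coeFn_smul
    (Complex.exp (2 * Real.pi * Complex.I * h * t)) (schrodinger 1 (Heis.mk (h * p) q 0) f)]
    with x h1 h2
  rw [h2, Pi.smul_apply, h1, smul_eq_mul]
  simp only [Heis.mk, Heis.p, Heis.q, Heis.t, one_mul, ← mul_assoc]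
  congr 1
  simp only [← Complex.exp_add]
  congr 1
  push_cast
  ring

/-- The matrix coefficient `⟨ψ, ρ₁(p, q, 0) φ⟩`. -/
def coeff (φ ψ : L2R) (z : ℝ × ℝ) : ℂ := inner ℂ (schrodinger 1 (Heis.mk z.1 z.2 0) φ) ψ

/-- Up to a factor of modulus one, the coefficient is the Fourier transform in `x`, at frequency
`q`, of `ψ(x) conj φ(x + p)`. Both joint measurability and the basis property come from this form.
-/
theorem coeff_eq (φ ψ : L2R) (z : ℝ × ℝ) : coeff φ ψ z = Complex.exp (-(Real.pi * Complex.I * z.1 * z.2)) *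
    ∫ x : ℝ, Complex.exp (-(2 * Real.pi * Complex.I * z.2 * x)) * (ψ x * conj (φ (x + z.1))) := by
  rw [coeff, L2.inner_def, ← integral_const_mul]
  apply integral_congr_ae
  filter_upwards [schrodinger_apply 1 (Heis.mk z.1 z.2 0) φ] with x hx
  rw [hx]
  simp only [Heis.mk, Heis.p, Heis.q, Heis.t, one_mul, RCLike.inner_apply, map_mul,
    ← Complex.exp_conj, Complex.conj_ofReal, Complex.conj_I, map_ofNat]
  simp
  ring_nf

theorem measurable_coeff (φ ψ : L2R) : Measurable (coeff φ ψ) := by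
  have h : coeff φ ψ = fun z => Complex.exp (-(Real.pi * Complex.I * z.1 * z.2)) *
    ∫ x : ℝ, Complex.exp (-(2 * Real.pi * Complex.I * z.2 * x)) * (ψ x * conj (φ (x + z.1))) :=
    funext (coeff_eq φ ψ)
  rw [h]
  have h1 : StronglyMeasurable fun z : ℝ × ℝ => ∫ x : ℝ,
      Complex.exp (-(2 * Real.pi * Complex.I * z.2 * x)) * (ψ x * conj (φ (x + z.1))) := by
    refine StronglyMeasurable.integral_prod_left' (f := fun w : ℝ × (ℝ × ℝ) =>
      Complex.exp (-(2 * Real.pi * Complex.I * w.2.2 * w.1)) * (ψ w.1 * conj (φ (w.1 + w.2.1)))) ?_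
    refine Measurable.stronglyMeasurable ?_
    have hφ := (Lp.stronglyMeasurable φ).measurable
    have hψ := (Lp.stronglyMeasurable ψ).measurable
    fun_prop
  have h2 := h1.measurable
  fun_prop

theorem inner_schrodinger (h : ℝ) (g : Heis) (φ ψ : L2R) : inner ℂ (schrodinger h g φ) ψ =
    Complex.exp (-(2 * Real.pi * Complex.I * h * g.t)) * coeff φ ψ (h * g.p, g.q) := by
  have h1 : g = Heis.mk g.p g.q g.t := rfl
  conv_lhs => rw [h1, schrodinger_eq_smul, inner_smul_left, ← Complex.exp_conj]
  rw [coeff]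
  congr 2
  simp [map_ofNat]

theorem measurable_inner_schrodinger (φ ψ : L2R) :
    Measurable fun w : ℝ × Heis => inner ℂ ψ (schrodinger w.1 w.2 φ) := by
  have h : (fun w : ℝ × Heis => inner ℂ ψ (schrodinger w.1 w.2 φ)) = fun w =>
      conj (Complex.exp (-(2 * Real.pi * Complex.I * w.1 * w.2.t)) *
        coeff φ ψ (w.1 * w.2.p, w.2.q)) := by
    funext w
    rw [← inner_schrodinger, inner_conj_symm]
  have hp : Measurable Heis.p := measurable_fst
  have hq : Measurable Heis.q := measurable_fst.comp measurable_snd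
  have ht : Measurable Heis.t := measurable_snd.comp measurable_snd
  have hc := measurable_coeff φ ψ
  rw [h]
  fun_prop

theorem norm_inner_schrodinger_le (h : ℝ) (g : Heis) (φ ψ : L2R) :
    ‖inner ℂ ψ (schrodinger h g φ)‖ ≤ ‖ψ‖ * ‖φ‖ :=
  (norm_inner_le_norm _ _).trans_eq (by rw [norm_schrodinger])

theorem norm_coeff_le (φ ψ : L2R) (z : ℝ × ℝ) : ‖coeff φ ψ z‖ ≤ ‖φ‖ * ‖ψ‖ :=
  (norm_inner_le_norm _ _).trans_eq (by rw [norm_schrodinger])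

/-! ### The matrix coefficients form a Hilbert basis -/

theorem exists_conj_basis {ι : Type*} (e : HilbertBasis ι ℂ L2R) :
    ∃ b : HilbertBasis ι ℂ L2R, ∀ j, b j =ᵐ[volume] fun x => conj (e j x) := by
  have hin : ∀ f g : L2R, inner ℂ (star f) g = conj (inner ℂ f (star g)) := by
    intro f g
    rw [L2.inner_def, L2.inner_def, ← integral_conj]
    apply integral_congr_ae
    filter_upwards [Lp.coeFn_star f, Lp.coeFn_star g] with x h1 h2
    rw [h1, h2]
    simp [RCLike.inner_apply]
  have hno : ∀ f : L2R, ‖star f‖ = ‖f‖ := by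
    intro f
    rw [Lp.norm_def, Lp.norm_def]
    congr 1
    refine eLpNorm_congr_norm_ae ?_
    filter_upwards [Lp.coeFn_star f] with x h1
    rw [h1]
    simp
  obtain ⟨b, hb⟩ := exists_basis (v := fun j => star (e j)) ⟨fun j =>
      (hno (e j)).trans (e.orthonormal.1 j), fun i j hij => by
      show inner ℂ (star (e i)) (star (e j)) = 0
      rw [hin, star_star, show inner ℂ (e i) (e j) = 0 from e.orthonormal.2 hij, map_zero]⟩
    (fun x hx => by
      rw [← norm_eq_zero, ← hno, norm_eq_zero]
      refine eq_zero_of_basis_inner e fun k => ?_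
      have := hx k
      rwa [hin, map_eq_zero] at this)
  refine ⟨b, fun j => ?_⟩
  rw [hb]
  exact Lp.coeFn_star (e j)

theorem isBasisField_shift {ι : Type*} (e : HilbertBasis ι ℂ L2R) :
    IsBasisField (volume : Measure ℝ) (volume : Measure ℝ)
      fun j (z : ℝ × ℝ) => conj (e j (z.1 + z.2)) where
  measurable j := by
    have := (Lp.stronglyMeasurable (e j)).measurable
    fun_prop
  basis := by
    refine ae_of_all _ fun x => ?_
    obtain ⟨b, hb⟩ := exists_conj_basis e
    refine ⟨mapBasis b (weightedComp (MeasurableEquiv.addLeft x) (fun _ => 1) measurable_const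
      (fun _ => one_ne_zero) ?_), fun j => ?_⟩
    · simpa using (measurePreserving_add_left volume x).map_eq
    · rw [mapBasis_apply]
      refine (coeFn_weightedComp _ _ _ _ _ _).trans ?_
      filter_upwards [(measurePreserving_add_left volume x).quasiMeasurePreserving.ae (hb j)]
        with y hy
      rw [one_mul]
      exact hy

/-- The functions `e_k(x) conj e_j(x + p)` form a Hilbert basis of `L²(ℝ²)`. By `coeff_eq` the
matrix coefficients arise from them through three unitary operations: the Fourier transform in `x`,
the exchange of the two coordinates, and multiplication by `e^{-πipq}`. -/
theorem exists_coeff_basis {ι : Type*} [Countable ι] (e : HilbertBasis ι ℂ L2R) :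
    ∃ b : HilbertBasis (ι × ι) ℂ (Lp ℂ 2 (volume : Measure (ℝ × ℝ))),
      ∀ m, b m =ᵐ[volume] coeff (e m.2) (e m.1) := by
  obtain ⟨b, hb⟩ := (isBasisField_shift e).exists_prod_basis e
  have hsq : ∀ (j : ι), Integrable (fun x => ‖e j x‖ ^ 2) ∧ ∫ x, ‖e j x‖ ^ 2 = 1 := by
    intro j
    have h1 := L2.integrable_inner (𝕜 := ℂ) (e j) (e j)
    have h2 := inner_self_eq_norm_sq_to_K (𝕜 := ℂ) (e j)
    rw [e.orthonormal.1 j, L2.inner_def] at h2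
    simp only [inner_self_eq_norm_sq_to_K] at h1 h2
    refine ⟨?_, ?_⟩
    · have := h1.re
      refine this.congr (ae_of_all _ fun x => ?_)
      norm_cast
    · have h3 : ∫ x, ((‖e j x‖ ^ 2 : ℝ) : ℂ) = 1 := by
        rw [← one_pow 2]
        simpa using h2
      rw [integral_complex_ofReal] at h3
      exact_mod_cast h3
  have hPF : ∀ m, partialFourier volume (b m) =ᵐ[(volume : Measure ℝ).prod volume] fun z =>
      ∫ x : ℝ, Complex.exp (-(2 * Real.pi * Complex.I * z.1 * x)) *
        (e m.1 x * conj (e m.2 (x + z.2))) := by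
    intro m
    have hco : b m =ᵐ[(volume : Measure ℝ).prod volume] fun z => e m.1 z.1 * conj (e m.2 (z.1 + z.2)) := by
      rw [hb]
      exact (isBasisField_shift e).coeFn_isom _ _
    have hL : MemLp (fun z : ℝ × ℝ => e m.1 z.1 * conj (e m.2 (z.1 + z.2))) 2
        ((volume : Measure ℝ).prod volume) := (memLp_congr_ae hco).1 (Lp.memLp (b m))
    have hbm : b m = hL.toLp := Lp.ext (hco.trans hL.coeFn_toLp.symm)
    have hmk := (Lp.stronglyMeasurable (e m.1)).measurable
    have hmj := (Lp.stronglyMeasurable (e m.2)).measurable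
    have hbd : ∀ y : ℝ, Integrable fun x => (‖e m.1 x‖ ^ 2 + ‖e m.2 (x + y)‖ ^ 2) / 2 := fun y =>
      ((hsq m.1).1.add ((hsq m.2).1.comp_add_right y)).div_const 2
    -- Both factors have norm one in `L²`, so this inequality bounds the `L¹` norm in `x` by `1`,
    -- uniformly in `y`, as `partialFourier_ae` requires.
    have hle : ∀ x y : ℝ, ‖e m.1 x * conj (e m.2 (x + y))‖
        ≤ (‖e m.1 x‖ ^ 2 + ‖e m.2 (x + y)‖ ^ 2) / 2 := by
      intro x y
      rw [norm_mul, RCLike.norm_conj]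
      nlinarith [sq_nonneg (‖e m.1 x‖ - ‖e m.2 (x + y)‖)]
    have hi : ∀ y : ℝ, Integrable fun x => e m.1 x * conj (e m.2 (x + y)) := fun y =>
      (hbd y).mono' (Measurable.aestronglyMeasurable (by fun_prop)) (ae_of_all _ fun x => hle x y)
    rw [hbm]
    refine partialFourier_ae (C := 1) (by fun_prop) hL hi fun y => ?_
    refine (integral_mono (hi y).norm (hbd y) fun x => hle x y).trans_eq ?_
    rw [integral_div, integral_add (hsq m.1).1 ((hsq m.2).1.comp_add_right y), (hsq m.1).2,
      integral_add_right_eq_self (fun x => ‖e m.2 x‖ ^ 2), (hsq m.2).2]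
    norm_num
  refine ⟨mapBasis (mapBasis b (partialFourier volume)) (weightedComp MeasurableEquiv.prodComm
    (fun z : ℝ × ℝ => Complex.exp (-(Real.pi * Complex.I * z.1 * z.2))) (by fun_prop)
    (fun _ => Complex.exp_ne_zero _) ?_), fun m => ?_⟩
  · have : ∀ z : ℝ × ℝ, ‖Complex.exp (-(Real.pi * Complex.I * z.1 * z.2))‖ₑ = 1 := by
      intro z
      rw [← ofReal_norm, Complex.norm_exp]
      simp
    simp_rw [this]
    rw [one_pow, withDensity_const, one_smul]
    exact Measure.prod_swap (μ := (volume : Measure ℝ)) (ν := (volume : Measure ℝ))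
  · rw [mapBasis_apply, mapBasis_apply]
    refine (coeFn_weightedComp _ _ _ _ _ _).trans ?_
    have hq : ∀ᵐ z : ℝ × ℝ, partialFourier volume (b m) z.swap =
        ∫ x : ℝ, Complex.exp (-(2 * Real.pi * Complex.I * z.2 * x)) *
        (e m.1 x * conj (e m.2 (x + z.1))) :=
      (Measure.measurePreserving_swap (μ := (volume : Measure ℝ))
        (ν := (volume : Measure ℝ))).quasiMeasurePreserving.ae (hPF m)
    filter_upwards [hq] with z hz
    rw [coeff_eq, ← hz]
    rfl

/-- The field `h ↦ |h|^{1/2} ⟨ψ, ρ_h(p, q, 0) φ⟩`, for `φ`, `ψ` in a Hilbert basis. -/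
def coeffField {ι : Type*} (e : HilbertBasis ι ℂ L2R) (m : ι × ι) (z : ℝ × (ℝ × ℝ)) : ℂ :=
  (Real.sqrt |z.1| : ℂ) * coeff (e m.2) (e m.1) (z.1 * z.2.1, z.2.2)

/-- For `h ≠ 0` the dilation `p ↦ hp` carries the coefficients of `ρ₁` to those of `ρ_h`, and the
factor `|h|^{1/2}` makes it unitary. This is where the density `|h|` of the Plancherel measure
originates. -/
theorem isBasisField_coeff {ι : Type*} [Countable ι] (e : HilbertBasis ι ℂ L2R) :
    IsBasisField (volume : Measure ℝ) (volume : Measure (ℝ × ℝ)) (coeffField e) where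
  measurable m := by
    have := measurable_coeff (e m.2) (e m.1)
    unfold coeffField
    fun_prop
  basis := by
    have h0 : ∀ᵐ h : ℝ, h ≠ 0 := by
      simp [ae_iff, measure_singleton]
    filter_upwards [h0] with h hh
    obtain ⟨b, hb⟩ := exists_coeff_basis e
    have hmap : ((volume : Measure (ℝ × ℝ)).withDensity
        fun _ => ‖(Real.sqrt |h| : ℂ)‖ₑ ^ 2).map (MeasurableEquiv.prodCongr
          (MeasurableEquiv.mulLeft₀ h hh) (MeasurableEquiv.refl ℝ)) = volume := by
      have h1 : ‖(Real.sqrt |h| : ℂ)‖ₑ ^ 2 = ENNReal.ofReal |h| := by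
        rw [← ofReal_norm, ← ENNReal.ofReal_pow (norm_nonneg _)]
        simp [Real.sq_sqrt]
      rw [h1, withDensity_const, Measure.map_smul]
      have h2 : (volume : Measure (ℝ × ℝ)).map (MeasurableEquiv.prodCongr
          (MeasurableEquiv.mulLeft₀ h hh) (MeasurableEquiv.refl ℝ))
          = ENNReal.ofReal |h⁻¹| • volume := by
        have h3 := Measure.map_prod_map (volume : Measure ℝ) (volume : Measure ℝ)
          (measurable_const_mul h) measurable_id
        rw [Real.map_volume_mul_left hh, Measure.map_id, Measure.prod_smul_left] at h3
        exact h3.symm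
      rw [h2, smul_smul, ← ENNReal.ofReal_mul (abs_nonneg _), ← abs_mul, mul_inv_cancel₀ hh]
      simp
    have hs0 : (Real.sqrt |h| : ℂ) ≠ 0 := by simp [hh]
    refine ⟨mapBasis b (weightedComp _ (fun _ => (Real.sqrt |h| : ℂ)) measurable_const
      (fun _ => hs0) hmap), fun m => ?_⟩
    rw [mapBasis_apply]
    refine (coeFn_weightedComp _ _ _ _ _ _).trans ?_
    filter_upwards [ae_weighted measurable_const (fun _ => hs0) hmap (hb m)] with z hz
    rw [hz]
    rfl

/-! ### The Plancherel measure -/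

theorem ae_ne_zero : ∀ᵐ h : ℝ, h ≠ 0 := by
  simp [ae_iff, measure_singleton]

theorem plancherelMeasure_ac : plancherelMeasure ≪ volume := withDensity_absolutelyContinuous _ _

theorem ac_plancherelMeasure : volume ≪ plancherelMeasure :=
  withDensity_absolutelyContinuous' (by fun_prop) (by
    filter_upwards [ae_ne_zero] with h hh
    simp [hh])

theorem ae_plancherel_iff {p : ℝ → Prop} : (∀ᵐ h ∂plancherelMeasure, p h) ↔ ∀ᵐ h, p h :=
  ⟨fun hp => ac_plancherelMeasure hp, fun hp => plancherelMeasure_ac hp⟩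

theorem aesm_plancherel_iff {K : Type*} [TopologicalSpace K] {f : ℝ → K} :
    AEStronglyMeasurable f plancherelMeasure ↔ AEStronglyMeasurable f volume :=
  ⟨fun hf => hf.mono_ac ac_plancherelMeasure, fun hf => hf.mono_ac plancherelMeasure_ac⟩

theorem lintegral_plancherel (g : ℝ → ℝ≥0∞) :
    ∫⁻ h, g h ∂plancherelMeasure = ∫⁻ h, ENNReal.ofReal |h| * g h := by
  rw [plancherelMeasure, lintegral_withDensity_eq_lintegral_mul_non_measurable]
  · rfl
  · fun_prop
  · exact ae_of_all _ fun _ => ENNReal.ofReal_lt_top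

theorem integral_plancherel (g : ℝ → ℂ) :
    ∫ h, g h ∂plancherelMeasure = ∫ h : ℝ, ((|h| : ℝ) : ℂ) * g h := by
  rw [plancherelMeasure, integral_withDensity_eq_integral_toReal_smul (by fun_prop)
    (ae_of_all _ fun _ => ENNReal.ofReal_lt_top)]
  congr 1 with h
  rw [ENNReal.toReal_ofReal (abs_nonneg _), Complex.real_smul]

theorem integrable_plancherel_iff (g : ℝ → ℂ) :
    Integrable g plancherelMeasure ↔ Integrable fun h : ℝ => ((|h| : ℝ) : ℂ) * g h := by
  rw [plancherelMeasure, integrable_withDensity_iff_integrable_smul' (by fun_prop)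
    (ae_of_all _ fun _ => ENNReal.ofReal_lt_top)]
  refine integrable_congr (ae_of_all _ fun h => ?_)
  dsimp only
  rw [ENNReal.toReal_ofReal (abs_nonneg _), Complex.real_smul]

/-! ### Decomposition of the direct integral along a Hilbert basis of the fibre -/

section ConstField

variable {K : Type*} [NormedAddCommGroup K] [InnerProductSpace ℂ K]

theorem lintegral_constField (v : K) (hv : ‖v‖ = 1) (a : ℝ → ℂ) :
    ∫⁻ h, ‖((Real.sqrt |h| : ℂ)⁻¹ * a h) • v‖ₑ ^ 2 ∂plancherelMeasure = ∫⁻ h, ‖a h‖ₑ ^ 2 := by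
  rw [lintegral_plancherel]
  apply lintegral_congr_ae
  filter_upwards [ae_ne_zero] with h hh
  have h0 : 0 < |h| := abs_pos.2 hh
  rw [← ofReal_norm, ← ofReal_norm, norm_smul, hv, mul_one, norm_mul, norm_inv, Complex.norm_real,
    Real.norm_of_nonneg (Real.sqrt_nonneg _), ← ENNReal.ofReal_pow (by positivity),
    ← ENNReal.ofReal_pow (by positivity), ← ENNReal.ofReal_mul h0.le, mul_pow, inv_pow,
    Real.sq_sqrt h0.le, mul_inv_cancel_left₀ h0.ne']

theorem memLp_constField (v : K) (hv : ‖v‖ = 1) {a : ℝ → ℂ} (ha : MemLp a 2 volume) :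
    MemLp (fun h => ((Real.sqrt |h| : ℂ)⁻¹ * a h) • v) 2 plancherelMeasure := by
  have hm : Measurable fun h : ℝ => (Real.sqrt |h| : ℂ)⁻¹ := by fun_prop
  have h1 : AEStronglyMeasurable (fun h => ((Real.sqrt |h| : ℂ)⁻¹ * a h) • v) plancherelMeasure :=
    aesm_plancherel_iff.2 ((hm.aestronglyMeasurable.mul ha.1).smul_const v)
  rw [memLp_two_iff h1, lintegral_constField v hv]
  exact (memLp_two_iff ha.1).1 ha

/-- The isometry `a ↦ |h|^{-1/2} a(h) v` into the direct integral. -/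
def constField (v : K) (hv : ‖v‖ = 1) : L2R →ₗᵢ[ℂ] Lp K 2 plancherelMeasure where
  toFun a := (memLp_constField v hv (Lp.memLp a)).toLp
  map_add' f g := by
    rw [← MemLp.toLp_add]
    refine MemLp.toLp_congr _ _ ?_
    filter_upwards [ae_plancherel_iff.2 (Lp.coeFn_add f g)] with y hy
    rw [hy]
    simp [mul_add, add_smul]
  map_smul' c f := by
    rw [RingHom.id_apply, ← MemLp.toLp_const_smul]
    refine MemLp.toLp_congr _ _ ?_
    filter_upwards [ae_plancherel_iff.2 (Lp.coeFn_smul c f)] with y hy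
    rw [hy]
    simp [smul_smul, mul_left_comm]
  norm_map' g := by
    show ‖(memLp_constField v hv (Lp.memLp g)).toLp‖ = ‖g‖
    rw [Lp.norm_toLp, Lp.norm_def, eLpNorm_two_eq, eLpNorm_two_eq, lintegral_constField v hv]

theorem coeFn_constField (v : K) (hv : ‖v‖ = 1) (a : L2R) :
    constField v hv a =ᵐ[volume] fun h => ((Real.sqrt |h| : ℂ)⁻¹ * a h) • v :=
  ae_plancherel_iff.1 (memLp_constField v hv (Lp.memLp a)).coeFn_toLp

theorem inner_constField (v : K) (hv : ‖v‖ = 1) (a : L2R) (F : Lp K 2 plancherelMeasure) :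
    inner ℂ (constField v hv a) F
      = ∫ h, conj (a h) * ((Real.sqrt |h| : ℂ) * inner ℂ v (F h)) := by
  rw [L2.inner_def, integral_plancherel]
  apply integral_congr_ae
  filter_upwards [coeFn_constField v hv a, ae_ne_zero] with h h1 hh
  have h0 : 0 < |h| := abs_pos.2 hh
  have h2 : ((|h| : ℝ) : ℂ) * (Real.sqrt |h| : ℂ)⁻¹ = (Real.sqrt |h| : ℂ) := by
    have : ((|h| : ℝ) : ℂ) = (Real.sqrt |h| : ℂ) * (Real.sqrt |h| : ℂ) := by
      rw [← Complex.ofReal_mul, Real.mul_self_sqrt h0.le]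
    rw [this, mul_inv_cancel_right₀]
    simp [hh]
  rw [h1, inner_smul_left, map_mul, map_inv₀, Complex.conj_ofReal]
  linear_combination (conj (a h) * inner ℂ v (F h)) * h2

theorem memLp_sqrt_inner (v : K) (F : Lp K 2 plancherelMeasure) :
    MemLp (fun h => (Real.sqrt |h| : ℂ) * inner ℂ v (F h)) 2 volume := by
  have hm : Measurable fun h : ℝ => (Real.sqrt |h| : ℂ) := by fun_prop
  have hF : AEStronglyMeasurable (F : ℝ → K) volume :=
    aesm_plancherel_iff.1 (Lp.aestronglyMeasurable F)
  refine (memLp_two_iff (hm.aestronglyMeasurable.mul (aestronglyMeasurable_const.inner hF))).2 ?_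
  have h1 := (memLp_two_iff (Lp.aestronglyMeasurable F)).1 (Lp.memLp F)
  rw [lintegral_plancherel] at h1
  have h2 : ∫⁻ h : ℝ, ENNReal.ofReal (‖v‖ ^ 2) * (ENNReal.ofReal |h| * ‖F h‖ₑ ^ 2) < ∞ := by
    rw [lintegral_const_mul' _ _ ENNReal.ofReal_ne_top]
    exact ENNReal.mul_lt_top ENNReal.ofReal_lt_top h1
  refine lt_of_le_of_lt (lintegral_mono fun h => ?_) h2
  rw [← ofReal_norm, ← ofReal_norm, ← ENNReal.ofReal_pow (by positivity),
    ← ENNReal.ofReal_pow (by positivity), ← ENNReal.ofReal_mul (abs_nonneg _),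
    ← ENNReal.ofReal_mul (by positivity)]
  apply ENNReal.ofReal_le_ofReal
  rw [Pi.mul_apply, norm_mul, mul_pow, Complex.norm_real, Real.norm_of_nonneg (Real.sqrt_nonneg _),
    Real.sq_sqrt (abs_nonneg _)]
  have h3 : ‖inner ℂ v (F h)‖ ^ 2 ≤ (‖v‖ * ‖F h‖) ^ 2 :=
    pow_le_pow_left₀ (norm_nonneg _) (norm_inner_le_norm _ _) 2
  nlinarith [abs_nonneg h, mul_le_mul_of_nonneg_left h3 (abs_nonneg h)]

theorem isHilbertSum_constField [CompleteSpace K] {ι : Type*} [Countable ι]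
    (b : HilbertBasis ι ℂ K) :
    IsHilbertSum ℂ (fun _ : ι => L2R) fun i => constField (b i) (b.orthonormal.1 i) := by
  refine isHilbertSum_of_orthogonal (fun i j hij a c => ?_) fun F hF => ?_
  · rw [inner_constField]
    apply integral_eq_zero_of_ae
    filter_upwards [coeFn_constField (b j) (b.orthonormal.1 j) c] with h hh
    rw [hh, inner_smul_right, show inner ℂ (b i) (b j) = 0 from b.orthonormal.2 hij]
    simp
  · have h1 : ∀ i, ∀ᵐ h : ℝ, inner ℂ (b i) (F h) = 0 := by
      intro i
      have hL := memLp_sqrt_inner (b i) F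
      -- The coefficient `|h|^{1/2} ⟨bᵢ, F(h)⟩` is itself a legitimate choice of `a`, and pairing
      -- its field with `F` returns its own squared norm.
      have h2 : hL.toLp = 0 := by
        rw [← inner_self_eq_zero (𝕜 := ℂ)]
        refine Eq.trans ?_ (hF i hL.toLp)
        rw [inner_constField, L2.inner_def]
        apply integral_congr_ae
        filter_upwards [hL.coeFn_toLp] with h hh
        rw [hh, RCLike.inner_apply, mul_comm]
      filter_upwards [hL.coeFn_toLp, Lp.coeFn_zero ℂ 2 (volume : Measure ℝ), ae_ne_zero]
        with h h3 h4 h5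
      rw [h2, h4] at h3
      have h6 : (Real.sqrt |h| : ℂ) ≠ 0 := by simp [h5]
      exact (mul_eq_zero.1 h3.symm).resolve_left h6
    refine Lp.ext (ae_plancherel_iff.2 ?_)
    filter_upwards [ae_all_iff.2 h1, ae_plancherel_iff.1 (Lp.coeFn_zero K 2 plancherelMeasure)]
      with h h2 h3
    rw [h3]
    exact eq_zero_of_basis_inner b h2

end ConstField

/-! ### The inverse Plancherel transform -/

/-- The coordinates `(t, (p, q))` on the Heisenberg group. -/
def heisCoord : Heis ≃ᵐ ℝ × (ℝ × ℝ) :=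
  (MeasurableEquiv.prodAssoc (α := ℝ) (β := ℝ) (γ := ℝ)).symm.trans MeasurableEquiv.prodComm

theorem heisCoord_apply (x : Heis) : heisCoord x = (x.t, (x.p, x.q)) := rfl

theorem measurePreserving_heisCoord : MeasurePreserving heisCoord volume
    ((volume : Measure ℝ).prod (volume : Measure (ℝ × ℝ))) :=
  (Measure.measurePreserving_swap (μ := (volume : Measure (ℝ × ℝ)))
    (ν := (volume : Measure ℝ))).comp
    ((measurePreserving_prodAssoc (volume : Measure ℝ) (volume : Measure ℝ)
      (volume : Measure ℝ)).symm _)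

/-- `L²(ℍ)` in the coordinates `(t, (p, q))`. -/
def heisL2 : Lp ℂ 2 ((volume : Measure ℝ).prod (volume : Measure (ℝ × ℝ))) ≃ₗᵢ[ℂ] L2H :=
  weightedComp heisCoord (fun _ => 1) measurable_const (fun _ => one_ne_zero)
    (by simpa using measurePreserving_heisCoord.map_eq)

theorem coeFn_heisL2 (f : Lp ℂ 2 ((volume : Measure ℝ).prod (volume : Measure (ℝ × ℝ)))) :
    heisL2 f =ᵐ[volume] fun x => f (heisCoord x) := by
  refine (coeFn_weightedComp _ _ _ _ _ _).trans (ae_of_all _ fun x => ?_)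
  exact one_mul _

/-- The Hilbert basis of rank one operators. -/
def rankOneBasis : HilbertBasis (basisIndex L2R × basisIndex L2R) ℂ (HS L2R) :=
  (HS.exists_rankOne_basis L2R).choose

theorem rankOneBasis_apply (m : basisIndex L2R × basisIndex L2R) :
    rankOneBasis m = HS.rankOne (basis L2R m.1) (basis L2R m.2) :=
  (HS.exists_rankOne_basis L2R).choose_spec m

/-- The inverse of the Plancherel transform. -/
def plancherelInv : DirectIntegral ≃ₗᵢ[ℂ] L2H :=
  (hilbertSumEquiv (isHilbertSum_constField rankOneBasis)
    (isBasisField_coeff (basis L2R)).isHilbertSum).trans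
    ((partialFourier volume).trans heisL2)

/-- The field `|h|^{-1/2} a(h) E_m`, where `E_m` is a basis vector. -/
def basisFieldDI (m : basisIndex L2R × basisIndex L2R) : L2R →ₗᵢ[ℂ] DirectIntegral :=
  constField (rankOneBasis m) (rankOneBasis.orthonormal.1 m)

theorem plancherelInv_basisField (m : basisIndex L2R × basisIndex L2R) (a : L2R) :
    plancherelInv (basisFieldDI m a)
      = heisL2 (partialFourier volume ((isBasisField_coeff (basis L2R)).isom m a)) := by
  have h := hilbertSumEquiv_apply (isHilbertSum_constField rankOneBasis)
    (isBasisField_coeff (basis L2R)).isHilbertSum m a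
  rw [plancherelInv, LinearIsometryEquiv.trans_apply, LinearIsometryEquiv.trans_apply, ← h]
  rfl

theorem norm_coeff_basis_le (m : basisIndex L2R × basisIndex L2R) (z : ℝ × ℝ) :
    ‖coeff (basis L2R m.2) (basis L2R m.1) z‖ ≤ 1 := by
  refine (norm_coeff_le _ _ _).trans_eq ?_
  rw [(basis L2R).orthonormal.1, (basis L2R).orthonormal.1, one_mul]

/-- This is the inversion formula `∫ tr(ρ_h(x)* F(h)) |h| dh` for the field `F(h) = |h|^{-1/2} a(h)
E_m`. The kernel `e^{-2πiht}` of the Fourier transform in `h` is the conjugate of the central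
character. Matrix coefficients of basis vectors are at most `1` in modulus, so integrability of
`|h|^{1/2} a` gives the uniform bound for `partialFourier_ae`. -/
theorem plancherelInv_ae (m : basisIndex L2R × basisIndex L2R) (a : L2R)
    (ha : Integrable fun h => (Real.sqrt |h| : ℂ) * a h) :
    plancherelInv (basisFieldDI m a) =ᵐ[volume] fun x => ∫ h, (Real.sqrt |h| : ℂ) * a h *
      inner ℂ (schrodinger h x (basis L2R m.2)) (basis L2R m.1) := by
  rw [plancherelInv_basisField]
  have hB := (isBasisField_coeff (basis L2R)).coeFn_isom m a
  have ham := (Lp.stronglyMeasurable a).measurable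
  have hcm := measurable_coeff (basis L2R m.2) (basis L2R m.1)
  have hkm : Measurable fun z : ℝ × (ℝ × ℝ) => a z.1 * coeffField (basis L2R) m z := by
    unfold coeffField
    fun_prop
  have hL : MemLp (fun z : ℝ × (ℝ × ℝ) => a z.1 * coeffField (basis L2R) m z) 2
      ((volume : Measure ℝ).prod volume) := (memLp_congr_ae hB).1 (Lp.memLp _)
  have hbm : (isBasisField_coeff (basis L2R)).isom m a = hL.toLp :=
    Lp.ext (hB.trans hL.coeFn_toLp.symm)
  have hle : ∀ (y : ℝ × ℝ) (h : ℝ), ‖a h * coeffField (basis L2R) m (h, y)‖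
      ≤ ‖(Real.sqrt |h| : ℂ) * a h‖ := by
    intro y h
    have h1 := norm_coeff_basis_le m (h * y.1, y.2)
    rw [coeffField, norm_mul, norm_mul, norm_mul]
    have h2 : 0 ≤ ‖a h‖ * ‖(Real.sqrt |h| : ℂ)‖ := by positivity
    nlinarith
  have hi : ∀ y : ℝ × ℝ, Integrable fun h => a h * coeffField (basis L2R) m (h, y) := fun y =>
    ha.norm.mono' (hkm.comp measurable_prodMk_right).aestronglyMeasurable
      (ae_of_all _ fun h => hle y h)
  have key := partialFourier_ae (C := ∫ h, ‖(Real.sqrt |h| : ℂ) * a h‖) hkm hL hi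
    fun y => integral_mono (hi y).norm ha.norm fun h => hle y h
  rw [hbm]
  refine (coeFn_heisL2 _).trans ?_
  filter_upwards [measurePreserving_heisCoord.quasiMeasurePreserving.ae key] with x hx
  rw [hx]
  congr 1 with h
  rw [inner_schrodinger, heisCoord_apply, coeffField]
  have : (2 * Real.pi * Complex.I * h * x.t : ℂ) = 2 * Real.pi * Complex.I * x.t * h := by ring
  rw [this]
  ring

/-! ### The Plancherel theorem -/

instance : SigmaFinite (volume : Measure Heis) :=
  inferInstanceAs (SigmaFinite (volume : Measure (ℝ × ℝ × ℝ)))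

/-- A function into a Hilbert space is measurable if its coefficients are. -/
theorem aestronglyMeasurable_of_basis {Z ι K : Type*} [MeasurableSpace Z] {μ : Measure Z}
    [NormedAddCommGroup K] [InnerProductSpace ℂ K] [Countable ι] (b : HilbertBasis ι ℂ K)
    {f : Z → K} (h : ∀ i, AEStronglyMeasurable (fun z => inner ℂ (b i) (f z)) μ) :
    AEStronglyMeasurable f μ := by
  refine aestronglyMeasurable_of_tendsto_ae (u := (atTop : Filter (Finset ι)))
    (f := fun s z => ∑ i ∈ s, inner ℂ (b i) (f z) • b i) (fun s => ?_) (ae_of_all _ fun z => ?_)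
  · exact Finset.aestronglyMeasurable_fun_sum s fun i _ => (h i).smul_const (b i)
  · have := b.hasSum_repr (f z)
    simp_rw [b.repr_apply_apply] at this
    exact this

theorem measurable_schrodinger (h : ℝ) (φ : L2R) (μ : Measure Heis) :
    AEStronglyMeasurable (fun x : Heis => schrodinger h x φ) μ :=
  aestronglyMeasurable_of_basis (basis L2R) fun i =>
    ((measurable_inner_schrodinger φ (basis L2R i)).comp
      measurable_prodMk_left).aestronglyMeasurable

theorem integrable_smul_schrodinger (f : L2H) (hf : Integrable f volume) (h : ℝ) (φ : L2R) :
    Integrable fun x : Heis => f x • schrodinger h x φ := by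
  refine (hf.norm.mul_const ‖φ‖).mono' (hf.1.smul (measurable_schrodinger h φ _))
    (ae_of_all _ fun x => ?_)
  rw [norm_smul, norm_schrodinger]

/-- The operator `∫ f(x) ρ_h(x) dx`. -/
def integratedRep (f : L2H) (hf : Integrable f volume) (h : ℝ) : L2R →L[ℂ] L2R :=
  LinearMap.mkContinuous
    { toFun := fun φ => ∫ x : Heis, f x • schrodinger h x φ
      map_add' := fun φ ψ => by
        simp_rw [map_add, smul_add]
        exact integral_add (integrable_smul_schrodinger f hf h φ)
          (integrable_smul_schrodinger f hf h ψ)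
      map_smul' := fun c φ => by
        simp_rw [map_smul, smul_comm _ c]
        exact integral_smul c _ } (∫ x : Heis, ‖f x‖) fun φ => by
    refine (norm_integral_le_integral_norm _).trans_eq ?_
    simp_rw [norm_smul, norm_schrodinger]
    exact integral_mul_const _ _

theorem inner_integratedRep (f : L2H) (hf : Integrable f volume) (h : ℝ) (φ ψ : L2R) :
    inner ℂ ψ (integratedRep f hf h φ) = ∫ x : Heis, f x * inner ℂ ψ (schrodinger h x φ) := by
  have h1 := integral_inner (𝕜 := ℂ) (integrable_smul_schrodinger f hf h φ) ψ
  simp_rw [inner_smul_right] at h1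
  exact h1.symm

/-- Pair both sides with cut-off functions of `h`. Unitarity moves the transform to the test field,
where `plancherelInv_ae` makes it explicit, and Fubini exchanges `x` and `h`. -/
theorem inner_plancherelInv_symm_ae (f : L2H) (hf : Integrable f volume)
    (m : basisIndex L2R × basisIndex L2R) :
    ∀ᵐ h : ℝ, inner ℂ (rankOneBasis m) (plancherelInv.symm f h)
      = ∫ x : Heis, f x * inner ℂ (basis L2R m.1) (schrodinger h x (basis L2R m.2)) := by
  set r : ℝ → ℂ := fun h => ∫ x : Heis, f x * inner ℂ (basis L2R m.1) (schrodinger h x (basis L2R m.2))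
    with hr
  -- The weight ensures `|h|^{1/2} w ≤ 1`, so `a = 1_s w` satisfies the integrability hypothesis of
  -- `plancherelInv_ae` for every `s` of finite measure; being nonzero, it is cancelled at the end.
  set w : ℝ → ℂ := fun h => (((1 + |h|)⁻¹ : ℝ) : ℂ) with hw
  set σ : ℝ → ℂ := fun h => (Real.sqrt |h| : ℂ) with hσ
  have hwm : Measurable w := by fun_prop
  have hσm : Measurable σ := by fun_prop
  have hrm : StronglyMeasurable r := by
    have h1 := measurable_inner_schrodinger (basis L2R m.2) (basis L2R m.1)
    have h2 := (Lp.stronglyMeasurable f).measurable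
    refine StronglyMeasurable.integral_prod_right' (f := fun w : ℝ × Heis =>
      f w.2 * inner ℂ (basis L2R m.1) (schrodinger w.1 w.2 (basis L2R m.2))) ?_
    exact ((h2.comp measurable_snd).mul h1).stronglyMeasurable
  have hno : ∀ (h : ℝ) (x : Heis),
      ‖inner ℂ (basis L2R m.1) (schrodinger h x (basis L2R m.2))‖ ≤ 1 := by
    intro h x
    refine (norm_inner_schrodinger_le _ _ _ _).trans_eq ?_
    rw [(basis L2R).orthonormal.1, (basis L2R).orthonormal.1, one_mul]
  have hrb : ∀ h, ‖r h‖ ≤ ∫ x : Heis, ‖f x‖ := by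
    intro h
    refine norm_integral_le_of_norm_le hf.norm (ae_of_all _ fun x => ?_)
    rw [norm_mul]
    exact mul_le_of_le_one_right (norm_nonneg _) (hno h x)
  have hw1 : ∀ h, ‖w h‖ ≤ 1 := by
    intro h
    rw [hw, Complex.norm_real, Real.norm_of_nonneg (by positivity)]
    exact inv_le_one_of_one_le₀ (by linarith [abs_nonneg h])
  have hwσ : ∀ h, ‖σ h * w h‖ ≤ 1 := by
    intro h
    have h0 := abs_nonneg h
    have h1 : Real.sqrt |h| ≤ 1 + |h| := by
      nlinarith [Real.sq_sqrt h0, Real.sqrt_nonneg |h|, sq_nonneg (Real.sqrt |h| - 1)]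
    rw [norm_mul, hw, hσ, Complex.norm_real, Complex.norm_real,
      Real.norm_of_nonneg (Real.sqrt_nonneg _), Real.norm_of_nonneg (by positivity),
      ← div_eq_mul_inv, div_le_one (by positivity)]
    exact h1
  have key : ∀ᵐ h : ℝ, w h * (σ h * inner ℂ (rankOneBasis m) (plancherelInv.symm f h))
      - w h * (σ h * r h) = 0 := by
    have hInt : ∀ s : Set ℝ, MeasurableSet s → volume s < ∞ →
        IntegrableOn (fun h => w h * (σ h * inner ℂ (rankOneBasis m) (plancherelInv.symm f h))) s ∧
        IntegrableOn (fun h => w h * (σ h * r h)) s := by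
      intro s hs hμ
      have : IsFiniteMeasure (volume.restrict s) := ⟨by simpa using hμ⟩
      have hL := (memLp_sqrt_inner (rankOneBasis m) (plancherelInv.symm f)).restrict s
      refine ⟨(hL.integrable (by norm_num)).bdd_mul hwm.aestronglyMeasurable (ae_of_all _ hw1), ?_⟩
      refine Integrable.of_bound (C := ∫ x : Heis, ‖f x‖) ?_ (ae_of_all _ fun h => ?_)
      · exact (hwm.mul (hσm.mul hrm.measurable)).aestronglyMeasurable
      · rw [← mul_assoc, mul_comm (w h), norm_mul]
        exact (mul_le_of_le_one_left (norm_nonneg _) (hwσ h)).trans (hrb h)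
    refine ae_eq_zero_of_forall_setIntegral_eq_of_sigmaFinite
      (fun s hs hμ => (hInt s hs hμ).1.sub (hInt s hs hμ).2) fun s hs hμ => ?_
    rw [integral_sub (hInt s hs hμ).1 (hInt s hs hμ).2, sub_eq_zero]
    have : IsFiniteMeasure (volume.restrict s) := ⟨by simpa using hμ⟩
    have haL : MemLp (s.indicator w) 2 volume :=
      (memLp_indicator_iff_restrict hs).2 (MemLp.of_bound hwm.aestronglyMeasurable 1 (ae_of_all _ hw1))
    have hconj : ∀ h, conj (w h) = w h := fun h => Complex.conj_ofReal _
    set a : L2R := haL.toLp with ha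
    have haco : a =ᵐ[volume] s.indicator w := haL.coeFn_toLp
    have hσa : Integrable fun h => σ h * a h := by
      have h1 : Integrable (s.indicator fun h => σ h * w h) :=
        (integrable_indicator_iff hs).2 (Integrable.of_bound (C := 1)
          (hσm.mul hwm).aestronglyMeasurable (ae_of_all _ hwσ))
      refine h1.congr ?_
      filter_upwards [haco] with h hh
      rw [hh]
      by_cases hhs : h ∈ s <;> simp [hhs]
    have h1 : inner ℂ (basisFieldDI m a) (plancherelInv.symm f)
        = ∫ h in s, w h * (σ h * inner ℂ (rankOneBasis m) (plancherelInv.symm f h)) := by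
      rw [basisFieldDI, inner_constField, ← integral_indicator hs]
      apply integral_congr_ae
      filter_upwards [haco] with h hh
      rw [hh]
      by_cases hhs : h ∈ s <;> simp [hhs, hconj, hσ]
    have h2 : inner ℂ (basisFieldDI m a) (plancherelInv.symm f)
        = inner ℂ (plancherelInv (basisFieldDI m a)) f := by
      rw [← plancherelInv.inner_map_map, plancherelInv.apply_symm_apply]
    have h3 : inner ℂ (plancherelInv (basisFieldDI m a)) f
        = ∫ x : Heis, ∫ h : ℝ, conj (σ h * a h) * (f x *
          inner ℂ (basis L2R m.1) (schrodinger h x (basis L2R m.2))) := by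
      rw [L2.inner_def]
      apply integral_congr_ae
      filter_upwards [plancherelInv_ae m a hσa] with x hx
      rw [hx, RCLike.inner_apply, ← integral_conj, ← integral_const_mul]
      congr 1 with h
      rw [map_mul, inner_conj_symm]
      ring
    have h4 : ∫ x : Heis, ∫ h : ℝ, conj (σ h * a h) * (f x *
          inner ℂ (basis L2R m.1) (schrodinger h x (basis L2R m.2)))
        = ∫ h : ℝ, ∫ x : Heis, conj (σ h * a h) * (f x *
          inner ℂ (basis L2R m.1) (schrodinger h x (basis L2R m.2))) := by
      apply integral_integral_swap
      have h5 : Integrable (fun w : Heis × ℝ => f w.1 * (σ w.2 * a w.2))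
        ((volume : Measure Heis).prod volume) := hf.mul_prod hσa
      refine h5.norm.mono' ?_ (ae_of_all _ fun w => ?_)
      · have e1 := (measurable_inner_schrodinger (basis L2R m.2) (basis L2R m.1)).comp
          (measurable_swap (α := Heis) (β := ℝ))
        have e2 := (Lp.stronglyMeasurable f).measurable
        have e3 := (Lp.stronglyMeasurable a).measurable
        refine Measurable.aestronglyMeasurable ?_
        refine Measurable.mul ?_ ((e2.comp measurable_fst).mul e1)
        fun_prop
      · simp only [Function.uncurry]
        rw [norm_mul, norm_mul, norm_mul, RCLike.norm_conj, mul_comm]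
        refine mul_le_mul_of_nonneg_right ?_ (norm_nonneg _)
        exact mul_le_of_le_one_right (norm_nonneg _) (hno _ _)
    rw [← h1, h2, h3, h4, ← integral_indicator hs]
    apply integral_congr_ae
    filter_upwards [haco] with h hh
    rw [integral_const_mul, hh]
    by_cases hhs : h ∈ s
    · simp only [hhs, Set.indicator_of_mem, map_mul, hconj]
      rw [show conj (σ h) = σ h from Complex.conj_ofReal _]
      ring
    · simp [hhs]
  filter_upwards [key, ae_ne_zero] with h hh h0
  have hw0 : w h ≠ 0 := by
    have : (1 + |h|)⁻¹ ≠ 0 := by positivity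
    exact Complex.ofReal_ne_zero.2 this
  have hσ0 : σ h ≠ 0 := by simp [hσ, h0]
  exact mul_left_cancel₀ hσ0 (mul_left_cancel₀ hw0 (sub_eq_zero.1 hh))

theorem toCLM_plancherelInv_symm_ae (f : L2H) (hf : Integrable f volume) :
    ∀ᵐ h : ℝ, (plancherelInv.symm f h).toCLM = integratedRep f hf h := by
  filter_upwards [ae_all_iff.2 (inner_plancherelInv_symm_ae f hf)] with h hh
  refine ContinuousLinearMap.ext_on (s := Set.range (basis L2R)) ?_ ?_
  · rw [dense_iff_closure_eq, ← Submodule.topologicalClosure_coe, (basis _).dense_span]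
    rfl
  · rintro _ ⟨j, rfl⟩
    rw [← sub_eq_zero]
    refine eq_zero_of_basis_inner (basis L2R) fun k => ?_
    have h1 := hh (k, j)
    rw [rankOneBasis_apply, HS.inner_rankOne] at h1
    rw [inner_sub_right, h1, inner_integratedRep, sub_self]

/-- An operator with the prescribed matrix coefficients is unique, so the choice made in `fourier`
must return the one already constructed. -/
theorem fourier_ae (f : L2H) (hf : Integrable f volume) :
    fourier f =ᵐ[volume] plancherelInv.symm f := by
  filter_upwards [toCLM_plancherelInv_symm_ae f hf] with h hh
  have ex : ∃ T : HS L2R, ∀ φ ψ : L2R,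
      inner ℂ ψ (T.toCLM φ) = ∫ x : Heis, f x * inner ℂ ψ (schrodinger h x φ) :=
    ⟨plancherelInv.symm f h, fun φ ψ => by rw [hh, inner_integratedRep]⟩
  rw [fourier, dif_pos ex]
  refine HS.ext_basis fun k j => ?_
  rw [ex.choose_spec, hh, inner_integratedRep]

theorem fourierField_eq (f : L2H) (hf : Integrable f volume) :
    fourierField f = plancherelInv.symm f := by
  have h1 := ae_plancherel_iff.2 (fourier_ae f hf)
  have h2 : MemLp (fourier f) 2 plancherelMeasure := (memLp_congr_ae h1).2 (Lp.memLp _)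
  rw [fourierField, dif_pos h2]
  exact Lp.ext (h2.coeFn_toLp.trans h1)

theorem dense_integrable : Dense {f : L2H | Integrable f volume} := by
  refine (Lp.simpleFunc.dense (E := ℂ) (p := 2) (μ := (volume : Measure Heis))
    (by norm_num)).mono ?_
  intro f hf
  have h1 := Lp.simpleFunc.toSimpleFunc_eq_toFun (⟨f, hf⟩ : Lp.simpleFunc ℂ 2 volume)
  have h2 := Lp.simpleFunc.memLp (⟨f, hf⟩ : Lp.simpleFunc ℂ 2 (volume : Measure Heis))
  exact ((SimpleFunc.memLp_iff_integrable (by norm_num) (by norm_num)).1 h2).congr h1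

/-- On the dense set of integrable `f` the two agree, and the right-hand side is continuous, so it
is the extension by continuity. -/
theorem plancherel_eq (f : L2H) : plancherel f = plancherelInv.symm f := by
  refine extendFrom_eq (dense_integrable f) ?_
  refine (plancherelInv.symm.continuous.continuousAt.mono_left nhdsWithin_le_nhds :
    Tendsto plancherelInv.symm _ _).congr' ?_
  filter_upwards [self_mem_nhdsWithin] with g hg
  exact (fourierField_eq g hg).symm

/-! ### The Plancherel transform and the left regular representation -/

/-- A closed relation that holds almost everywhere passes to limits in `L²`. -/
theorem ae_rel_of_tendsto {Z K K' : Type*} [MeasurableSpace Z] {μ : Measure Z}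
    [NormedAddCommGroup K] [NormedAddCommGroup K'] {R : Z → K → K' → Prop}
    (hR : ∀ z, IsClosed {p : K × K' | R z p.1 p.2}) {F : ℕ → Lp K 2 μ} {F₀ : Lp K 2 μ}
    {G : ℕ → Lp K' 2 μ} {G₀ : Lp K' 2 μ} (hF : Tendsto F atTop (𝓝 F₀))
    (hG : Tendsto G atTop (𝓝 G₀)) (h : ∀ n, ∀ᵐ z ∂μ, R z (F n z) (G n z)) :
    ∀ᵐ z ∂μ, R z (F₀ z) (G₀ z) := by
  obtain ⟨ns, hns, h1⟩ := (tendstoInMeasure_of_tendsto_Lp hF).exists_seq_tendsto_ae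
  obtain ⟨ms, hms, h2⟩ := (tendstoInMeasure_of_tendsto_Lp
    (hG.comp hns.tendsto_atTop)).exists_seq_tendsto_ae
  filter_upwards [h1, h2, ae_all_iff.2 h] with z h3 h4 h5
  exact (hR z).mem_of_tendsto ((h3.comp hms.tendsto_atTop).prodMk_nhds h4)
    (Eventually.of_forall fun n => h5 (ns (ms n)))

/-- The Plancherel transform as a unitary operator. -/
def plancherelU : L2H ≃ₗᵢ[ℂ] DirectIntegral := plancherelInv.symm

theorem plancherel_eq_plancherelU (f : L2H) : plancherel f = plancherelU f := plancherel_eq f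

theorem coeFn_leftReg (x : Heis) (f : L2H) : leftReg x f =ᵐ[volume] fun y => f (x⁻¹ * y) :=
  Lp.coeFn_compMeasurePreserving f (Heis.measurePreserving_mul_left x⁻¹)

theorem leftReg_leftReg_inv (x : Heis) (f : L2H) : leftReg x (leftReg x⁻¹ f) = f := by
  refine Lp.ext ((coeFn_leftReg x _).trans ?_)
  filter_upwards [(Heis.measurePreserving_mul_left x⁻¹).quasiMeasurePreserving.ae
    (coeFn_leftReg x⁻¹ f)] with y hy
  rw [hy, inv_inv, mul_inv_cancel_left]

theorem inner_leftReg_right (x : Heis) (f g : L2H) :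
    inner ℂ f (leftReg x g) = inner ℂ (leftReg x⁻¹ f) g := by
  rw [← (leftReg x).inner_map_map (leftReg x⁻¹ f), leftReg_leftReg_inv]

theorem integrable_leftReg (x : Heis) {f : L2H} (hf : Integrable f volume) :
    Integrable (leftReg x f) volume :=
  ((Heis.measurePreserving_mul_left x⁻¹).integrable_comp_of_integrable hf).congr
    (coeFn_leftReg x f).symm

theorem integral_comp_measurePreserving {X Y : Type*} [MeasurableSpace X] [MeasurableSpace Y]
    {μ : Measure X} {ν : Measure Y} {T : X → Y} (hT : MeasurePreserving T μ ν) {g : Y → ℂ}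
    (hg : AEStronglyMeasurable g ν) : ∫ x, g (T x) ∂μ = ∫ y, g y ∂ν := by
  rw [← hT.map_eq] at hg ⊢
  exact (integral_map hT.measurable.aemeasurable hg).symm

theorem integratedRep_leftReg (x : Heis) {f : L2H} (hf : Integrable f volume) (h : ℝ) :
    integratedRep (leftReg x f) (integrable_leftReg x hf) h
      = schrodinger h x ∘L integratedRep f hf h := by
  ext1 φ
  refine ext_inner_left ℂ fun ψ => ?_
  rw [inner_integratedRep, ContinuousLinearMap.comp_apply, ← ContinuousLinearMap.adjoint_inner_left,
    inner_integratedRep]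
  have hT := Heis.measurePreserving_mul_left x
  have hm : AEStronglyMeasurable (fun y : Heis => leftReg x f y * inner ℂ ψ (schrodinger h y φ))
      volume :=
    (Lp.aestronglyMeasurable _).mul ((measurable_inner_schrodinger φ ψ).comp
      measurable_prodMk_left).aestronglyMeasurable
  rw [← integral_comp_measurePreserving hT hm]
  apply integral_congr_ae
  filter_upwards [hT.quasiMeasurePreserving.ae (coeFn_leftReg x f)] with y hy
  rw [hy, inv_mul_cancel_left, ContinuousLinearMap.adjoint_inner_left, schrodinger_mul]
  rfl

theorem toCLM_plancherelU_ae (f : L2H) (hf : Integrable f volume) :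
    ∀ᵐ h : ℝ, (plancherelU f h).toCLM = integratedRep f hf h :=
  toCLM_plancherelInv_symm_ae f hf

theorem exists_seq_integrable (f : L2H) :
    ∃ u : ℕ → L2H, (∀ n, Integrable (u n) volume) ∧ Tendsto u atTop (𝓝 f) :=
  mem_closure_iff_seq_limit.1 (dense_integrable f)

theorem HS.continuous_lcomp (A : L2R →L[ℂ] L2R) (hA : ∀ v w, inner ℂ (A v) (A w) = inner ℂ v w) :
    Continuous (HS.lcomp A) := by
  refine (Isometry.of_dist_eq fun S T => ?_).continuous
  rw [dist_eq_norm, dist_eq_norm, ← HS.norm_lcomp_of_isometry hA (S - T)]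
  congr 1
  apply HS.toCLM_injective
  rw [map_sub, HS.toCLM_lcomp, HS.toCLM_lcomp, HS.toCLM_lcomp, map_sub,
    ContinuousLinearMap.comp_sub]

/-- For integrable `f` this is invariance of Haar measure together with `ρ_h(xy) = ρ_h(x) ρ_h(y)`.
The fibrewise equation is closed, hence survives `L²` limits. -/
theorem plancherelU_leftReg (x : Heis) (f : L2H) :
    ∀ᵐ h : ℝ, plancherelU (leftReg x f) h = HS.lcomp (schrodinger h x) (plancherelU f h) := by
  obtain ⟨u, hu, hlim⟩ := exists_seq_integrable f
  rw [← ae_plancherel_iff]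
  refine ae_rel_of_tendsto (R := fun h S T => T = HS.lcomp (schrodinger h x) S)
    (fun h => isClosed_eq continuous_snd ((HS.continuous_lcomp _ (schrodinger_inner h x)).comp
      continuous_fst)) ((plancherelU.continuous.tendsto f).comp hlim)
    (((plancherelU.continuous.comp (leftReg x).continuous).tendsto f).comp hlim) fun n => ?_
  rw [ae_plancherel_iff]
  filter_upwards [toCLM_plancherelU_ae (u n) (hu n),
    toCLM_plancherelU_ae _ (integrable_leftReg x (hu n))] with h h1 h2
  apply HS.toCLM_injective
  rw [HS.toCLM_lcomp]
  show (plancherelU (leftReg x (u n)) h).toCLM = _ ∘L (plancherelU (u n) h).toCLM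
  rw [h1, h2, integratedRep_leftReg]

theorem inner_eq_integral (f g : L2H) :
    inner ℂ f g = ∫ h, inner ℂ (plancherelU f h) (plancherelU g h) ∂plancherelMeasure := by
  rw [← plancherelU.inner_map_map, L2.inner_def]

theorem inner_leftReg_eq_integral (x : Heis) (f g : L2H) :
    inner ℂ (leftReg x f) g = ∫ h, inner ℂ (HS.lcomp (schrodinger h x) (plancherelU f h))
      (plancherelU g h) ∂plancherelMeasure := by
  rw [inner_eq_integral]
  apply integral_congr_ae
  filter_upwards [ae_plancherel_iff.2 (plancherelU_leftReg x f)] with h hh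
  rw [hh]

/-! ### Fields of rank one operators -/

namespace HS

variable {E : Type*} [NormedAddCommGroup E] [InnerProductSpace ℂ E] [CompleteSpace E]

theorem rankOne_sub_right (φ v w : E) : rankOne φ (v - w) = rankOne φ v - rankOne φ w := by
  apply toCLM_injective
  ext1 u
  simp [rankOne_apply, sub_smul]

theorem rankOne_sub_left (φ ψ v : E) : rankOne (φ - ψ) v = rankOne φ v - rankOne ψ v := by
  apply toCLM_injective
  ext1 u
  simp [rankOne_apply, smul_sub]

theorem continuous_rankOne_right (φ : E) : Continuous (rankOne φ) := by
  refine (LipschitzWith.of_dist_le_mul (K := ‖φ‖₊) fun v w => ?_).continuous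
  rw [dist_eq_norm, dist_eq_norm, ← rankOne_sub_right, norm_rankOne]
  rfl

theorem continuous_rankOne_left (v : E) : Continuous fun φ => rankOne φ v := by
  refine (LipschitzWith.of_dist_le_mul (K := ‖v‖₊) fun φ ψ => ?_).continuous
  rw [dist_eq_norm, dist_eq_norm, ← rankOne_sub_left, norm_rankOne, mul_comm]
  rfl

theorem lcomp_rankOne (A : E →L[ℂ] E) (φ v : E) : lcomp A (rankOne φ v) = rankOne (A φ) v := by
  apply toCLM_injective
  ext1 u
  rw [toCLM_lcomp, ContinuousLinearMap.comp_apply, rankOne_apply, rankOne_apply, map_smul]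

end HS

theorem aesm_apply {F : DirectIntegral} {v : ℝ → L2R} (hv : AEStronglyMeasurable v volume) :
    AEStronglyMeasurable (fun h => (F h).toCLM (v h)) volume := by
  have h1 : AEStronglyMeasurable (fun h => (F h).toCLM) volume :=
    HS.continuous_toCLM.comp_aestronglyMeasurable
      (aesm_plancherel_iff.1 (Lp.aestronglyMeasurable F))
  exact (isBoundedBilinearMap_apply (𝕜 := ℂ) (E := L2R) (F := L2R)).continuous.comp_aestronglyMeasurable
    (h1.prodMk hv)

theorem memLp_of_le_mul (F : DirectIntegral) {K : Type*} [NormedAddCommGroup K] {B : ℝ → K}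
    (hB : AEStronglyMeasurable B volume) (C : ℝ) (hle : ∀ᵐ h : ℝ, ‖B h‖ ≤ C * ‖F h‖) :
    MemLp B 2 plancherelMeasure :=
  (Lp.memLp F).of_le_mul (aesm_plancherel_iff.2 hB) (ae_plancherel_iff.2 hle)

/-- Expanding `b(h)` in a countable basis reduces joint measurability in `(x, h)` to coefficients of
fixed vectors. -/
theorem measurable_inner_schrodinger_field {a b : ℝ → L2R} (ha : AEStronglyMeasurable a volume)
    (hb : AEStronglyMeasurable b volume) :
    AEStronglyMeasurable (fun w : Heis × ℝ => inner ℂ (a w.2) (schrodinger w.2 w.1 (b w.2)))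
      ((volume : Measure Heis).prod volume) := by
  have hbi : ∀ φ : L2R, AEStronglyMeasurable (fun w : Heis × ℝ => inner ℂ φ
      (schrodinger w.2 w.1 (b w.2))) ((volume : Measure Heis).prod volume) := by
    intro φ
    refine aestronglyMeasurable_of_tendsto_ae (u := (atTop : Filter (Finset (basisIndex L2R))))
      (f := fun s w => ∑ i ∈ s, inner ℂ (basis L2R i) (b w.2) *
        inner ℂ φ (schrodinger w.2 w.1 (basis L2R i)))
      (fun s => ?_) (ae_of_all _ fun w => ?_)
    · refine Finset.aestronglyMeasurable_fun_sum s fun i _ => ?_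
      refine AEStronglyMeasurable.mul ?_ ?_
      · exact (aestronglyMeasurable_const.inner hb).comp_snd
      · exact ((measurable_inner_schrodinger (basis L2R i) φ).comp
          measurable_swap).aestronglyMeasurable
    · have h1 := (((basis L2R).hasSum_repr (b w.2)).mapL (schrodinger w.2 w.1)).mapL (innerSL ℂ φ)
      simp only [(basis L2R).repr_apply_apply, map_smul, smul_eq_mul] at h1
      exact h1
  have h2 : AEStronglyMeasurable (fun w : Heis × ℝ => schrodinger w.2 w.1 (b w.2))
      ((volume : Measure Heis).prod volume) :=
    aestronglyMeasurable_of_basis (basis L2R) fun i => hbi _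
  exact AEStronglyMeasurable.inner ha.comp_snd h2

/-- Integrating a field of matrix coefficients against `f`. -/
theorem integral_mul_inner_schrodinger {a b : ℝ → L2R} (ha : AEStronglyMeasurable a volume)
    (hb : AEStronglyMeasurable b volume) (hab : Integrable (fun h => ‖a h‖ * ‖b h‖) plancherelMeasure)
    (f : L2H) (hf : Integrable f volume) :
    ∫ x : Heis, f x * ∫ h, inner ℂ (a h) (schrodinger h x (b h)) ∂plancherelMeasure
      = ∫ h, inner ℂ (a h) ((plancherelU f h).toCLM (b h)) ∂plancherelMeasure := by
  have hfin : SigmaFinite plancherelMeasure := SigmaFinite.withDensity_ofReal _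
  simp_rw [← integral_const_mul]
  rw [integral_integral_swap]
  · apply integral_congr_ae
    filter_upwards [ae_plancherel_iff.2 (toCLM_plancherelU_ae f hf)] with h hh
    rw [hh, inner_integratedRep]
  · have h1 : Integrable (fun w : Heis × ℝ => f w.1 * ((‖a w.2‖ * ‖b w.2‖ : ℝ) : ℂ))
        ((volume : Measure Heis).prod plancherelMeasure) := hf.mul_prod hab.ofReal
    have hac : (volume : Measure Heis).prod plancherelMeasure ≪ (volume : Measure Heis).prod volume :=
      Measure.AbsolutelyContinuous.prod Measure.AbsolutelyContinuous.rfl plancherelMeasure_ac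
    refine h1.norm.mono' ?_ (ae_of_all _ fun w => ?_)
    · exact (Lp.aestronglyMeasurable f).comp_fst.mul
        ((measurable_inner_schrodinger_field ha hb).mono_ac hac)
    · simp only [Function.uncurry]
      rw [norm_mul, norm_mul, Complex.norm_real, Real.norm_of_nonneg (by positivity)]
      refine mul_le_mul_of_nonneg_left ?_ (norm_nonneg _)
      exact norm_inner_schrodinger_le _ _ _ _

/-- If two pairs of functions have the same matrix coefficients for the left regular
representation, and one member of each pair has a transform of rank one, then the transforms are
related fibrewise. -/
theorem rankOne_ae_of_inner_leftReg {F G F' G' : L2H} {φ φ' : L2R} {v v' : ℝ → L2R} {C : ℝ}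
    (hv : AEStronglyMeasurable v volume) (hv' : AEStronglyMeasurable v' volume)
    (hvC : ∀ h, ‖v h‖ ≤ C) (hvC' : ∀ h, ‖v' h‖ ≤ C)
    (hF : ∀ᵐ h : ℝ, plancherelU F h = HS.rankOne φ (v h))
    (hG' : ∀ᵐ h : ℝ, plancherelU G' h = HS.rankOne φ' (v' h))
    (heq : ∀ x, inner ℂ F (leftReg x G) = inner ℂ F' (leftReg x G')) :
    ∀ᵐ h : ℝ, HS.rankOne φ ((plancherelU G h).toCLM (v h))
      = HS.rankOne ((plancherelU F' h).toCLM (v' h)) φ' := by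
  have hbound : ∀ (K : L2H) (u : ℝ → L2R), (∀ h, ‖u h‖ ≤ C) → ∀ h,
      ‖(plancherelU K h).toCLM (u h)‖ ≤ C * ‖plancherelU K h‖ := by
    intro K u hu h
    refine (HS.opNorm_le _ _).trans ?_
    rw [mul_comm]
    exact mul_le_mul_of_nonneg_right (hu h) (norm_nonneg _)
  have hu := aesm_apply (F := plancherelU G) hv
  have hu' := aesm_apply (F := plancherelU F') hv'
  have hB : MemLp (fun h => HS.rankOne φ ((plancherelU G h).toCLM (v h))) 2 plancherelMeasure := by
    refine memLp_of_le_mul (plancherelU G)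
      ((HS.continuous_rankOne_right φ).comp_aestronglyMeasurable hu) (‖φ‖ * C)
      (ae_of_all _ fun h => ?_)
    rw [HS.norm_rankOne, mul_assoc]
    exact mul_le_mul_of_nonneg_left (hbound G v hvC h) (norm_nonneg _)
  have hB' : MemLp (fun h => HS.rankOne ((plancherelU F' h).toCLM (v' h)) φ') 2 plancherelMeasure := by
    refine memLp_of_le_mul (plancherelU F')
      ((HS.continuous_rankOne_left φ').comp_aestronglyMeasurable hu') (C * ‖φ'‖)
      (ae_of_all _ fun h => ?_)
    rw [HS.norm_rankOne, mul_right_comm]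
    exact mul_le_mul_of_nonneg_right (hbound F' v' hvC' h) (norm_nonneg _)
  have hint : ∀ (K L : L2H) (c : ℝ → L2R) (χ : L2R), AEStronglyMeasurable c volume →
      (∀ h, ‖c h‖ ≤ C) → (∀ᵐ h : ℝ, plancherelU L h = HS.rankOne χ (c h)) →
      Integrable (fun h => ‖χ‖ * ‖(plancherelU K h).toCLM (c h)‖) plancherelMeasure := by
    intro K L c χ hc hcC hL
    have h1 : Integrable (fun h => ‖plancherelU K h‖ * ‖plancherelU L h‖) plancherelMeasure :=
      (Lp.memLp (plancherelU K)).norm.integrable_mul (Lp.memLp (plancherelU L)).norm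
    refine h1.mono' (aesm_plancherel_iff.2 (aestronglyMeasurable_const.mul
      (aesm_apply (F := plancherelU K) hc).norm)) ?_
    filter_upwards [ae_plancherel_iff.2 hL] with h hh
    rw [Real.norm_of_nonneg (by positivity), hh, HS.norm_rankOne]
    have h2 := mul_le_mul_of_nonneg_left (HS.opNorm_le (plancherelU K h) (c h)) (norm_nonneg χ)
    linarith
  -- Integrating `x ↦ ⟨F, λ(x)G⟩` against `f` gives, by Fubini, the pairing of the rank one field `φ
  -- ⊗ Ĝ(h)v(h)` with `f̂`; likewise for the primed pair. As such `f̂` are dense, the coefficient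
  -- function determines the field.
  have key : ∀ f : L2H, Integrable f volume →
      inner ℂ hB.toLp (plancherelU f) = inner ℂ hB'.toLp (plancherelU f) := by
    intro f hf
    have h1 : inner ℂ hB.toLp (plancherelU f) = ∫ x : Heis, f x * inner ℂ F (leftReg x G) := by
      have h2 := integral_mul_inner_schrodinger aestronglyMeasurable_const hu
        (hint G F v φ hv hvC hF) f hf
      rw [L2.inner_def]
      refine Eq.trans ?_ (h2.symm.trans ?_)
      · apply integral_congr_ae
        filter_upwards [hB.coeFn_toLp] with h hh
        rw [hh, HS.inner_rankOne]
      · congr 1 with x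
        congr 1
        rw [inner_eq_integral]
        apply integral_congr_ae
        filter_upwards [ae_plancherel_iff.2 hF, ae_plancherel_iff.2 (plancherelU_leftReg x G)]
          with h h3 h4
        rw [h3, h4, HS.inner_rankOne]
        rfl
    have h1' : inner ℂ hB'.toLp (plancherelU f)
        = ∫ x : Heis, f x * inner ℂ F' (leftReg x G') := by
      have h2 := integral_mul_inner_schrodinger hu' (b := fun _ => φ') aestronglyMeasurable_const
        ((hint F' G' v' φ' hv' hvC' hG').congr (ae_of_all _ fun h => mul_comm _ _)) f hf
      rw [L2.inner_def]
      refine Eq.trans ?_ (h2.symm.trans ?_)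
      · apply integral_congr_ae
        filter_upwards [hB'.coeFn_toLp] with h hh
        rw [hh, HS.inner_rankOne]
      · congr 1 with x
        congr 1
        rw [inner_eq_integral]
        apply integral_congr_ae
        filter_upwards [ae_plancherel_iff.2 hG', ae_plancherel_iff.2 (plancherelU_leftReg x G')]
          with h h3 h4
        rw [h4, h3, HS.lcomp_rankOne, ← inner_conj_symm, ← inner_conj_symm (plancherelU F' h),
          HS.inner_rankOne]
    rw [h1, h1']
    simp_rw [heq]
  have hall : ∀ f : L2H, inner ℂ hB.toLp (plancherelU f) = inner ℂ hB'.toLp (plancherelU f) := by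
    intro f
    have hc : IsClosed {f : L2H | inner ℂ hB.toLp (plancherelU f)
        = inner ℂ hB'.toLp (plancherelU f)} :=
      isClosed_eq (continuous_const.inner plancherelU.continuous)
        (continuous_const.inner plancherelU.continuous)
    exact closure_minimal (fun g hg => key g hg) hc (dense_integrable f)
  have hBB : hB.toLp = hB'.toLp := by
    refine ext_inner_right ℂ fun T => ?_
    have := hall (plancherelU.symm T)
    rwa [plancherelU.apply_symm_apply] at this
  filter_upwards [ae_plancherel_iff.1 hB.coeFn_toLp, ae_plancherel_iff.1 hB'.coeFn_toLp] with h h1 h2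
  rw [← h1, ← h2, hBB]

/-! ### Existence of the projection field -/

section ProjectionField

instance : SigmaFinite plancherelMeasure := SigmaFinite.withDensity_ofReal _

/-- Constant fields are not square integrable for `|h| dh`, so they have to be damped by a positive
weight. Truncating an integrable positive `g` at `1` gives `w² ≤ w ≤ g`, and also the pointwise
bound that `rankOne_ae_of_inner_leftReg` needs. -/
theorem exists_weight : ∃ w : ℝ → ℝ, Measurable w ∧ (∀ h, 0 < w h) ∧ (∀ h, w h ≤ 1) ∧
    MemLp w 2 plancherelMeasure := by
  obtain ⟨g, hg0, hgm, hg⟩ := exists_pos_lintegral_lt_of_sigmaFinite plancherelMeasure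
    (ε := 1) one_ne_zero
  have hm : Measurable fun h => min (g h : ℝ) 1 := by fun_prop
  have h0 : ∀ h, 0 < min (g h : ℝ) 1 := fun h => lt_min (by exact_mod_cast hg0 h) one_pos
  refine ⟨fun h => min (g h : ℝ) 1, hm, h0, fun h => min_le_right _ _, ?_⟩
  rw [memLp_two_iff hm.aestronglyMeasurable]
  refine lt_of_le_of_lt (lintegral_mono fun h => ?_) (hg.trans ENNReal.one_lt_top)
  rw [← ofReal_norm, Real.norm_of_nonneg (h0 h).le, ← ENNReal.ofReal_pow (h0 h).le,
    ← ENNReal.ofReal_coe_nnreal]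
  apply ENNReal.ofReal_le_ofReal
  have h1 := min_le_left (g h : ℝ) 1
  have h2 := min_le_right (g h : ℝ) 1
  nlinarith [h0 h]

theorem nonempty_basisIndex : Nonempty (basisIndex L2R) := by
  by_contra hne
  rw [not_nonempty_iff] at hne
  have h1 : ∀ f : L2R, f = 0 := fun f => eq_zero_of_basis_inner (basis L2R) fun k => hne.elim k
  have h2 := norm_indicatorConstLp (p := 2) (E := ℂ) (c := 1) (μ := (volume : Measure ℝ))
    (s := Set.Icc 0 1) (hs := measurableSet_Icc) (hμs := by simp) (by norm_num) (by norm_num)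
  rw [h1 (indicatorConstLp _ _ _ _)] at h2
  simp at h2

/-- The field `1_s(h) w(h) E_m` on which projections are tested. -/
theorem exists_testField {w : ℝ → ℝ} (hw : Measurable w)
    (hwL : MemLp w 2 plancherelMeasure) (s : Set ℝ) (hs : MeasurableSet s)
    (m : basisIndex L2R × basisIndex L2R) :
    ∃ F : L2H, ∀ᵐ h : ℝ, plancherelU F h
      = HS.rankOne (basis L2R m.1) (((s.indicator w h : ℝ) : ℂ) • basis L2R m.2) := by
  have hm : Measurable fun h => ((s.indicator w h : ℝ) : ℂ) :=
    Complex.measurable_ofReal.comp (hw.indicator hs)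
  have hL : MemLp (fun h => HS.rankOne (basis L2R m.1) (((s.indicator w h : ℝ) : ℂ) • basis L2R m.2)) 2
      plancherelMeasure := by
    refine hwL.of_le ?_ (ae_of_all _ fun h => ?_)
    · exact (HS.continuous_rankOne_right _).comp_aestronglyMeasurable
        (hm.aestronglyMeasurable.smul_const _)
    · rw [HS.norm_rankOne, norm_smul, (basis L2R).orthonormal.1, (basis L2R).orthonormal.1,
        one_mul, mul_one, Complex.norm_real]
      exact norm_indicator_le_norm_self _ _
  refine ⟨plancherelU.symm hL.toLp, ?_⟩
  rw [plancherelU.apply_symm_apply]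
  exact ae_plancherel_iff.1 hL.coeFn_toLp

variable {H : Submodule ℂ L2H} [CompleteSpace H]

theorem starProjection_leftReg (hinv : ∀ x : Heis, ∀ f ∈ H, leftReg x f ∈ H) (x : Heis) (f : L2H) :
    H.starProjection (leftReg x f) = leftReg x (H.starProjection f) := by
  refine Submodule.eq_starProjection_of_mem_of_inner_eq_zero
    (hinv x _ (Submodule.starProjection_apply_mem H f)) fun g hg => ?_
  rw [← map_sub, ← inner_conj_symm, inner_leftReg_right, inner_conj_symm]
  exact Submodule.starProjection_inner_eq_zero f _ (hinv x⁻¹ g hg)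

theorem inner_starProjection_leftReg (hinv : ∀ x : Heis, ∀ f ∈ H, leftReg x f ∈ H) (F G : L2H)
    (x : Heis) : inner ℂ F (leftReg x (H.starProjection G))
      = inner ℂ (H.starProjection F) (leftReg x G) := by
  rw [← starProjection_leftReg hinv, Submodule.inner_starProjection_left_eq_right]

/-- The projection onto a left-invariant subspace acts on the fields `1_s(h) w(h) e_k ⊗ e_i` through
their second factor only. -/
theorem exists_projected_testField (hinv : ∀ x : Heis, ∀ f ∈ H, leftReg x f ∈ H) :
    ∃ (w : ℝ → ℝ) (F : {s : Set ℝ // MeasurableSet s} → basisIndex L2R × basisIndex L2R → L2H)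
      (q : basisIndex L2R → ℝ → L2R), (∀ h, 0 < w h) ∧
      (∀ i, AEStronglyMeasurable (q i) volume) ∧
      (∀ s m, ∀ᵐ h : ℝ, plancherelU (F s m) h = (s.1.indicator (fun _ => (1 : ℂ)) h * w h) •
        HS.rankOne (basis L2R m.1) (basis L2R m.2)) ∧
      (∀ s m, ∀ᵐ h : ℝ, plancherelU (H.starProjection (F s m)) h
        = (s.1.indicator (fun _ => (1 : ℂ)) h * w h) • HS.rankOne (basis L2R m.1) (q m.2 h)) := by
  obtain ⟨w, hwm, hw0, hw1, hwL⟩ := exists_weight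
  obtain ⟨k₀⟩ := nonempty_basisIndex
  set e := basis L2R with he
  have hon : ∀ k, inner ℂ (e k) (e k) = (1 : ℂ) := fun k => by
    rw [inner_self_eq_norm_sq_to_K, e.orthonormal.1]; simp
  choose F hF using fun (s : {s : Set ℝ // MeasurableSet s}) =>
    exists_testField hwm hwL s.1 s.2
  set U : {s : Set ℝ // MeasurableSet s} := ⟨Set.univ, MeasurableSet.univ⟩
  -- the transform of the projections of the test fields
  set M : {s : Set ℝ // MeasurableSet s} → basisIndex L2R × basisIndex L2R → DirectIntegral :=
    fun s m => plancherelU (H.starProjection (F s m)) with hM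
  -- The projection is self-adjoint and commutes with translations, so `rankOne_ae_of_inner_leftReg`
  -- applies to two test fields with the projection on either one. Evaluated at `e k₀`, the result
  -- says that the projected field still has its range in the line of `e m.1`, with a coefficient
  -- independent of `m.1`.
  have hstar : ∀ s m, ∀ i' : basisIndex L2R, ∀ᵐ h : ℝ,
      (M s m h).toCLM (e i') = (s.1.indicator (fun _ => (1 : ℂ)) h *
        inner ℂ ((M U (k₀, i') h).toCLM (e m.2)) (e k₀)) • e m.1 := by
    intro s m i'
    have hmeas : ∀ (s : {s : Set ℝ // MeasurableSet s}) (i : basisIndex L2R),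
        AEStronglyMeasurable (fun h => ((s.1.indicator w h : ℝ) : ℂ) • e i) volume := fun s i =>
      ((Complex.measurable_ofReal.comp (hwm.indicator s.2)).aestronglyMeasurable).smul_const _
    have hbd : ∀ (s : {s : Set ℝ // MeasurableSet s}) (i : basisIndex L2R) (h : ℝ),
        ‖((s.1.indicator w h : ℝ) : ℂ) • e i‖ ≤ 1 := by
      intro s i h
      rw [norm_smul, e.orthonormal.1, mul_one, Complex.norm_real]
      refine (norm_indicator_le_norm_self _ _).trans ?_
      rw [Real.norm_of_nonneg (hw0 h).le]
      exact hw1 h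
    have := rankOne_ae_of_inner_leftReg (F := F s m) (G := H.starProjection (F U (k₀, i')))
      (F' := H.starProjection (F s m)) (G' := F U (k₀, i')) (hmeas s m.2) (hmeas U i') (hbd s m.2)
      (hbd U i') (hF s m) (hF U (k₀, i')) (inner_starProjection_leftReg hinv _ _)
    filter_upwards [this] with h hh
    have h1 := congrArg (fun T => HS.toCLM T (e k₀)) hh
    simp only [HS.rankOne_apply, map_smul, inner_smul_left, Complex.conj_ofReal] at h1
    rw [show inner ℂ (basis L2R k₀) (e k₀) = (1 : ℂ) from hon k₀, one_smul] at h1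
    have hU : U.1.indicator w h = w h := Set.indicator_of_mem (Set.mem_univ _) _
    rw [hU] at h1
    have hw0' : (w h : ℂ) ≠ 0 := Complex.ofReal_ne_zero.2 (hw0 h).ne'
    have h2 : (M s m h).toCLM (e i') = (w h : ℂ)⁻¹ • ((w h : ℂ) • (M s m h).toCLM (e i')) := by
      rw [smul_smul, inv_mul_cancel₀ hw0', one_smul]
    rw [h2]
    refine (congrArg _ h1.symm).trans ?_
    rw [smul_smul]
    congr 1
    by_cases hs : h ∈ s.1
    · simp only [hs, Set.indicator_of_mem, one_mul]
      rw [inv_mul_cancel_left₀ hw0']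
    · simp [hs]
  -- The candidate for `P_h eᵢ`: if the projected field is `w · (e_{k₀} ⊗ P_h eᵢ)`, its adjoint
  -- sends `e_{k₀}` to `w · P_h eᵢ`.
  set q : basisIndex L2R → ℝ → L2R := fun i h =>
    (w h : ℂ)⁻¹ • (ContinuousLinearMap.adjoint (M U (k₀, i) h).toCLM) (e k₀) with hq
  have hqm : ∀ i, AEStronglyMeasurable (q i) volume := by
    intro i
    refine AEStronglyMeasurable.smul
      (Complex.measurable_ofReal.comp hwm).inv.aestronglyMeasurable ?_
    have h1 : AEStronglyMeasurable (fun h => (M U (k₀, i) h).toCLM) volume :=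
      HS.continuous_toCLM.comp_aestronglyMeasurable
        (aesm_plancherel_iff.1 (Lp.aestronglyMeasurable _))
    have h2 := (ContinuousLinearMap.adjoint (𝕜 := ℂ) (E := L2R) (F := L2R)).continuous
      |>.comp_aestronglyMeasurable h1
    exact (ContinuousLinearMap.apply ℂ L2R (e k₀)).continuous.comp_aestronglyMeasurable h2
  have hcont : ∀ i i' h, inner ℂ (q i h) (e i')
      = (w h : ℂ)⁻¹ * inner ℂ (e k₀) ((M U (k₀, i) h).toCLM (e i')) := by
    intro i i' h
    rw [hq, inner_smul_left, ContinuousLinearMap.adjoint_inner_left, map_inv₀, Complex.conj_ofReal]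
  have hMs : ∀ s m, ∀ᵐ h : ℝ, M s m h
      = (s.1.indicator (fun _ => (1 : ℂ)) h * w h) • HS.rankOne (e m.1) (q m.2 h) := by
    intro s m
    filter_upwards [ae_all_iff.2 (hstar s m), ae_all_iff.2 (hstar U (k₀, m.2))] with h h1 h2
    have hw0' : (w h : ℂ) ≠ 0 := Complex.ofReal_ne_zero.2 (hw0 h).ne'
    refine HS.ext_basis fun k j => ?_
    rw [h1 j, map_smul, smul_apply, HS.rankOne_apply, hcont, h2 j, smul_smul]
    have h3 : ∀ c : ℂ, inner ℂ (e k₀) (c • e k₀) = c := fun c => by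
      rw [inner_smul_right, hon, mul_one]
    rw [h3, show U.1 = Set.univ from rfl]
    simp only [Set.indicator_univ, one_mul]
    rw [mul_assoc, mul_inv_cancel_left₀ hw0']
  have hFU : ∀ s m, ∀ᵐ h : ℝ, plancherelU (F s m) h
      = (s.1.indicator (fun _ => (1 : ℂ)) h * w h) • HS.rankOne (e m.1) (e m.2) := by
    intro s m
    filter_upwards [hF s m] with h hh
    rw [hh]
    apply HS.toCLM_injective
    ext1 u
    rw [map_smul, smul_apply, HS.rankOne_apply, HS.rankOne_apply, smul_smul,
      inner_smul_left, Complex.conj_ofReal]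
    by_cases hs : h ∈ s.1 <;> simp [hs, he]
  exact ⟨w, F, q, hw0, hqm, hFU, hMs⟩

theorem inner_ae_eq_zero (A B : DirectIntegral)
    (h0 : ∀ s : Set ℝ, MeasurableSet s →
      ∫ h, s.indicator (fun _ => (1 : ℂ)) h * inner ℂ (A h) (B h) ∂plancherelMeasure = 0) :
    ∀ᵐ h : ℝ, inner ℂ (A h) (B h) = 0 := by
  rw [← ae_plancherel_iff]
  refine (L2.integrable_inner A B).ae_eq_zero_of_forall_setIntegral_eq_zero fun s hs _ => ?_
  rw [← integral_indicator hs, ← h0 s hs]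
  congr 1 with h
  by_cases hh : h ∈ s <;> simp [hh]

theorem HS.inner_rankOne_rankOne {E : Type*} [NormedAddCommGroup E] [InnerProductSpace ℂ E]
    [CompleteSpace E] (φ ψ u v : E) :
    inner ℂ (HS.rankOne φ u) (HS.rankOne ψ v) = inner ℂ v u * inner ℂ φ ψ := by
  rw [HS.inner_rankOne, HS.rankOne_apply, inner_smul_right]

theorem HS.rankOne_comp {E : Type*} [NormedAddCommGroup E] [InnerProductSpace ℂ E]
    [CompleteSpace E] (φ u : E) {P : E →L[ℂ] E} (hP : IsSelfAdjoint P) :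
    (HS.rankOne φ u).toCLM ∘L P = (HS.rankOne φ (P u)).toCLM := by
  ext1 v
  rw [ContinuousLinearMap.comp_apply, HS.rankOne_apply, HS.rankOne_apply]
  congr 1
  rw [← ContinuousLinearMap.adjoint_inner_left, hP.adjoint_eq]

/-- The functions on which the projection onto `H` acts through the field `P`. -/
def decomposedSubmodule (H : Submodule ℂ L2H) [CompleteSpace H] (P : ℝ → L2R →L[ℂ] L2R) :
    Submodule ℂ L2H where
  carrier := {f | ∀ᵐ h : ℝ, (plancherelU (H.starProjection f) h).toCLM
    = (plancherelU f h).toCLM ∘L P h}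
  zero_mem' := by
    filter_upwards [ae_plancherel_iff.1 (Lp.coeFn_zero (HS L2R) 2 plancherelMeasure)] with h hh
    simp only [map_zero]
    rw [hh]
    simp
  add_mem' := by
    intro a b ha hb
    filter_upwards [ha, hb, ae_plancherel_iff.1 (Lp.coeFn_add (plancherelU a) (plancherelU b)),
      ae_plancherel_iff.1 (Lp.coeFn_add (plancherelU (H.starProjection a))
        (plancherelU (H.starProjection b)))] with h h1 h2 h3 h4
    rw [map_add, map_add, map_add, h3, h4, Pi.add_apply, Pi.add_apply, map_add, map_add, h1, h2,
      ContinuousLinearMap.add_comp]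
  smul_mem' := by
    intro c a ha
    filter_upwards [ha, ae_plancherel_iff.1 (Lp.coeFn_smul c (plancherelU a)),
      ae_plancherel_iff.1 (Lp.coeFn_smul c (plancherelU (H.starProjection a)))] with h h1 h3 h4
    rw [map_smul, map_smul, map_smul, h3, h4, Pi.smul_apply, Pi.smul_apply, map_smul, map_smul,
      h1, ContinuousLinearMap.smul_comp]

theorem isClosed_decomposedSubmodule (P : ℝ → L2R →L[ℂ] L2R) :
    IsClosed (decomposedSubmodule H P : Set L2H) := by
  refine IsSeqClosed.isClosed fun u f hu hlim => ?_
  show ∀ᵐ h : ℝ, _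
  rw [← ae_plancherel_iff]
  refine ae_rel_of_tendsto (R := fun h (S T : HS L2R) => T.toCLM = S.toCLM ∘L P h) (fun h => ?_)
    ((plancherelU.continuous.tendsto f).comp hlim)
    (((plancherelU.continuous.comp H.starProjection.continuous).tendsto f).comp hlim) fun n =>
      ae_plancherel_iff.2 (hu n)
  exact isClosed_eq (HS.continuous_toCLM.comp continuous_snd)
    ((HS.continuous_toCLM.comp continuous_fst).clm_comp_const _)

/-- The vectors `qⱼ(h)` behave like `P_h eⱼ`: the residue `eⱼ - qⱼ(h)` is orthogonal to every
`qᵢ(h)`. So `P_h` has to be the projection onto the closed span of the `qᵢ(h)`. It decomposes the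
projection onto `H` on test fields, hence everywhere by density. -/
theorem exists_isProjectionField (hinv : ∀ x : Heis, ∀ f ∈ H, leftReg x f ∈ H) :
    ∃ P, IsProjectionField H P := by
  obtain ⟨w, F, q, hw0, hqm, hF, hPF⟩ := exists_projected_testField hinv
  obtain ⟨k₀⟩ := nonempty_basisIndex
  set e := basis L2R with he
  have hon : ∀ k, inner ℂ (e k) (e k) = (1 : ℂ) := fun k => by
    rw [inner_self_eq_norm_sq_to_K, e.orthonormal.1]; simp
  have hw0' : ∀ h, (w h : ℂ) ≠ 0 := fun h => Complex.ofReal_ne_zero.2 (hw0 h).ne'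
  set U : {s : Set ℝ // MeasurableSet s} := ⟨Set.univ, MeasurableSet.univ⟩ with hU
  have hind : ∀ (s : Set ℝ) (h : ℝ), conj (s.indicator (fun _ => (1 : ℂ)) h)
      = s.indicator (fun _ => (1 : ℂ)) h := fun s h => by
    by_cases hh : h ∈ s <;> simp [hh]
  -- Projected fields are orthogonal to the residues `F - P F`; cutting off by an arbitrary set `s`
  -- localises this orthogonality to almost every `h`.
  have hqq : ∀ i j, ∀ᵐ h : ℝ, inner ℂ (q i h) (e j - q j h) = 0 := by
    intro i j
    have h1 : ∀ᵐ h : ℝ, inner ℂ (plancherelU (H.starProjection (F U (k₀, i))) h)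
        (plancherelU (F U (k₀, j) - H.starProjection (F U (k₀, j))) h) = 0 := by
      refine inner_ae_eq_zero _ _ fun s hs => ?_
      have h2 : inner ℂ (H.starProjection (F ⟨s, hs⟩ (k₀, i)))
          (F U (k₀, j) - H.starProjection (F U (k₀, j))) = 0 := by
        rw [← inner_conj_symm, Submodule.starProjection_inner_eq_zero _ _
          (Submodule.starProjection_apply_mem H _), map_zero]
      rw [inner_eq_integral] at h2
      rw [← h2]
      apply integral_congr_ae
      rw [EventuallyEq, ae_plancherel_iff]
      filter_upwards [hPF U (k₀, i), hPF ⟨s, hs⟩ (k₀, i)] with h h3 h4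
      rw [h3, h4, inner_smul_left, inner_smul_left, map_mul, map_mul, hind, hind]
      simp only [hU, Set.indicator_univ, one_mul, mul_assoc]
    filter_upwards [h1, hPF U (k₀, i), hF U (k₀, j), hPF U (k₀, j),
      ae_plancherel_iff.1 (Lp.coeFn_sub (plancherelU (F U (k₀, j)))
        (plancherelU (H.starProjection (F U (k₀, j)))))] with h h1 h2 h3 h4 h5
    rw [map_sub, h5, Pi.sub_apply, h2, h3, h4, ← smul_sub, ← HS.rankOne_sub_right, inner_smul_left,
      inner_smul_right, HS.inner_rankOne_rankOne, hon, mul_one] at h1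
    simp only [hU, Set.indicator_univ, one_mul, Complex.conj_ofReal, mul_eq_zero, hw0',
      false_or] at h1
    rw [← inner_conj_symm, h1, map_zero]
  -- Defined through a span, `P h` is an orthogonal projection for every `h`, although its relation
  -- to the `q i h` holds only almost everywhere.
  set P : ℝ → L2R →L[ℂ] L2R := fun h =>
    (Submodule.span ℂ (Set.range fun i => q i h)).topologicalClosure.starProjection with hP
  have hPe : ∀ᵐ h : ℝ, ∀ j, P h (e j) = q j h := by
    filter_upwards [ae_all_iff.2 fun i => ae_all_iff.2 (hqq i)] with h hh j
    refine Submodule.eq_starProjection_of_mem_of_inner_eq_zero ?_ fun v hv => ?_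
    · exact Submodule.le_topologicalClosure _ (Submodule.subset_span ⟨j, rfl⟩)
    · have hle : (Submodule.span ℂ (Set.range fun i => q i h)).topologicalClosure
          ≤ (Submodule.span ℂ {e j - q j h})ᗮ := by
        refine Submodule.topologicalClosure_minimal _ ?_ (Submodule.isClosed_orthogonal _)
        rw [Submodule.span_le]
        rintro _ ⟨i, rfl⟩
        rw [SetLike.mem_coe, Submodule.mem_orthogonal_singleton_iff_inner_left]
        exact hh i j
      rw [← inner_conj_symm, Submodule.mem_orthogonal_singleton_iff_inner_left.1 (hle hv),
        map_zero]
  have hPproj : ∀ h, IsStarProjection (P h) := fun h => isStarProjection_starProjection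
  have hPm : ∀ v : L2R, AEStronglyMeasurable (fun h => P h v) volume := by
    intro v
    refine aestronglyMeasurable_of_basis e fun j => ?_
    refine ((hqm j).inner (𝕜 := ℂ) (g := fun _ => v) aestronglyMeasurable_const).congr ?_
    filter_upwards [hPe] with h hh
    rw [← hh, ← ContinuousLinearMap.adjoint_inner_right,
      (hPproj h).isSelfAdjoint.adjoint_eq]
  refine ⟨P, hPproj, hPm, fun f g hg hfg => ?_⟩
  rw [plancherel_eq_plancherelU, plancherel_eq_plancherelU,
    ← Submodule.eq_starProjection_of_mem_orthogonal hg hfg]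
  -- `V` is a closed subspace containing the test fields. Something orthogonal to all of them has,
  -- after varying `s`, vanishing matrix coefficients in almost every fibre, so `V` is everything.
  set V := decomposedSubmodule H P with hVdef
  have hVc : IsClosed (V : Set L2H) := isClosed_decomposedSubmodule P
  have hFV : ∀ s m, F s m ∈ V := by
    intro s m
    filter_upwards [hF s m, hPF s m, hPe] with h h1 h2 h3
    rw [h1, h2, map_smul, map_smul, ContinuousLinearMap.smul_comp,
      HS.rankOne_comp _ _ (hPproj h).isSelfAdjoint, h3]
  have hV : Vᗮ = ⊥ := by
    rw [eq_bot_iff]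
    intro g hg
    have h1 : ∀ m, ∀ᵐ h : ℝ, inner ℂ (plancherelU (F U m) h) (plancherelU g h) = 0 := by
      intro m
      refine inner_ae_eq_zero _ _ fun s hs => ?_
      have h2 := (Submodule.mem_orthogonal _ _).1 hg _ (hFV ⟨s, hs⟩ m)
      rw [inner_eq_integral] at h2
      rw [← h2]
      apply integral_congr_ae
      rw [EventuallyEq, ae_plancherel_iff]
      filter_upwards [hF U m, hF ⟨s, hs⟩ m] with h h3 h4
      rw [h3, h4, inner_smul_left, inner_smul_left, map_mul, map_mul, hind, hind]
      simp only [hU, Set.indicator_univ, one_mul, mul_assoc]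
    have h2 : plancherelU g = 0 := by
      refine Lp.ext (ae_plancherel_iff.2 ?_)
      filter_upwards [ae_all_iff.2 h1, ae_all_iff.2 (hF U), ae_plancherel_iff.1
        (Lp.coeFn_zero (HS L2R) 2 plancherelMeasure)] with h h3 h4 h5
      rw [h5]
      refine eq_zero_of_basis_inner rankOneBasis fun m => ?_
      have h6 := h3 m
      rw [h4, inner_smul_left] at h6
      simp only [hU, Set.indicator_univ, one_mul, Complex.conj_ofReal, mul_eq_zero, hw0',
        false_or] at h6
      rwa [rankOneBasis_apply]
    rw [Submodule.mem_bot]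
    exact plancherelU.map_eq_zero_iff.1 h2
  have hVtop : V = ⊤ := by
    rw [← hVc.submodule_topologicalClosure_eq]
    exact Submodule.topologicalClosure_eq_top_iff.2 hV
  exact (hVtop ▸ Submodule.mem_top : f ∈ V)

theorem isProjectionField_projectionField (hinv : ∀ x : Heis, ∀ f ∈ H, leftReg x f ∈ H) :
    IsProjectionField H (projectionField H) := by
  have ex := exists_isProjectionField hinv
  rw [projectionField, dif_pos ex]
  exact ex.choose_spec

end ProjectionField

/-! ### Parseval's identity for functions with disjoint integer translates -/

section Parseval

theorem enorm_sq_eq_ofReal {K : Type*} [NormedAddCommGroup K] (v : K) :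
    ‖v‖ₑ ^ 2 = ENNReal.ofReal (‖v‖ ^ 2) := by
  rw [← ofReal_norm, ENNReal.ofReal_pow (norm_nonneg _)]

theorem tsum_enorm_sq_of_hasSum {ι K : Type*} [NormedAddCommGroup K] {c : ι → K} {r : ℝ}
    (h : HasSum (fun i => ‖c i‖ ^ 2) r) : ∑' i, ‖c i‖ₑ ^ 2 = ENNReal.ofReal r := by
  simp_rw [enorm_sq_eq_ofReal]
  rw [← ENNReal.ofReal_tsum_of_nonneg (fun _ => by positivity) h.summable, h.tsum_eq]

theorem hasSum_of_tsum_enorm_sq {ι K : Type*} [NormedAddCommGroup K] {c : ι → K} {r : ℝ}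
    (hr : 0 ≤ r) (h : ∑' i, ‖c i‖ₑ ^ 2 = ENNReal.ofReal r) : HasSum (fun i => ‖c i‖ ^ 2) r := by
  have h1 := ENNReal.hasSum_toReal (f := fun i => ‖c i‖ₑ ^ 2) (by rw [h]; exact ENNReal.ofReal_ne_top)
  rw [← ENNReal.tsum_toReal_eq (fun i => by simp), h, ENNReal.toReal_ofReal hr] at h1
  simpa using h1

/-- The integer translations of the line. -/
abbrev intTranslations : AddSubgroup ℝ := AddSubgroup.zmultiples (1 : ℝ)

/-- Almost every orbit of the integers meets the support of `a` at most once. Periodisation is then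
a sum with at most one nonzero term: it converges trivially and its square has no cross terms. -/
theorem ae_translates_subsingleton {a : ℝ → ℂ}
    (hdis : ∀ m : ℤ, m ≠ 0 → ∀ᵐ x : ℝ, a x = 0 ∨ a (m + x) = 0) :
    ∀ᵐ x : ℝ, ∃ g₀ : intTranslations, ∀ g, g ≠ g₀ → a (g +ᵥ x) = 0 := by
  have h1 : ∀ᵐ x : ℝ, ∀ g g' : intTranslations, g' ≠ g → a (g +ᵥ x) = 0 ∨ a (g' +ᵥ x) = 0 := by
    rw [ae_all_iff]
    intro g
    rw [ae_all_iff]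
    intro g'
    by_cases hg : g' = g
    · exact ae_of_all _ fun x h => absurd hg h
    obtain ⟨m, hm⟩ := AddSubgroup.mem_zmultiples_iff.1 (g' - g).2
    have hm' : (m : ℝ) = g' - g := by simpa using hm
    have hm0 : m ≠ 0 := by
      rintro rfl
      exact hg (Subtype.ext (sub_eq_zero.1 (by simpa using hm'.symm)))
    filter_upwards [(measurePreserving_add_left volume (g : ℝ)).quasiMeasurePreserving.ae
      (hdis m hm0)] with x hx _
    have h2 : (m : ℝ) + (g + x) = g' +ᵥ x := by
      rw [hm', AddSubgroup.vadd_def, vadd_eq_add]; ring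
    rwa [h2] at hx
  filter_upwards [h1] with x hx
  by_cases h : ∃ g₀ : intTranslations, a (g₀ +ᵥ x) ≠ 0
  · obtain ⟨g₀, h0⟩ := h
    exact ⟨g₀, fun g hg => (hx g₀ g hg).resolve_left h0⟩
  · push Not at h
    exact ⟨0, fun g _ => h g⟩

/-- The integrals are the Fourier coefficients of the 1-periodisation `b` of `a`. Parseval on `(0,
1]` gives `∫ |b|²` over one period, which equals `∫ |a|²` over the line because translates do not
overlap. -/
theorem tsum_sq_fourierIntegral {a : ℝ → ℂ} (hi : Integrable a) (h2 : MemLp a 2 volume)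
    (hdis : ∀ m : ℤ, m ≠ 0 → ∀ᵐ x : ℝ, a x = 0 ∨ a (m + x) = 0) :
    ∑' l : ℤ, ‖∫ x : ℝ, Complex.exp (-(2 * Real.pi * Complex.I * x * l)) * a x‖ₑ ^ 2
      = ∫⁻ x : ℝ, ‖a x‖ₑ ^ 2 := by
  set I : Set ℝ := Set.Ioc 0 1 with hI
  have hfd : IsAddFundamentalDomain intTranslations I := by
    simpa using isAddFundamentalDomain_Ioc zero_lt_one (0 : ℝ)
  have hone := ae_translates_subsingleton hdis
  set b : ℝ → ℂ := fun x => ∑' g : intTranslations, a (g +ᵥ x) with hb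
  have hqmp : ∀ g : intTranslations, Measure.QuasiMeasurePreserving (fun x : ℝ => g +ᵥ x)
      volume volume := fun g =>
    (measurePreserving_add_left volume (g : ℝ)).quasiMeasurePreserving
  have ham : ∀ g : intTranslations, AEStronglyMeasurable (fun x : ℝ => a (g +ᵥ x)) volume :=
    fun g => hi.1.comp_quasiMeasurePreserving (hqmp g)
  have hbm : AEStronglyMeasurable b volume := by
    refine aestronglyMeasurable_of_tendsto_ae (u := (atTop : Filter (Finset intTranslations)))
      (f := fun s x => ∑ g ∈ s, a (g +ᵥ x)) (fun s => ?_) ?_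
    · exact Finset.aestronglyMeasurable_fun_sum s fun g _ => ham g
    · filter_upwards [hone] with x ⟨g₀, hx⟩
      show Tendsto _ _ (𝓝 (∑' g : intTranslations, a (g +ᵥ x)))
      rw [tsum_eq_single g₀ hx]
      exact hasSum_single g₀ hx
  have hbn : ∀ᵐ x : ℝ, ‖b x‖ₑ ^ 2 = ∑' g : intTranslations, ‖a (g +ᵥ x)‖ₑ ^ 2 := by
    filter_upwards [hone] with x ⟨g₀, hx⟩
    show ‖∑' g : intTranslations, a (g +ᵥ x)‖ₑ ^ 2 = _
    rw [tsum_eq_single g₀ hx, tsum_eq_single g₀ fun g hg => by simp [hx g hg]]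
  have hbint : ∫⁻ x in I, ‖b x‖ₑ ^ 2 = ∫⁻ x : ℝ, ‖a x‖ₑ ^ 2 := by
    rw [hfd.lintegral_eq_tsum'', lintegral_congr_ae (ae_restrict_of_ae hbn)]
    exact lintegral_tsum fun g => ((ham g).enorm.pow_const 2).restrict
  have hbL : MemLp b 2 (volume.restrict I) := by
    rw [memLp_two_iff hbm.restrict, hbint]
    exact (memLp_two_iff hi.1).1 h2
  -- Unfold the integral over the line into integrals over the fundamental domain; the characters
  -- `e^{-2πixl}` are 1-periodic. Integrability of `a` justifies exchanging sum and integral.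
  have hcoef : ∀ l : ℤ, fourierCoeffOn zero_lt_one b l
      = ∫ x : ℝ, Complex.exp (-(2 * Real.pi * Complex.I * x * l)) * a x := by
    intro l
    have hEi : Integrable fun x : ℝ => Complex.exp (-(2 * Real.pi * Complex.I * x * l)) * a x := by
      refine hi.norm.mono' (AEStronglyMeasurable.mul (by fun_prop) hi.1) (ae_of_all _ fun x => ?_)
      simp [Complex.norm_exp]
    have hper : ∀ (g : intTranslations) (x : ℝ),
        Complex.exp (-(2 * Real.pi * Complex.I * (g +ᵥ x : ℝ) * l))
          = Complex.exp (-(2 * Real.pi * Complex.I * x * l)) := by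
      intro g x
      obtain ⟨m, hm⟩ := AddSubgroup.mem_zmultiples_iff.1 g.2
      have hm' : (g : ℝ) = m := by simpa using hm.symm
      rw [AddSubgroup.vadd_def, vadd_eq_add, hm', Complex.exp_eq_exp_iff_exists_int]
      refine ⟨-(m * l), ?_⟩
      push_cast
      ring
    rw [fourierCoeffOn_eq_integral, intervalIntegral.integral_of_le zero_le_one,
      hfd.integral_eq_tsum'' _ hEi, ← integral_tsum]
    · rw [sub_zero, div_one, one_smul]
      refine setIntegral_congr_fun measurableSet_Ioc fun x _ => ?_
      simp only [hper, fourier_coe_apply, tsum_mul_left, smul_eq_mul, hb]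
      congr 2
      push_cast
      ring
    · exact fun g => (hEi.1.comp_quasiMeasurePreserving (hqmp g)).restrict
    · rw [← hfd.lintegral_eq_tsum'' (fun x : ℝ =>
        ‖Complex.exp (-(2 * Real.pi * Complex.I * x * l)) * a x‖ₑ)]
      exact hEi.2.ne
  have hs := tsum_enorm_sq_of_hasSum (hasSum_sq_fourierCoeffOn zero_lt_one hbL)
  simp_rw [hcoef] at hs
  rw [hs, ← hbint, intervalIntegral.integral_of_le zero_le_one, sub_zero, inv_one, one_smul]
  rw [ofReal_integral_eq_lintegral_ofReal ((memLp_two_iff_integrable_sq_norm hbm.restrict).1 hbL)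
    (ae_of_all _ fun x => by positivity)]
  simp_rw [enorm_sq_eq_ofReal]

end Parseval

/-! ### The lattice and the reduced lattice -/

theorem Heis.mk_mul_mk (p q t p' q' t' : ℝ) : Heis.mk p q t * Heis.mk p' q' t'
    = Heis.mk (p + p') (q + q') (t + t' + (p * q' - q * p') / 2) := rfl

theorem Heis.mk_inv (p q t : ℝ) : (Heis.mk p q t)⁻¹ = Heis.mk (-p) (-q) (-t) := rfl

theorem Heis.mk_zpow (p q t : ℝ) (n : ℤ) :
    Heis.mk p q t ^ n = Heis.mk (n * p) (n * q) (n * t) := by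
  induction n using Int.induction_on with
  | zero => simp only [zpow_zero, Int.cast_zero, zero_mul]; rfl
  | succ n ih =>
    rw [zpow_add_one, ih, Heis.mk_mul_mk]
    congr 1 <;> push_cast <;> ring
  | pred n ih =>
    rw [zpow_sub_one, ih, Heis.mk_inv, Heis.mk_mul_mk]
    congr 1 <;> push_cast <;> ring

/-- The element `(m, dk, dmk/2 + l)`. -/
def latticePt (d : ℕ) (n : ℤ × ℤ) (l : ℤ) : Heis :=
  Heis.mk n.1 (d * n.2) (d * n.1 * n.2 / 2 + l)

theorem latticePt_injective {d : ℕ} (hd : 0 < d) :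
    Function.Injective fun z : (ℤ × ℤ) × ℤ => latticePt d z.1 z.2 := by
  rintro ⟨⟨m, k⟩, l⟩ ⟨⟨m', k'⟩, l'⟩ h
  have h1 : (m : ℝ) = m' := congrArg Heis.p h
  have h2 : (d * k : ℝ) = d * k' := congrArg Heis.q h
  have h3 : (d * m * k / 2 + l : ℝ) = d * m' * k' / 2 + l' := congrArg Heis.t h
  have hd' : (d : ℝ) ≠ 0 := by exact_mod_cast hd.ne'
  have h2' : (k : ℝ) = k' := mul_left_cancel₀ hd' h2
  rw [h1, h2', add_right_inj] at h3
  norm_cast at h1 h2' h3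
  subst h1 h2' h3
  rfl

/-- Each such point is the product of the `m`-th, `k`-th and `l`-th powers of the three generators.
Conversely the points form a group, because the commutator of the first two generators is the
central element with the integer coordinate `d`. -/
theorem mem_lattice_iff (d : ℕ) (x : Heis) :
    x ∈ lattice d ↔ ∃ z : (ℤ × ℤ) × ℤ, latticePt d z.1 z.2 = x := by
  constructor
  · intro hx
    induction hx using Subgroup.closure_induction with
    | mem x hx =>
      rcases hx with rfl | rfl | rfl
      · exact ⟨((1, 0), 0), by simp [latticePt]⟩
      · exact ⟨((0, 1), 0), by simp [latticePt]⟩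
      · exact ⟨((0, 0), 1), by simp [latticePt]⟩
    | one => exact ⟨((0, 0), 0), by simp [latticePt]; rfl⟩
    | mul x y _ _ hx hy =>
      obtain ⟨⟨⟨m, k⟩, l⟩, rfl⟩ := hx
      obtain ⟨⟨⟨m', k'⟩, l'⟩, rfl⟩ := hy
      -- The correction `-dkm'` is the difference between the term `(dmk' - dkm')/2` from the group
      -- law and the mixed part `d(mk' + m'k)/2` of the new half product.
      refine ⟨((m + m', k + k'), l + l' - d * k * m'), ?_⟩
      simp only [latticePt, Heis.mk_mul_mk]
      congr 1 <;> push_cast <;> ring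
    | inv x _ hx =>
      obtain ⟨⟨⟨m, k⟩, l⟩, rfl⟩ := hx
      refine ⟨((-m, -k), -l - d * m * k), ?_⟩
      simp only [latticePt, Heis.mk_inv]
      congr 1 <;> push_cast <;> ring
  · rintro ⟨⟨⟨m, k⟩, l⟩, rfl⟩
    have h1 : Heis.mk 1 0 0 ∈ lattice d := Subgroup.subset_closure (by simp)
    have h2 : Heis.mk 0 d 0 ∈ lattice d := Subgroup.subset_closure (by simp)
    have h3 : Heis.mk 0 0 1 ∈ lattice d := Subgroup.subset_closure (by simp)
    have h4 : latticePt d (m, k) l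
        = Heis.mk 1 0 0 ^ m * Heis.mk 0 d 0 ^ k * Heis.mk 0 0 1 ^ l := by
      simp only [latticePt, Heis.mk_zpow, Heis.mk_mul_mk]
      congr 1 <;> ring
    rw [h4]
    exact mul_mem (mul_mem (zpow_mem h1 m) (zpow_mem h2 k)) (zpow_mem h3 l)

/-- The lattice is parametrised by triples of integers. -/
def latticeEquiv {d : ℕ} (hd : 0 < d) : (ℤ × ℤ) × ℤ ≃ lattice d :=
  Equiv.ofBijective (fun z => ⟨latticePt d z.1 z.2, (mem_lattice_iff d _).2 ⟨z, rfl⟩⟩)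
    ⟨fun _ _ h => latticePt_injective hd (congrArg Subtype.val h),
      fun x => let ⟨z, hz⟩ := (mem_lattice_iff d _).1 x.2; ⟨z, Subtype.ext hz⟩⟩

theorem coe_latticeEquiv {d : ℕ} (hd : 0 < d) (z : (ℤ × ℤ) × ℤ) :
    (latticeEquiv hd z : Heis) = latticePt d z.1 z.2 := rfl

theorem reducedLattice_eq (d : ℕ) : reducedLattice d = Set.range fun n => latticePt d n 0 := by
  simp [reducedLattice, latticePt]

/-- The reduced lattice is parametrised by pairs of integers. -/
def reducedLatticeEquiv {d : ℕ} (hd : 0 < d) : ℤ × ℤ ≃ reducedLattice d :=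
  (Equiv.ofInjective (fun n : ℤ × ℤ => latticePt d n 0) fun _ _ h =>
    congrArg Prod.fst (latticePt_injective hd (a₁ := (_, 0)) (a₂ := (_, 0)) h)).trans
      (Equiv.setCongr (reducedLattice_eq d).symm)

/-- The centre acts by scalars, so all dependence on `l` sits in a character of `h`. This is the
source of the Fourier series. -/
theorem schrodinger_latticePt (d : ℕ) (n : ℤ × ℤ) (l : ℤ) (h : ℝ) :
    schrodinger h (latticePt d n l)
      = Complex.exp (2 * Real.pi * Complex.I * h * l) • schrodinger h (latticePt d n 0) := by
  ext1 f
  rw [smul_apply, latticePt, latticePt, schrodinger_eq_smul h _ _ (_ + (l : ℝ)),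
    schrodinger_eq_smul h _ _ (_ + ((0 : ℤ) : ℝ)), smul_smul,
    ← Complex.exp_add]
  congr 2
  push_cast
  ring

/-! ### Frame coefficients -/

/-- The fibrewise frame coefficient of `f` at `h`. -/
def fibreCoeff (d : ℕ) (Φ f : L2H) (n : ℤ × ℤ) (h : ℝ) : ℂ :=
  (|h| : ℝ) * inner ℂ (HS.lcomp (schrodinger h (latticePt d n 0)) (plancherelU Φ h))
    (plancherelU f h)

theorem HS.smul_lcomp {E : Type*} [NormedAddCommGroup E] [InnerProductSpace ℂ E]
    [CompleteSpace E] (c : ℂ) (A : E →L[ℂ] E) (T : HS E) :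
    HS.lcomp (c • A) T = c • HS.lcomp A T := by
  apply HS.toCLM_injective
  rw [map_smul, HS.toCLM_lcomp, HS.toCLM_lcomp, ContinuousLinearMap.smul_comp]

theorem inner_leftReg_latticePt (d : ℕ) (Φ f : L2H) (n : ℤ × ℤ) (l : ℤ) :
    inner ℂ (leftReg (latticePt d n l) Φ) f
      = ∫ h : ℝ, Complex.exp (-(2 * Real.pi * Complex.I * h * l)) * fibreCoeff d Φ f n h := by
  rw [inner_leftReg_eq_integral, integral_plancherel]
  congr 1 with h
  rw [schrodinger_latticePt, HS.smul_lcomp, inner_smul_left, fibreCoeff, ← Complex.exp_conj]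
  simp only [map_mul, Complex.conj_ofReal, Complex.conj_I, map_ofNat, map_intCast]
  rw [mul_left_comm]
  congr 3
  ring

theorem integrable_fibreCoeff (d : ℕ) (Φ f : L2H) (n : ℤ × ℤ) :
    Integrable (fibreCoeff d Φ f n) := by
  have h1 := L2.integrable_inner (𝕜 := ℂ) (plancherelU (leftReg (latticePt d n 0) Φ))
    (plancherelU f)
  rw [integrable_plancherel_iff] at h1
  refine h1.congr ?_
  filter_upwards [plancherelU_leftReg (latticePt d n 0) Φ] with h hh
  rw [hh, fibreCoeff]

/-- If the fibre coefficients are square integrable with disjoint integer translates, the frame sum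
over the lattice is an integral of frame sums over the reduced lattice. -/
theorem tsum_enorm_inner_leftReg {d : ℕ} (hd : 0 < d) (Φ f : L2H)
    (h2 : ∀ n, MemLp (fibreCoeff d Φ f n) 2 volume)
    (hdis : ∀ n, ∀ m : ℤ, m ≠ 0 → ∀ᵐ x : ℝ, fibreCoeff d Φ f n x = 0 ∨
      fibreCoeff d Φ f n (m + x) = 0) :
    ∑' γ : lattice d, ‖inner ℂ (leftReg γ Φ) f‖ₑ ^ 2
      = ∫⁻ h : ℝ, ∑' n, ‖fibreCoeff d Φ f n h‖ₑ ^ 2 := by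
  rw [← (latticeEquiv hd).tsum_eq, ENNReal.tsum_prod',
    lintegral_tsum fun n => (h2 n).1.enorm.pow_const 2]
  congr 1 with n
  rw [← tsum_sq_fourierIntegral (integrable_fibreCoeff d Φ f n) (h2 n) (hdis n)]
  simp_rw [coe_latticeEquiv, inner_leftReg_latticePt]

/-! ### Composition with a projection on the right -/

namespace HS

variable {E : Type*} [NormedAddCommGroup E] [InnerProductSpace ℂ E] [CompleteSpace E]
  {P : E →L[ℂ] E}

theorem mem_rightMul_iff (hP : IsStarProjection P) {T : HS E} :
    T ∈ rightMul P ↔ toCLM T ∘L P = toCLM T := by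
  constructor
  · rintro ⟨S, hS⟩
    rw [hS, ContinuousLinearMap.comp_assoc]
    exact congrArg _ hP.isIdempotentElem
  · exact fun h => ⟨T, h.symm⟩

theorem isClosed_rightMul (hP : IsStarProjection P) : IsClosed (rightMul P : Set (HS E)) := by
  have h1 : (rightMul P : Set (HS E)) = {T | toCLM T ∘L P = toCLM T} :=
    Set.ext fun T => mem_rightMul_iff hP
  rw [h1]
  exact isClosed_eq (continuous_toCLM.clm_comp_const _) continuous_toCLM

theorem completeSpace_rightMul (hP : IsStarProjection P) : CompleteSpace (rightMul P) :=
  (isClosed_rightMul hP).completeSpace_coe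

/-- Composition with an orthogonal projection `P` on the right, which is the orthogonal projection
onto `B₂(E) ∘ P`. -/
def rcomp (hP : IsStarProjection P) : HS E →L[ℂ] HS E :=
  haveI := completeSpace_rightMul hP
  (rightMul P).starProjection

theorem rcomp_mem (hP : IsStarProjection P) (T : HS E) : rcomp hP T ∈ rightMul P :=
  haveI := completeSpace_rightMul hP
  Submodule.starProjection_apply_mem _ _

theorem rcomp_of_mem (hP : IsStarProjection P) {T : HS E} (hT : T ∈ rightMul P) :
    rcomp hP T = T :=
  haveI := completeSpace_rightMul hP
  Submodule.starProjection_eq_self_iff.2 hT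

theorem norm_rcomp_le (hP : IsStarProjection P) (T : HS E) : ‖rcomp hP T‖ ≤ ‖T‖ :=
  haveI := completeSpace_rightMul hP
  Submodule.norm_starProjection_apply_le _ _

theorem inner_rcomp (hP : IsStarProjection P) {S : HS E} (hS : S ∈ rightMul P) (T : HS E) :
    inner ℂ S (rcomp hP T) = inner ℂ S T := by
  have := completeSpace_rightMul hP
  rw [rcomp, ← Submodule.inner_starProjection_left_eq_right,
    Submodule.starProjection_eq_self_iff.2 hS]

/-- `rcomp` is an orthogonal projection by construction, hence contractive. Testing it against the
rank one operators `φ ⊗ P v`, which lie in `B₂(E) ∘ P`, identifies it with composition. -/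
theorem toCLM_rcomp (hP : IsStarProjection P) (T : HS E) : toCLM (rcomp hP T) = toCLM T ∘L P := by
  rw [← (mem_rightMul_iff hP).1 (rcomp_mem hP T)]
  ext1 v
  refine ext_inner_left ℂ fun φ => ?_
  have h1 : rankOne φ (P v) ∈ rightMul P :=
    ⟨rankOne φ v, (rankOne_comp φ v hP.isSelfAdjoint).symm⟩
  have h2 := inner_rcomp hP h1 T
  rwa [inner_rankOne, inner_rankOne] at h2

theorem lcomp_mem_rightMul (A : E →L[ℂ] E) {T : HS E} (hT : T ∈ rightMul P) :
    lcomp A T ∈ rightMul P := by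
  obtain ⟨S, hS⟩ := hT
  exact ⟨lcomp A S, by rw [toCLM_lcomp, toCLM_lcomp, hS, ContinuousLinearMap.comp_assoc]⟩

end HS

/-- A frame identity extends from a dense set. -/
theorem hasSum_inner_sq_of_dense {E ι : Type*} [NormedAddCommGroup E] [InnerProductSpace ℂ E]
    {η : ι → E} {Q : E →L[ℂ] E} (hQ : ∀ x, ‖Q x‖ ≤ ‖x‖) {S : Set E} (hS : Dense S)
    (h : ∀ x ∈ S, HasSum (fun i => ‖inner ℂ (η i) x‖ ^ 2) (‖Q x‖ ^ 2)) (x : E) :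
    HasSum (fun i => ‖inner ℂ (η i) x‖ ^ 2) (‖Q x‖ ^ 2) := by
  have h2 : (0 : ℝ) < (2 : ℝ≥0∞).toReal := by norm_num
  -- Finite sums are continuous, so the Bessel inequality extends from `S` first. It makes the
  -- coefficient operator `C` into `ℓ²` bounded, after which the equality is a closed condition as
  -- well.
  have hb : ∀ x, ∀ s : Finset ι, ∑ i ∈ s, ‖inner ℂ (η i) x‖ ^ 2 ≤ ‖Q x‖ ^ 2 := by
    intro x s
    have hc : IsClosed {x | ∑ i ∈ s, ‖inner ℂ (η i) x‖ ^ 2 ≤ ‖Q x‖ ^ 2} :=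
      isClosed_le (by fun_prop) (by fun_prop)
    exact closure_minimal (fun y hy => sum_le_hasSum s (fun _ _ => by positivity) (h y hy)) hc
      (hS x)
  have hm : ∀ x, Memℓp (fun i => inner ℂ (η i) x) 2 := by
    intro x
    rw [memℓp_gen_iff h2]
    have := summable_of_sum_le (fun _ => by positivity) (hb x)
    simpa using this
  let C : E →ₗ[ℂ] lp (fun _ : ι => ℂ) 2 :=
    { toFun := fun x => ⟨fun i => inner ℂ (η i) x, hm x⟩
      map_add' := fun x y => by ext i; exact inner_add_right _ _ _
      map_smul' := fun c x => by ext i; exact inner_smul_right _ _ _ }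
  have hC : ∀ x, HasSum (fun i => ‖inner ℂ (η i) x‖ ^ 2) (‖C x‖ ^ 2) := by
    intro x
    have h3 := lp.hasSum_norm h2 (C x)
    simp only [ENNReal.toReal_ofNat, Real.rpow_ofNat] at h3
    exact h3
  have hle : ∀ x, ‖C x‖ ≤ 1 * ‖x‖ := by
    intro x
    rw [one_mul]
    refine le_trans ?_ (hQ x)
    exact (sq_le_sq₀ (norm_nonneg _) (norm_nonneg _)).1 (hasSum_le_of_sum_le (hC x) (hb x))
  have hcont : Continuous C := (C.mkContinuous 1 hle).continuous
  have hc : IsClosed {x | ‖C x‖ ^ 2 = ‖Q x‖ ^ 2} :=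
    isClosed_eq (hcont.norm.pow 2) (by fun_prop)
  have := closure_minimal (fun y hy => (hC y).unique (h y hy)) hc (hS x)
  rw [← show ‖C x‖ ^ 2 = ‖Q x‖ ^ 2 from this]
  exact hC x

/-! ### The fibre systems -/

/-- The system `|h|^{1/2} ρ_h(γ) Φ̂(h)`, parametrised by pairs of integers. -/
def fibreFrame (d : ℕ) (Φ : L2H) (h : ℝ) (n : ℤ × ℤ) : HS L2R :=
  ((Real.sqrt |h| : ℝ) : ℂ) • HS.lcomp (schrodinger h (latticePt d n 0)) (plancherelU Φ h)

theorem fibreCondition_iff {d : ℕ} (hd : 0 < d) (H : Submodule ℂ L2H) (Φ : L2H) (h : ℝ) :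
    FibreCondition d H Φ h ↔ (∀ n, fibreFrame d Φ h n ∈ HS.rightMul (projectionField H h)) ∧
      ∀ T ∈ HS.rightMul (projectionField H h),
        HasSum (fun n => ‖inner ℂ (fibreFrame d Φ h n) T‖ ^ 2) (‖T‖ ^ 2) := by
  rw [FibreCondition, IsNormalisedTightFrame, plancherel_eq_plancherelU]
  refine and_congr ?_ (forall₂_congr fun T _ => ?_)
  · rw [← (reducedLatticeEquiv hd).forall_congr_right]
    rfl
  · rw [← (reducedLatticeEquiv hd).hasSum_iff]
    rfl

/-- The squared coefficient carries `|h|²`: one factor normalises the fibre frame vectors, the other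
is the Plancherel density. -/
theorem enorm_fibreCoeff_sq (d : ℕ) (Φ f : L2H) (n : ℤ × ℤ) (h : ℝ) :
    ‖fibreCoeff d Φ f n h‖ₑ ^ 2
      = ENNReal.ofReal |h| * ‖inner ℂ (fibreFrame d Φ h n) (plancherelU f h)‖ₑ ^ 2 := by
  rw [enorm_sq_eq_ofReal, enorm_sq_eq_ofReal, ← ENNReal.ofReal_mul (abs_nonneg _)]
  congr 1
  rw [fibreCoeff, fibreFrame, inner_smul_left, norm_mul, norm_mul, Complex.conj_ofReal,
    Complex.norm_real, Complex.norm_real, Real.norm_of_nonneg (Real.sqrt_nonneg _), Real.norm_eq_abs,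
    abs_abs, mul_pow, mul_pow, Real.sq_sqrt (abs_nonneg _)]
  ring

theorem tsum_enorm_fibreCoeff_sq (d : ℕ) (Φ f : L2H) (h : ℝ) :
    ∑' n, ‖fibreCoeff d Φ f n h‖ₑ ^ 2 = ENNReal.ofReal |h| *
      ∑' n, ‖inner ℂ (fibreFrame d Φ h n) (plancherelU f h)‖ₑ ^ 2 := by
  simp_rw [enorm_fibreCoeff_sq]
  exact ENNReal.tsum_mul_left

theorem ofReal_norm_sq_eq_lintegral (f : L2H) :
    ENNReal.ofReal (‖f‖ ^ 2) = ∫⁻ h : ℝ, ENNReal.ofReal |h| * ‖plancherelU f h‖ₑ ^ 2 := by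
  rw [← plancherelU.norm_map, norm_sq_eq_lintegral, lintegral_plancherel]

/-! ### Equivalence of the frame properties of the lattice orbit and of the fibres -/

section LeftInvariant

variable {H : Submodule ℂ L2H} [CompleteSpace H]

theorem plancherelU_mem_rightMul (hinv : ∀ x : Heis, ∀ f ∈ H, leftReg x f ∈ H) {f : L2H}
    (hf : f ∈ H) : ∀ᵐ h : ℝ, plancherelU f h ∈ HS.rightMul (projectionField H h) := by
  filter_upwards [(isProjectionField_projectionField hinv).decomposes f f hf (by simp)] with h hh
  rw [plancherel_eq_plancherelU] at hh
  exact ⟨_, hh⟩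

theorem plancherelU_eq_zero_of_notMem (hinv : ∀ x : Heis, ∀ f ∈ H, leftReg x f ∈ H) {f : L2H}
    (hf : f ∈ H) : ∀ᵐ h : ℝ, h ∉ spectralSupport H → plancherelU f h = 0 := by
  filter_upwards [plancherelU_mem_rightMul hinv hf, ae_ne_zero] with h ⟨S, hS⟩ h0 hh
  have h1 : projectionField H h = 0 := by
    by_contra hne
    exact hh ⟨h0, hne⟩
  apply HS.toCLM_injective
  rw [hS, h1, ContinuousLinearMap.comp_zero, map_zero]

/-- The frame property of the fibres implies that of the lattice orbit. -/
theorem isNormalisedTightFrame_of_fibreCondition {d : ℕ} (hd : 0 < d)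
    (hinv : ∀ x : Heis, ∀ f ∈ H, leftReg x f ∈ H) {Φ : L2H} (hΦ : Φ ∈ H)
    (hfib : ∀ᵐ h : ℝ, h ∈ spectralSupport H → FibreCondition d H Φ h)
    (hsupp : SupportCondition H) :
    IsNormalisedTightFrame H (fun γ : lattice d => leftReg γ Φ) := by
  refine ⟨fun γ => hinv γ Φ hΦ, fun f hf => ?_⟩
  have hzero := plancherelU_eq_zero_of_notMem hinv hf
  have hsum : ∀ᵐ h : ℝ, ∑' n, ‖fibreCoeff d Φ f n h‖ₑ ^ 2
      = ENNReal.ofReal |h| * ‖plancherelU f h‖ₑ ^ 2 := by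
    filter_upwards [hfib, hzero, plancherelU_mem_rightMul hinv hf] with h h1 h2 h3
    rw [tsum_enorm_fibreCoeff_sq]
    by_cases hh : h ∈ spectralSupport H
    · rw [tsum_enorm_sq_of_hasSum (((fibreCondition_iff hd H Φ h).1 (h1 hh)).2 _ h3),
        enorm_sq_eq_ofReal]
    · simp [h2 hh]
  have hint : ∫⁻ h : ℝ, ∑' n, ‖fibreCoeff d Φ f n h‖ₑ ^ 2 = ENNReal.ofReal (‖f‖ ^ 2) := by
    rw [ofReal_norm_sq_eq_lintegral, lintegral_congr_ae hsum]
  refine hasSum_of_tsum_enorm_sq (by positivity) ?_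
  rw [← hint]
  refine tsum_enorm_inner_leftReg hd Φ f (fun n => ?_) fun n m hm => ?_
  -- A single coefficient is dominated by the sum over `n`, whose integral is already known to be
  -- `‖f‖²`.
  · rw [memLp_two_iff (integrable_fibreCoeff d Φ f n).1]
    refine lt_of_le_of_lt (lintegral_mono fun h =>
      ENNReal.le_tsum (f := fun n => ‖fibreCoeff d Φ f n h‖ₑ ^ 2) n) ?_
    rw [hint]
    exact ENNReal.ofReal_lt_top
  · have hs := hsupp (-m) (neg_ne_zero.2 hm)
    -- The sign is reversed because `x = -m + (m + x)`: if both `x` and `m + x` lie in the support,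
    -- then `x` lies in the intersection attached to `-m`.
    rw [measure_eq_zero_iff_ae_notMem] at hs
    filter_upwards [hs, hzero, (measurePreserving_add_left volume (m : ℝ)).quasiMeasurePreserving.ae
      hzero] with x h1 h2 h3
    by_cases hx : x ∈ spectralSupport H
    · right
      rw [fibreCoeff, h3 fun hx' => h1 ⟨hx, m + x, hx', by push_cast; ring⟩, inner_zero_right,
        mul_zero]
    · left
      rw [fibreCoeff, h2 hx, inner_zero_right, mul_zero]

/-- Project onto `H` the function whose transform is `T` on `A` and zero elsewhere. These functions
supply enough elements of `H` to reach every fibre. -/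
theorem exists_localised_field (hinv : ∀ x : Heis, ∀ f ∈ H, leftReg x f ∈ H) (T : HS L2R)
    {A : Set ℝ} (hA : MeasurableSet A) (hfin : plancherelMeasure A ≠ ∞) :
    ∃ f ∈ H, ∀ᵐ h : ℝ, plancherelU f h = A.indicator (fun h =>
      HS.rcomp ((isProjectionField_projectionField hinv).isStarProjection h) T) h := by
  set g : L2H := plancherelU.symm (indicatorConstLp 2 hA hfin T)
  refine ⟨H.starProjection g, Submodule.starProjection_apply_mem _ _, ?_⟩
  filter_upwards [(isProjectionField_projectionField hinv).decomposes g (H.starProjection g)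
    (Submodule.starProjection_apply_mem _ _) (Submodule.sub_starProjection_mem_orthogonal g),
    ae_plancherel_iff.1 (indicatorConstLp_coeFn (p := 2) (hs := hA) (hμs := hfin) (c := T))]
    with h h1 h2
  rw [plancherel_eq_plancherelU, plancherel_eq_plancherelU, plancherelU.apply_symm_apply, h2] at h1
  apply HS.toCLM_injective
  rw [h1]
  by_cases hh : h ∈ A
  · simp only [hh, Set.indicator_of_mem, HS.toCLM_rcomp]
  · simp [hh]

theorem plancherelMeasure_ne_top {A : Set ℝ} {k : ℤ} (hA : A ⊆ Set.Ico (k : ℝ) (k + 1)) :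
    plancherelMeasure A ≠ ∞ := by
  have : IsLocallyFiniteMeasure plancherelMeasure :=
    IsLocallyFiniteMeasure.withDensity_ofReal continuous_abs
  exact ((measure_mono hA).trans_lt measure_Ico_lt_top).ne

/-- Functions in `H` with transform supported in `B` have coefficients with disjoint integer
translates, since `B` lies in an interval of length one; no support condition on `H` enters. The
bound `N` makes these coefficients square integrable, which cannot yet be drawn from a fibrewise
identity. -/
theorem hasSum_fibreFrame_of_frame {d : ℕ} (hd : 0 < d)
    (hinv : ∀ x : Heis, ∀ f ∈ H, leftReg x f ∈ H) {Φ : L2H}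
    (hfr : IsNormalisedTightFrame H (fun γ : lattice d => leftReg γ Φ)) (T : HS L2R)
    {B : Set ℝ} (hB : MeasurableSet B) {k : ℤ} (hBk : B ⊆ Set.Ico (k : ℝ) (k + 1)) {N : ℝ}
    (hBN : ∀ h ∈ B, |h| * ‖plancherelU Φ h‖ ≤ N) :
    ∀ᵐ h : ℝ, h ∈ B → ∑' n, ‖inner ℂ (fibreFrame d Φ h n)
        (HS.rcomp ((isProjectionField_projectionField hinv).isStarProjection h) T)‖ₑ ^ 2
      = ‖HS.rcomp ((isProjectionField_projectionField hinv).isStarProjection h) T‖ₑ ^ 2 := by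
  set Q : ℝ → HS L2R := fun h =>
    HS.rcomp ((isProjectionField_projectionField hinv).isStarProjection h) T with hQ
  have hex : ∀ s : Set ℝ, MeasurableSet s → ∃ f ∈ H, ∀ᵐ h : ℝ, plancherelU f h
      = (s ∩ B).indicator Q h := fun s hs =>
    exists_localised_field hinv T (hs.inter hB)
      (plancherelMeasure_ne_top (Set.inter_subset_right.trans hBk))
  have hkey : ∀ f ∈ H, (∀ᵐ h : ℝ, ‖plancherelU f h‖ ≤ B.indicator (fun _ => ‖T‖) h) →
      ∫⁻ h : ℝ, ∑' n, ‖fibreCoeff d Φ f n h‖ₑ ^ 2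
        = ∫⁻ h : ℝ, ENNReal.ofReal |h| * ‖plancherelU f h‖ₑ ^ 2 := by
    intro f hf hfB
    rw [← ofReal_norm_sq_eq_lintegral, ← tsum_enorm_sq_of_hasSum (hfr.2 f hf)]
    have hz : ∀ᵐ h : ℝ, h ∉ B → plancherelU f h = 0 := by
      filter_upwards [hfB] with h hh hn
      rw [Set.indicator_of_notMem hn] at hh
      exact norm_le_zero_iff.1 hh
    symm
    refine tsum_enorm_inner_leftReg hd Φ f (fun n => ?_) fun n m hm => ?_
    · refine (memLp_indicator_const 2 hB (N * ‖T‖) (Or.inr ((measure_mono hBk).trans_lt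
        measure_Ico_lt_top).ne)).of_le (integrable_fibreCoeff d Φ f n).1 ?_
      filter_upwards [hfB] with h hh
      have h1 : ‖fibreCoeff d Φ f n h‖ ≤ |h| * ‖plancherelU Φ h‖ * ‖plancherelU f h‖ := by
        rw [fibreCoeff, norm_mul, Complex.norm_real, Real.norm_eq_abs, abs_abs, mul_assoc]
        refine mul_le_mul_of_nonneg_left ((norm_inner_le_norm _ _).trans_eq ?_) (abs_nonneg _)
        rw [HS.norm_lcomp_of_isometry (schrodinger_inner h _)]
      refine h1.trans ?_
      by_cases hb : h ∈ B
      · rw [Set.indicator_of_mem hb] at hh ⊢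
        refine le_trans ?_ (le_abs_self _)
        exact mul_le_mul (hBN h hb) hh (norm_nonneg _)
          (le_trans (by positivity) (hBN h hb))
      · rw [Set.indicator_of_notMem hb] at hh ⊢
        rw [norm_le_zero_iff.1 hh]
        simp
    · filter_upwards [hz, (measurePreserving_add_left volume
        (m : ℝ)).quasiMeasurePreserving.ae hz] with x h2 h3
      by_cases hx : x ∈ B
      · right
        rw [fibreCoeff, h3 fun hx' => ?_, inner_zero_right, mul_zero]
        -- Two points of a half-open interval of length one differ by less than one, so an integer
        -- difference `m` would be zero.
        have h4 := hBk hx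
        have h5 := hBk hx'
        rw [Set.mem_Ico] at h4 h5
        have h6 : (m : ℝ) < 1 := by linarith
        have h7 : (-1 : ℝ) < m := by linarith
        have h8 : m < 1 := by exact_mod_cast h6
        have h9 : -1 < m := by exact_mod_cast h7
        omega
      · left
        rw [fibreCoeff, h2 hx, inner_zero_right, mul_zero]
  have hQle : ∀ (s : Set ℝ) (h : ℝ), ‖(s ∩ B).indicator Q h‖ ≤ B.indicator (fun _ => ‖T‖) h := by
    intro s h
    by_cases hb : h ∈ B
    · rw [Set.indicator_of_mem hb]
      exact (norm_indicator_le_norm_self _ _).trans (HS.norm_rcomp_le _ T)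
    · rw [Set.indicator_of_notMem hb, Set.indicator_of_notMem fun hh => hb hh.2, norm_zero]
  obtain ⟨f, hf, hfQ⟩ := hex Set.univ MeasurableSet.univ
  rw [Set.univ_inter] at hfQ
  -- Replacing `f` by the function whose transform is cut off to `s` multiplies both integrands by
  -- `1_s`. The integrals therefore agree on every `s`, and so do the integrands.
  have hae : (fun h : ℝ => ∑' n, ‖fibreCoeff d Φ f n h‖ₑ ^ 2)
      =ᵐ[volume] fun h => ENNReal.ofReal |h| * ‖plancherelU f h‖ₑ ^ 2 := by
    refine ae_eq_of_forall_setLIntegral_eq_of_sigmaFinite₀ ?_ ?_ fun s hs _ => ?_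
    · exact AEMeasurable.tsum fun n =>
        (integrable_fibreCoeff d Φ f n).1.enorm.pow_const 2
    · exact (by fun_prop : Measurable fun h : ℝ => ENNReal.ofReal |h|).aemeasurable.mul
        ((aesm_plancherel_iff.1 (Lp.aestronglyMeasurable _)).enorm.pow_const 2)
    · obtain ⟨g, hg, hgQ⟩ := hex s hs
      have h1 := hkey g hg (by
        filter_upwards [hgQ] with h hh
        rw [hh]
        exact hQle s h)
      have hgf : ∀ᵐ h : ℝ, plancherelU g h = s.indicator (fun h => plancherelU f h) h := by
        filter_upwards [hfQ, hgQ] with h h2 h3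
        by_cases hhs : h ∈ s
        · rw [h3, Set.indicator_of_mem hhs, h2]
          by_cases hb : h ∈ B
          · rw [Set.indicator_of_mem hb, Set.indicator_of_mem (Set.mem_inter hhs hb)]
          · rw [Set.indicator_of_notMem hb, Set.indicator_of_notMem fun hh => hb hh.2]
        · rw [h3, Set.indicator_of_notMem hhs, Set.indicator_of_notMem fun hh => hhs hh.1]
      rw [← lintegral_indicator hs, ← lintegral_indicator hs]
      refine Eq.trans ?_ (h1.trans ?_)
      · apply lintegral_congr_ae
        filter_upwards [hgf] with h hh
        by_cases hhs : h ∈ s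
        · simp only [Set.indicator_of_mem hhs, fibreCoeff, hh]
        · simp [Set.indicator_of_notMem hhs, fibreCoeff, hh]
      · apply lintegral_congr_ae
        filter_upwards [hgf] with h hh
        by_cases hhs : h ∈ s
        · simp only [Set.indicator_of_mem hhs, hh]
        · simp [Set.indicator_of_notMem hhs, hh]
  filter_upwards [hae, hfQ, ae_ne_zero] with h h1 h2 h0 hb
  rw [tsum_enorm_fibreCoeff_sq, h2, Set.indicator_of_mem hb] at h1
  exact (ENNReal.mul_right_inj (by simpa using h0) ENNReal.ofReal_ne_top).1 h1

/-- The frame property of the lattice orbit implies that of almost every fibre. -/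
theorem fibreCondition_of_isNormalisedTightFrame {d : ℕ} (hd : 0 < d)
    (hinv : ∀ x : Heis, ∀ f ∈ H, leftReg x f ∈ H) {Φ : L2H} (hΦ : Φ ∈ H)
    (hfr : IsNormalisedTightFrame H (fun γ : lattice d => leftReg γ Φ)) :
    ∀ᵐ h : ℝ, FibreCondition d H Φ h := by
  have hP := (isProjectionField_projectionField hinv).isStarProjection
  have : TopologicalSpace.SeparableSpace (HS L2R) := HS.separableSpace (countable_basisIndex _)
  set u : ℕ → HS L2R := TopologicalSpace.denseSeq (HS L2R)
  have hall : ∀ᵐ h : ℝ, ∀ j, ∑' n, ‖inner ℂ (fibreFrame d Φ h n) (HS.rcomp (hP h) (u j))‖ₑ ^ 2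
      = ‖HS.rcomp (hP h) (u j)‖ₑ ^ 2 := by
    rw [ae_all_iff]
    intro j
    -- Bounding `|h| ‖Φ̂(h)‖` by `N` and confining `h` to `[k, k+1)` splits the line into countably
    -- many sets to which the local result applies.
    have hloc : ∀ (N : ℕ) (k : ℤ), ∀ᵐ h : ℝ,
        h ∈ {h | |h| * ‖plancherelU Φ h‖ ≤ N} ∩ Set.Ico (k : ℝ) (k + 1) →
        ∑' n, ‖inner ℂ (fibreFrame d Φ h n) (HS.rcomp (hP h) (u j))‖ₑ ^ 2
          = ‖HS.rcomp (hP h) (u j)‖ₑ ^ 2 := by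
      intro N k
      refine hasSum_fibreFrame_of_frame hd hinv hfr (u j) ?_ Set.inter_subset_right
        fun h hh => hh.1
      exact (measurableSet_le (measurable_abs.mul (Lp.stronglyMeasurable _).norm.measurable)
        measurable_const).inter measurableSet_Ico
    filter_upwards [ae_all_iff.2 fun N => ae_all_iff.2 (hloc N)] with h hh
    obtain ⟨N, hN⟩ := exists_nat_ge (|h| * ‖plancherelU Φ h‖)
    exact hh N ⌊h⌋ ⟨hN, Int.floor_le h, Int.lt_floor_add_one h⟩
  filter_upwards [hall, plancherelU_mem_rightMul hinv hΦ] with h h1 h2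
  have hmem : ∀ n, fibreFrame d Φ h n ∈ HS.rightMul (projectionField H h) := fun n =>
    Submodule.smul_mem _ _ (HS.lcomp_mem_rightMul _ h2)
  refine (fibreCondition_iff hd H Φ h).2 ⟨hmem, fun T hT => ?_⟩
  -- The dense sequence lives in the whole of `B₂`, not in the subspace `B₂ ∘ P_h`, which varies
  -- with `h`. As the frame vectors lie in that subspace, pairing them with `T` or with `T ∘ P_h`
  -- gives the same number, so the identity can be extended by density in `B₂` and then restricted.
  have h3 := hasSum_inner_sq_of_dense (η := fibreFrame d Φ h) (Q := HS.rcomp (hP h))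
    (HS.norm_rcomp_le (hP h)) (TopologicalSpace.denseRange_denseSeq (HS L2R)) (by
      rintro _ ⟨j, rfl⟩
      refine hasSum_of_tsum_enorm_sq (by positivity) ?_
      rw [← enorm_sq_eq_ofReal, ← h1 j]
      simp_rw [HS.inner_rcomp (hP h) (hmem _)]
      rfl) T
  rwa [HS.rcomp_of_mem (hP h) hT] at h3

end LeftInvariant

end HeisenbergSampling

end

theorem proposition5p1 (d : ℕ) (hd : 0 < d)
    (H : Submodule ℂ HeisenbergSampling.L2H) (hclosed : IsClosed (H : Set HeisenbergSampling.L2H))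
    (hinv : ∀ x : HeisenbergSampling.Heis, ∀ f ∈ H, HeisenbergSampling.leftReg x f ∈ H)
    (Φ : HeisenbergSampling.L2H) (hΦ : Φ ∈ H) :
    (HeisenbergSampling.IsNormalisedTightFrame H
        (fun γ : HeisenbergSampling.lattice d => HeisenbergSampling.leftReg γ Φ) →
      ∀ᵐ h : ℝ, HeisenbergSampling.FibreCondition d H Φ h) ∧
    ((∀ᵐ h : ℝ, h ∈ HeisenbergSampling.spectralSupport H →
        HeisenbergSampling.FibreCondition d H Φ h) →
      HeisenbergSampling.SupportCondition H →
      HeisenbergSampling.IsNormalisedTightFrame H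
        (fun γ : HeisenbergSampling.lattice d => HeisenbergSampling.leftReg γ Φ)) := by
  have : CompleteSpace H := hclosed.completeSpace_coe
  exact ⟨HeisenbergSampling.fibreCondition_of_isNormalisedTightFrame hd hinv hΦ,
    HeisenbergSampling.isNormalisedTightFrame_of_fibreCondition hd hinv hΦ⟩
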